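/- **Setting.** Let $M$ be a (Hausdorff) complex curve with a smooth foliation $\mathcal F$ of real codimension one. A transversal section is an embedded real curve in $M$ everywhere transverse to the leaves; a holonomy embedding $U\hookrightarrow U'$ of transversal sections is an embedding given by transport along leafwise paths. Let $\mathcal U$ be a transversal basis: a family of transversal sections such that for every transversal section $U'$ and $p\in U'$ there are $U\in\mathcal U$ and a holonomy embedding $h:U\hookrightarrow U'$ with $p\in h(U)$. Every $U\in\mathcal U$ carries a coordinate $t_U$, the restriction of a holomorphic chart of $M$ whose domain contains $U$. Let $V=\coprod_{n\in\mathbb Z}V_{(n)}$ be a quasi-conformal grading-restricted vertex algebra and $W=\coprod_{\alpha\in\mathbb C}W_{(\alpha)}$ a grading-restricted generalized $V$-module ($L_W(-1)$ being of weight one), $W'=\coprod W_{(\alpha)}^*$, $\overline W=\prod W_{(\alpha)}$, with projections $P_\alpha$. Matrix elements of products of vertex operators are understood as the rational functions to which the series converge. In particular $E_V(v_1,x_1;\ldots;v_k,x_k;\mathbf 1)\in\overline V$ and $E_W(v_1,x_1;\ldots;v_k,x_k;w)\in\overline W$ denote the elements with matrix elements given by the rational extensions of $\langle\,\cdot\,,Y(v_1,x_1)\cdots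 Y(v_k,x_k)\mathbf 1\rangle$, respectively $\langle\,\cdot\,,Y_W(v_1,x_1)\cdots Y_W(v_k,x_k)w\rangle$, from $|x_1|>\cdots>|x_k|>0$. **Cochains.** Consider linear maps $v\mapsto\Phi(v,\cdot)$ from $V$ to functions $\mathbb C\to\overline W$ such that every $\langle w',\Phi(v,z)\rangle$ is a polynomial in $z$, $\partial_z\langle w',\Phi(v,z)\rangle=\langle w',\Phi(L_V(-1)v,z)\rangle=\langle w',L_W(-1)\Phi(v,z)\rangle$, and $e^{aL_W(0)}\Phi(v,z)=\Phi(e^{aL_V(0)}v,e^az)$ for $a\in\mathbb C$. Such a $\Phi$ is *composable with $m$ vertex operators* for parameters in a set $D\subset\mathbb C^{m+1}$ if there are positive integers $N(u,v)$, depending only on $u,v\in V$, such that for all $v_1,\ldots,v_{m+1}\in V$, $w'\in W'$ each of the series $$\sum_{r}\langle w',\Phi(P_rE_V(v_1,z_1-\zeta;\ldots;v_{m+1},z_{m+1}-\zeta;\mathbf 1),\zeta)\rangle\quad(\zeta\in\mathbb C),$$ $$\sum_{q}\langle w',E_W(v_1,z_1;\ldots;v_m,z_m;P_q\Phi(v_{m+1},z_{m+1}))\rangle\quad(|z_i|>|z_{m+1}|>0,\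 i\le m)$$ converges absolutely, for all $z\in D$ with distinct entries, to a rational function of $z$ (independent of $\zeta$) whose only possible poles are at $z_i=z_j$, of order at most $N(v_i,v_j)$. Let $C^1_m(V,\mathcal W,\mathcal F)$, $m\ge 0$, consist of the $\Phi$ that, for every sequence $U_1\hookrightarrow\cdots\hookrightarrow U_m$ of holonomy embeddings between sections of $\mathcal U$ and every $1\le j\le m$, are composable with $m$ vertex operators for the parameters $(t_{U_1}(p'_1),\ldots,t_{U_m}(p'_m),t_{U_j}(p))$ with $p'_i\in U_i$, $p\in U_j$. For a section $U_r\in\mathcal U$ and $p'_r\in U_r$, the space $C^1_m(p'_r;V,\mathcal W,\mathcal F)$ is defined in the same way, using only sequences whose $r$-th section is the given $U_r$ and only parameters whose $r$-th entry is $t_{U_r}(p'_r)$. For $m=0$ there is no composability condition in either definition. **Cohomology and connections.** The two-point connection form of $\Phi$ is $$(\delta^1\Phi)(v_1,z_1;v_2,z_2)=Y_W(v_1,z_1)\Phi(v_2,z_2)-\Phi(Y_V(v_1,z_1-z_2)v_2,z_2)+Y_W(v_2,z_2)\Phi(v_1,z_1),$$ where each term stands for the rational function to which its matrix elements converge (in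 $|z_1|>|z_2|>0$, in $z_1\ne z_2$, and in $|z_2|>|z_1|>0$, respectively). Let $\ker\delta^1_m$ be the space of all $\Phi\in C^1_m(V,\mathcal W,\mathcal F)$ for which this form is defined and vanishes for all $z_1\neq z_2$; let $(\delta^0w)(v,z)=Y_W(v,z)w-Y_W(v,z)w$ on $C^0_{m+1}=W$, and $H^1_m(V,\mathcal W,\mathcal F)=\ker\delta^1_m/\operatorname{im}\delta^0_{m+1}$. Let $\mathcal Con_{p'_r}(m;V,\mathcal W)$ be the space of all $\Phi\in C^1_m(p'_r;V,\mathcal W,\mathcal F)$ whose form is defined and vanishes at $z_1=c(p'_r)$, $z_2=c(p)$, i.e. $$\Phi(Y_V(v_1,c(p'_r)-c(p))v_2,c(p))=Y_W(v_1,c(p'_r))\Phi(v_2,c(p))+Y_W(v_2,c(p))\Phi(v_1,c(p'_r)),$$ for all $v_1,v_2\in V$ and all points $p\ne p'_r$ in the domain of the holomorphic chart $c=t_{U_r}$. **Proposition.** For every $m\ge 0$, every $1\le r\le \max(m,1)$, every section $U_r\in\mathcal U$ and every point $p'_r\in U_r$, the map $[\Phi]\mapsto\Phi$ is a well-defined linear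 isomorphism $$H^1_m(V,\mathcal W,\mathcal F)\;\cong\;\mathcal Con_{p'_r}(m;V,\mathcal W).$$ -/

import Mathlib

open scoped Manifold ContDiff

noncomputable section

namespace FoliationVertex

/-! ## Graded spaces, restricted duals and algebraic completions -/

section Graded

variable {ι W : Type*} [AddCommGroup W] [Module ℂ W]

/-- The restricted dual `W' = ∐ W_(α)^*`: linear functionals on `W = ∐ W_(α)` that vanish on all
but finitely many of the homogeneous subspaces. -/
def restrictedDual (gr : ι → Submodule ℂ W) : Submodule ℂ (Module.Dual ℂ W) where
  carrier := {f | {α | ∃ w ∈ gr α, f w ≠ 0}.Finite}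
  zero_mem' := by simp
  add_mem' := by
    intro f g hf hg
    refine (hf.union hg).subset ?_
    rintro α ⟨w, hw, h⟩
    by_cases h1 : f w = 0
    · exact Or.inr ⟨w, hw, by simpa [h1] using h⟩
    · exact Or.inl ⟨w, hw, h1⟩
  smul_mem' := by
    intro c f hf
    refine hf.subset ?_
    rintro α ⟨w, hw, h⟩
    exact ⟨w, hw, fun h0 => h (by simp [h0])⟩

/-- The algebraic completion `∏ W_(α)`. For `x` in it, `x.1 α` is the projection `P_α x`. -/
def Completion (gr : ι → Submodule ℂ W) : Type _ := ↥(Submodule.pi Set.univ gr)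

instance (gr : ι → Submodule ℂ W) : AddCommGroup (Completion gr) :=
  inferInstanceAs (AddCommGroup ↥(Submodule.pi Set.univ gr))

instance (gr : ι → Submodule ℂ W) : Module ℂ (Completion gr) :=
  inferInstanceAs (Module ℂ ↥(Submodule.pi Set.univ gr))

@[simp]
theorem Completion.zero_val {gr : ι → Submodule ℂ W} : (0 : Completion gr).1 = 0 := rfl

@[simp]
theorem Completion.add_val {gr : ι → Submodule ℂ W} (x y : Completion gr) :
    (x + y).1 = x.1 + y.1 := rfl

@[simp]
theorem Completion.smul_val {gr : ι → Submodule ℂ W} (c : ℂ) (x : Completion gr) :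
    (c • x).1 = c • x.1 := rfl

/-- The evaluation pairing between `W'` and the algebraic completion of `W` (a finite sum). -/
def pair {gr : ι → Submodule ℂ W} (w' : restrictedDual gr) (x : Completion gr) : ℂ :=
  ∑ᶠ α, (w' : Module.Dual ℂ W) (x.1 α)

theorem pair_finite {gr : ι → Submodule ℂ W} (w' : restrictedDual gr) (x : Completion gr) :
    (Function.support fun α => (w' : Module.Dual ℂ W) (x.1 α)).Finite :=
  w'.2.subset fun α h => ⟨x.1 α, x.2 α (Set.mem_univ α), h⟩

theorem pair_add {gr : ι → Submodule ℂ W} (w' : restrictedDual gr) (x y : Completion gr) :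
    pair w' (x + y) = pair w' x + pair w' y := by
  unfold pair
  rw [← finsum_add_distrib (pair_finite w' x) (pair_finite w' y)]
  simp

theorem pair_smul {gr : ι → Submodule ℂ W} (w' : restrictedDual gr) (c : ℂ) (x : Completion gr) :
    pair w' (c • x) = c * pair w' x := by
  unfold pair
  rw [← smul_eq_mul, smul_finsum]
  simp

theorem pair_zero {gr : ι → Submodule ℂ W} (w' : restrictedDual gr) :
    pair w' (0 : Completion gr) = 0 := by
  simp [pair]

/-- The homogeneous component of index `i` of an element of `W = ∐ W_(i)`. -/
def homComponent [DecidableEq ι] {gr : ι → Submodule ℂ W} (h : DirectSum.IsInternal gr) (i : ι) :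
    W →ₗ[ℂ] W :=
  (gr i).subtype ∘ₗ DirectSum.component ℂ ι (fun i => gr i) i ∘ₗ
    (LinearEquiv.ofBijective (DirectSum.coeLinearMap gr) h).symm.toLinearMap

end Graded

/-! ## Rational functions and values of rational extensions -/

/-- `c = R(f)(z)`: the series `∑ i, s i x` converges absolutely for every `x` in `U` to one and the
same rational function of `x`, this rational function is regular at `z`, and `c` is its value
there. (Summability in `ℂ` is absolute summability.) -/
def RationalValue {κ : Type*} {k : ℕ} (U : Set (Fin k → ℂ)) (s : κ → (Fin k → ℂ) → ℂ)
    (z : Fin k → ℂ) (c : ℂ) : Prop :=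
  ∃ P Q : MvPolynomial (Fin k) ℂ,
    (∀ x ∈ U, MvPolynomial.eval x Q ≠ 0 ∧
      HasSum (fun i => s i x) (MvPolynomial.eval x P / MvPolynomial.eval x Q)) ∧
    MvPolynomial.eval z Q ≠ 0 ∧ c = MvPolynomial.eval z P / MvPolynomial.eval z Q

theorem RationalValue.add {κ : Type*} {k : ℕ} {U : Set (Fin k → ℂ)}
    {s t r : κ → (Fin k → ℂ) → ℂ} {z : Fin k → ℂ} {c d : ℂ}
    (h : RationalValue U s z c) (h' : RationalValue U t z d)
    (hr : ∀ i x, r i x = s i x + t i x) : RationalValue U r z (c + d) := by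
  obtain ⟨P, Q, h1, h2, h3⟩ := h
  obtain ⟨P', Q', h1', h2', h3'⟩ := h'
  refine ⟨P * Q' + P' * Q, Q * Q', fun x hx => ⟨?_, ?_⟩, ?_, ?_⟩
  · simpa using ⟨(h1 x hx).1, (h1' x hx).1⟩
  · have a := (h1 x hx).1
    have b := (h1' x hx).1
    convert (h1 x hx).2.add (h1' x hx).2 using 1
    · funext i; exact hr i x
    · simp only [map_add, map_mul]; field_simp
  · simpa using ⟨h2, h2'⟩
  · rw [h3, h3']; simp only [map_add, map_mul]; field_simp

theorem RationalValue.smul {κ : Type*} {k : ℕ} {U : Set (Fin k → ℂ)}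
    {s r : κ → (Fin k → ℂ) → ℂ} {z : Fin k → ℂ} {c : ℂ} (a : ℂ)
    (h : RationalValue U s z c) (hr : ∀ i x, r i x = a * s i x) :
    RationalValue U r z (a * c) := by
  obtain ⟨P, Q, h1, h2, h3⟩ := h
  refine ⟨MvPolynomial.C a * P, Q, fun x hx => ⟨(h1 x hx).1, ?_⟩, h2, ?_⟩
  · have h := (h1 x hx).2.mul_left a
    simp only [← hr] at h
    simpa [mul_div_assoc] using h
  · rw [h3]; simp [mul_div_assoc]

theorem RationalValue.zero {κ : Type*} {k : ℕ} {U : Set (Fin k → ℂ)}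
    {r : κ → (Fin k → ℂ) → ℂ} {z : Fin k → ℂ} (hr : ∀ i x, r i x = 0) :
    RationalValue U r z 0 :=
  ⟨0, 1, fun x _ => ⟨by simp, by simp [hr, hasSum_zero]⟩, by simp, by simp⟩

/-- The region `|x_1| > |x_2| > ⋯ > |x_k| > 0`. -/
def orderedRegion (k : ℕ) : Set (Fin k → ℂ) :=
  {x | (∀ i j, i < j → ‖x j‖ < ‖x i‖) ∧ ∀ i, 0 < ‖x i‖}

/-- The denominator `∏_{i<j} (z_i - z_j)^{N(v_i, v_j)}`. -/
def poleDenominator {V : Type*} {k : ℕ} (N : V → V → ℕ+) (v : Fin k → V) (z : Fin k → ℂ) : ℂ :=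
  ∏ i, ∏ j ∈ Finset.Ioi i, (z i - z j) ^ (N (v i) (v j) : ℕ)

/-! ## Grading-restricted vertex algebras and their modules -/

section Vertex

set_option linter.unusedSectionVars false

variable {V W : Type*} [AddCommGroup V] [Module ℂ V] [AddCommGroup W] [Module ℂ W]

/-- The mode `v(n)` in `Y(v, z) = ∑ v(n) z^{-n-1}`. -/
abbrev mode (Y : V →ₗ[ℂ] VertexOperator ℂ W) (v : V) (n : ℤ) : Module.End ℂ W :=
  VertexOperator.ncoeff (Y v) n

/-- Duality: the products in both orders and the iterate of two vertex operators converge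
absolutely, in their regions, to a common rational function with poles at most at
`z_1 = 0`, `z_2 = 0`, `z_1 = z_2`. -/
def Duality {ι : Type*} (YV : V →ₗ[ℂ] VertexOperator ℂ V) (YW : V →ₗ[ℂ] VertexOperator ℂ W)
    (gr : ι → Submodule ℂ W) : Prop :=
  ∀ (u₁ u₂ : V) (w : W), ∀ w' ∈ restrictedDual gr,
    ∃ (P : MvPolynomial (Fin 2) ℂ) (k : ℕ), ∀ z₁ z₂ : ℂ,
      (0 < ‖z₂‖ → ‖z₂‖ < ‖z₁‖ →
        HasSum (fun n : ℤ × ℤ =>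
            w' (mode YW u₁ n.1 (mode YW u₂ n.2 w)) * z₁ ^ (-n.1 - 1) * z₂ ^ (-n.2 - 1))
          (MvPolynomial.eval ![z₁, z₂] P / (z₁ * z₂ * (z₁ - z₂)) ^ k)) ∧
      (0 < ‖z₁‖ → ‖z₁‖ < ‖z₂‖ →
        HasSum (fun n : ℤ × ℤ =>
            w' (mode YW u₂ n.2 (mode YW u₁ n.1 w)) * z₁ ^ (-n.1 - 1) * z₂ ^ (-n.2 - 1))
          (MvPolynomial.eval ![z₁, z₂] P / (z₁ * z₂ * (z₁ - z₂)) ^ k)) ∧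
      (0 < ‖z₁ - z₂‖ → ‖z₁ - z₂‖ < ‖z₂‖ →
        HasSum (fun n : ℤ × ℤ =>
            w' (mode YW (mode YV u₁ n.1 u₂) n.2 w) * (z₁ - z₂) ^ (-n.1 - 1) * z₂ ^ (-n.2 - 1))
          (MvPolynomial.eval ![z₁, z₂] P / (z₁ * z₂ * (z₁ - z₂)) ^ k))

variable (V) in
/-- A grading-restricted vertex algebra. Lower truncation is built into `VertexOperator`. -/
structure GradingRestrictedVertexAlgebra where
  /-- the vertex operator map -/
  Y : V →ₗ[ℂ] VertexOperator ℂ V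
  /-- the vacuum -/
  one : V
  /-- the homogeneous subspaces `V_(n)` -/
  gr : ℤ → Submodule ℂ V
  internal : DirectSum.IsInternal gr
  finite_dim : ∀ n, FiniteDimensional ℂ (gr n)
  bounded_below : ∃ N : ℤ, ∀ n < N, gr n = ⊥
  identity : ∀ (n : ℤ) (v : V), mode Y one n v = if n = -1 then v else 0
  creation : ∀ (u : V) (n : ℤ), 0 ≤ n → mode Y u n one = 0
  creation_limit : ∀ u : V, mode Y u (-1) one = u
  duality : Duality Y Y gr
  /-- the grading operator `L(0)` -/
  L0 : Module.End ℂ V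
  L0_apply : ∀ (n : ℤ), ∀ v ∈ gr n, L0 v = (n : ℂ) • v
  L0_bracket : ∀ (u v : V) (n : ℤ),
    L0 (mode Y u n v) - mode Y u n (L0 v) = mode Y (L0 u) n v + (-(n : ℂ) - 1) • mode Y u n v
  /-- `d/dz Y(u, z) = Y(L(-1)u, z)` with `L(-1)u = u(-2)1` -/
  derivative : ∀ (u v : V) (n : ℤ),
    mode Y (mode Y u (-2) one) n v = (-(n : ℂ)) • mode Y u (n - 1) v
  /-- `d/dz Y(u, z) = [L(-1), Y(u, z)]` -/
  derivative_bracket : ∀ (u v : V) (n : ℤ),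
    mode Y (mode Y u n v) (-2) one - mode Y u n (mode Y v (-2) one) =
      (-(n : ℂ)) • mode Y u (n - 1) v

namespace GradingRestrictedVertexAlgebra

variable (A : GradingRestrictedVertexAlgebra V)

/-- `L(-1)v = v(-2)1`. -/
def Lm1 (v : V) : V := mode A.Y v (-2) A.one

/-- `e^{a L(0)} v`, that is `z^{L(0)} v` for `z = e^a`. -/
def expL0 (a : ℂ) (v : V) : V :=
  ∑ᶠ n : ℤ, Complex.exp (a * n) • homComponent A.internal n v

/-- Quasi-conformality: an action of the Lie algebra of vector fields `β(z)∂_z` on the formal disc,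
with `L n` the operator of `-z^n ∂_z` (usually called `L_{n-1}`), such that
`[L_{n-1}, Y(u, z)] = ∑_i binom(n, i) z^{n-i} Y(L_{i-1} u, z)`, the operator `L_{-1}` is the
translation operator, `L_0` is the grading operator, and the subalgebra spanned by the
`L_n` with `n > 0` acts locally nilpotently. -/
def IsQuasiConformal : Prop :=
  ∃ L : ℕ → Module.End ℂ V,
    (∀ v, L 0 v = A.Lm1 v) ∧ L 1 = A.L0 ∧
    (∀ m n, L m * L n - L n * L m = ((m : ℂ) - n) • L (m + n - 1)) ∧
    (∀ (n : ℕ) (u v : V) (k : ℤ),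
      L n (mode A.Y u k v) - mode A.Y u k (L n v) =
        ∑ i ∈ Finset.range (n + 1), (n.choose i : ℂ) • mode A.Y (L i u) (k + n - i) v) ∧
    ∀ v, ∃ K : ℕ, ∀ l : List ℕ, K ≤ l.sum → (l.map fun n => if n = 0 then 1 else L (n + 1)).prod v = 0

variable (W) in
/-- A grading-restricted generalized module. -/
structure GeneralizedModule where
  /-- the vertex operator map -/
  Y : V →ₗ[ℂ] VertexOperator ℂ W
  /-- the operator `L_W(0)` -/
  L0 : Module.End ℂ W
  /-- the operator `L_W(-1)` -/
  Lm1 : Module.End ℂ W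
  /-- the homogeneous subspaces `W_(α)` -/
  gr : ℂ → Submodule ℂ W
  internal : DirectSum.IsInternal gr
  bounded_below : ∃ N : ℝ, ∀ α : ℂ, α.re < N → gr α = ⊥
  identity : ∀ (n : ℤ) (w : W), mode Y A.one n w = if n = -1 then w else 0
  duality : Duality A.Y Y gr
  L0_bracket : ∀ (u : V) (w : W) (n : ℤ),
    L0 (mode Y u n w) - mode Y u n (L0 w) = mode Y (A.L0 u) n w + (-(n : ℂ) - 1) • mode Y u n w
  L0_grading : ∀ (α : ℂ), ∀ w ∈ gr α, ∃ N : ℕ, ((L0 - α • (1 : Module.End ℂ W)) ^ N) w = 0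
  /-- `L_W(-1)` is an operator of weight one -/
  Lm1_weight : ∀ (α : ℂ), ∀ w ∈ gr α, Lm1 w ∈ gr (α + 1)
  derivative : ∀ (u : V) (w : W) (n : ℤ),
    mode Y (A.Lm1 u) n w = (-(n : ℂ)) • mode Y u (n - 1) w
  derivative_bracket : ∀ (u : V) (w : W) (n : ℤ),
    Lm1 (mode Y u n w) - mode Y u n (Lm1 w) = (-(n : ℂ)) • mode Y u (n - 1) w

end GradingRestrictedVertexAlgebra

open GradingRestrictedVertexAlgebra

variable {A : GradingRestrictedVertexAlgebra V}

namespace GradingRestrictedVertexAlgebra.GeneralizedModule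

variable (B : A.GeneralizedModule W)

/-- The action of `L_W(-1)` on the algebraic completion. -/
def Lm1Bar (x : Completion B.gr) : Completion B.gr :=
  ⟨fun α => B.Lm1 (x.1 (α - 1)), fun α _ => by
    simpa using B.Lm1_weight (α - 1) _ (x.2 (α - 1) (Set.mem_univ _))⟩

/-- The component of index `α` of `e^{a L_W(0)} x`, where `x` has the component `w ∈ W_(α)`:
`e^{aα} ∑_k a^k / k! (L_W(0) - α)^k w`, a finite sum. -/
def expL0Component (a α : ℂ) (w : W) : W :=
  Complex.exp (a * α) •
    ∑ᶠ k : ℕ, (a ^ k / (k.factorial : ℂ)) • ((B.L0 - α • (1 : Module.End ℂ W)) ^ k) w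

/-- `Y_W(v, z)w` as an element of the algebraic completion, for `z ≠ 0`. -/
def actBar (v : V) (z : ℂ) (w : W) : Completion B.gr :=
  ⟨fun α => ∑ᶠ n : ℤ, z ^ (-n - 1) • homComponent B.internal α (mode B.Y v n w), fun α _ =>
    finsum_induction (fun x => x ∈ B.gr α) (Submodule.zero_mem _)
      (fun _ _ => Submodule.add_mem _)
      (fun _ => Submodule.smul_mem _ _ (by simp [homComponent]))⟩

/-! ## Cochains with one entry -/

/-- Linear maps `v ↦ Φ(v, ·)` from `V` to functions on `F_1 ℂ = ℂ` with values in the completion of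
`W`; here `Φ z v` stands for `Φ(v, z)`. A form `Φ(dz^{wt v} ⊗ v, z)` is represented by its
coefficient function. -/
abbrev Cochain : Type _ := ℂ → V →ₗ[ℂ] Completion B.gr

/-- `Φ` takes values in the space `𝒲_z`: it is rational in `z` without poles (for one variable
there is no diagonal `z_i = z_j`) and has the two `L(-1)`-derivative properties and the
`L(0)`-conjugation property. With one entry the shuffle condition is empty. -/
structure IsWValued (Φ : Cochain B) : Prop where
  rational : ∀ (v : V) (w' : restrictedDual B.gr), ∃ p : Polynomial ℂ, ∀ z, pair w' (Φ z v) = p.eval z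
  derivative_V : ∀ (v : V) (w' : restrictedDual B.gr) (z : ℂ),
    HasDerivAt (fun x => pair w' (Φ x v)) (pair w' (Φ z (A.Lm1 v))) z
  derivative_W : ∀ (v : V) (w' : restrictedDual B.gr) (z : ℂ),
    HasDerivAt (fun x => pair w' (Φ x v)) (pair w' (B.Lm1Bar (Φ z v))) z
  conjugation : ∀ (a : ℂ) (v : V) (z α : ℂ),
    B.expL0Component a α ((Φ z v).1 α) = (Φ (Complex.exp a * z) (A.expL0 a v)).1 α

/-- `x = E_V(v_1, y_1; …; v_k, y_k; 1)`: the element of the completion of `V` whose matrix elements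
are the values at `y` of the rational functions to which the series
`⟨v', Y(v_1, x_1) ⋯ Y(v_k, x_k) 1⟩` converge for `|x_1| > ⋯ > |x_k| > 0`. -/
def IsVacuumCorrelator (A : GradingRestrictedVertexAlgebra V) {k : ℕ} (v : Fin k → V)
    (y : Fin k → ℂ) (x : Completion A.gr) : Prop :=
  ∀ v' : restrictedDual A.gr,
    RationalValue (orderedRegion k)
      (fun (n : Fin k → ℤ) y' => (v' : Module.Dual ℂ V)
        ((List.ofFn fun i => mode A.Y (v i) (n i)).prod A.one) * ∏ i, y' i ^ (-n i - 1))
      y (pair v' x)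

/-- `c = ⟨w', E_W(v_1, y_1; …; v_k, y_k; w)⟩`: the value at `y` of the rational function to which
`⟨w', Y_W(v_1, x_1) ⋯ Y_W(v_k, x_k) w⟩` converges for `|x_1| > ⋯ > |x_k| > 0`. -/
def IsCorrelatorValue {k : ℕ} (v : Fin k → V) (w : W) (w' : restrictedDual B.gr)
    (y : Fin k → ℂ) (c : ℂ) : Prop :=
  RationalValue (orderedRegion k)
    (fun (n : Fin k → ℤ) y' => (w' : Module.Dual ℂ W)
      ((List.ofFn fun i => mode B.Y (v i) (n i)).prod w) * ∏ i, y' i ^ (-n i - 1))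
    y c

/-- For all parameters `z ∈ D` with distinct entries, the value `c` with `rel v w' z c` is given by
a rational function of `z` (depending on `v` and `w'`), whose only possible poles are at
`z_i = z_j`, of order at most `N(v_i, v_j)` with positive integers depending only on
`v_i` and `v_j`. -/
def GivenByRationalFunction {k : ℕ} (D : Set (Fin k → ℂ))
    (rel : (Fin k → V) → restrictedDual B.gr → (Fin k → ℂ) → ℂ → Prop) : Prop :=
  ∃ N : V → V → ℕ+, ∀ (v : Fin k → V) (w' : restrictedDual B.gr),
    ∃ P : MvPolynomial (Fin k) ℂ, ∀ z ∈ D, Function.Injective z →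
      rel v w' z (MvPolynomial.eval z P / poleDenominator N v z)

/-- `c = ∑_r ⟨w', Φ(P_r E_V(v_1, z_1 - ζ; …; v_k, z_k - ζ; 1), ζ)⟩`, absolutely convergent, for
all `ζ`. -/
def IsSumI {k : ℕ} (Φ : Cochain B) (v : Fin k → V) (w' : restrictedDual B.gr) (z : Fin k → ℂ)
    (c : ℂ) : Prop :=
  ∀ (ζ : ℂ) (x : Completion A.gr), IsVacuumCorrelator A v (fun i => z i - ζ) x →
    HasSum (fun r : ℤ => pair w' (Φ ζ (x.1 r))) c

/-- If `|z_i| > |z_{m+1}| > 0` for `i ≤ m`, then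
`c = ∑_q ⟨w', E_W(v_1, z_1; …; v_m, z_m; P_q Φ(v_{m+1}, z_{m+1}))⟩`, absolutely convergent. -/
def IsSumJ {m : ℕ} (Φ : Cochain B) (v : Fin (m + 1) → V) (w' : restrictedDual B.gr)
    (z : Fin (m + 1) → ℂ) (c : ℂ) : Prop :=
  (∀ i : Fin m, ‖z (Fin.last m)‖ < ‖z i.castSucc‖) → 0 < ‖z (Fin.last m)‖ →
    ∃ e : ℂ → ℂ,
      (∀ q : ℂ, IsCorrelatorValue B (fun i : Fin m => v i.castSucc)
        ((Φ (z (Fin.last m)) (v (Fin.last m))).1 q) w' (fun i => z i.castSucc) (e q)) ∧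
      HasSum e c

/-- `Φ` is composable with `m` vertex operators, where the parameters `z_1, …, z_m` of the vertex
operators and `z_{m+1}` of `Φ` are restricted to `D`. -/
def ComposableOn {m : ℕ} (D : Set (Fin (m + 1) → ℂ)) (Φ : Cochain B) : Prop :=
  GivenByRationalFunction B D (IsSumI B Φ) ∧ GivenByRationalFunction B D (IsSumJ B Φ)

/-! ### Linearity of these conditions -/

theorem poleDenominator_ne_zero {k : ℕ} (N : V → V → ℕ+) (v : Fin k → V) {z : Fin k → ℂ}
    (hz : Function.Injective z) : poleDenominator N v z ≠ 0 := by
  refine Finset.prod_ne_zero_iff.2 fun i _ => Finset.prod_ne_zero_iff.2 fun j hj => ?_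
  exact pow_ne_zero _ (sub_ne_zero.2 fun h => (Finset.mem_Ioi.1 hj).ne (hz h))

/-- The denominator as a polynomial. -/
def polePolynomial {k : ℕ} (N : V → V → ℕ+) (v : Fin k → V) : MvPolynomial (Fin k) ℂ :=
  ∏ i, ∏ j ∈ Finset.Ioi i, (MvPolynomial.X i - MvPolynomial.X j) ^ (N (v i) (v j) : ℕ)

theorem eval_polePolynomial {k : ℕ} (N : V → V → ℕ+) (v : Fin k → V) (z : Fin k → ℂ) :
    MvPolynomial.eval z (polePolynomial N v) = poleDenominator N v z := by
  simp [polePolynomial, poleDenominator]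

theorem poleDenominator_add {k : ℕ} (N N' : V → V → ℕ+) (v : Fin k → V) (z : Fin k → ℂ) :
    poleDenominator (fun a b => N a b + N' a b) v z =
      poleDenominator N v z * poleDenominator N' v z := by
  simp [poleDenominator, pow_add, Finset.prod_mul_distrib]

variable {B}

theorem GivenByRationalFunction.add {k : ℕ} {D : Set (Fin k → ℂ)}
    {r s t : (Fin k → V) → restrictedDual B.gr → (Fin k → ℂ) → ℂ → Prop}
    (hr : GivenByRationalFunction B D r) (hs : GivenByRationalFunction B D s)
    (h : ∀ v w' z c d, r v w' z c → s v w' z d → t v w' z (c + d)) :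
    GivenByRationalFunction B D t := by
  obtain ⟨N, hN⟩ := hr
  obtain ⟨N', hN'⟩ := hs
  refine ⟨fun a b => N a b + N' a b, fun v w' => ?_⟩
  obtain ⟨P, hP⟩ := hN v w'
  obtain ⟨P', hP'⟩ := hN' v w'
  refine ⟨P * polePolynomial N' v + P' * polePolynomial N v, fun z hz hi => ?_⟩
  have a := poleDenominator_ne_zero N v hi
  have b := poleDenominator_ne_zero N' v hi
  convert h v w' z _ _ (hP z hz hi) (hP' z hz hi) using 1
  rw [poleDenominator_add]
  simp only [map_add, map_mul, eval_polePolynomial]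
  field_simp

theorem GivenByRationalFunction.smul {k : ℕ} {D : Set (Fin k → ℂ)} (a : ℂ)
    {r t : (Fin k → V) → restrictedDual B.gr → (Fin k → ℂ) → ℂ → Prop}
    (hr : GivenByRationalFunction B D r)
    (h : ∀ v w' z c, r v w' z c → t v w' z (a * c)) :
    GivenByRationalFunction B D t := by
  obtain ⟨N, hN⟩ := hr
  refine ⟨N, fun v w' => ?_⟩
  obtain ⟨P, hP⟩ := hN v w'
  refine ⟨MvPolynomial.C a * P, fun z hz hi => ?_⟩
  convert h v w' z _ (hP z hz hi) using 1
  simp [mul_div_assoc]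

theorem GivenByRationalFunction.zero {k : ℕ} {D : Set (Fin k → ℂ)}
    {t : (Fin k → V) → restrictedDual B.gr → (Fin k → ℂ) → ℂ → Prop}
    (h : ∀ v w' z, t v w' z 0) : GivenByRationalFunction B D t :=
  ⟨fun _ _ => 1, fun v w' => ⟨0, fun z _ _ => by simpa using h v w' z⟩⟩

theorem IsSumI.add {k : ℕ} {Φ Ψ : Cochain B} {v : Fin k → V} {w' : restrictedDual B.gr}
    {z : Fin k → ℂ} {c d : ℂ} (h : IsSumI B Φ v w' z c) (h' : IsSumI B Ψ v w' z d) :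
    IsSumI B (Φ + Ψ) v w' z (c + d) := fun ζ x hx => by
  simpa [pair_add] using (h ζ x hx).add (h' ζ x hx)

theorem IsSumI.smul {k : ℕ} {Φ : Cochain B} {v : Fin k → V} {w' : restrictedDual B.gr}
    {z : Fin k → ℂ} {c : ℂ} (a : ℂ) (h : IsSumI B Φ v w' z c) :
    IsSumI B (a • Φ) v w' z (a * c) := fun ζ x hx => by
  simpa [pair_smul] using (h ζ x hx).mul_left a

theorem IsSumJ.add {m : ℕ} {Φ Ψ : Cochain B} {v : Fin (m + 1) → V} {w' : restrictedDual B.gr}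
    {z : Fin (m + 1) → ℂ} {c d : ℂ} (h : IsSumJ B Φ v w' z c) (h' : IsSumJ B Ψ v w' z d) :
    IsSumJ B (Φ + Ψ) v w' z (c + d) := fun h1 h2 => by
  obtain ⟨e, he, hs⟩ := h h1 h2
  obtain ⟨e', he', hs'⟩ := h' h1 h2
  exact ⟨fun q => e q + e' q,
    fun q => RationalValue.add (he q) (he' q) fun n y => by simp [add_mul], hs.add hs'⟩

theorem IsSumJ.smul {m : ℕ} {Φ : Cochain B} {v : Fin (m + 1) → V} {w' : restrictedDual B.gr}
    {z : Fin (m + 1) → ℂ} {c : ℂ} (a : ℂ) (h : IsSumJ B Φ v w' z c) :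
    IsSumJ B (a • Φ) v w' z (a * c) := fun h1 h2 => by
  obtain ⟨e, he, hs⟩ := h h1 h2
  exact ⟨fun q => a * e q,
    fun q => RationalValue.smul a (he q) fun n y => by simp [mul_assoc], hs.mul_left a⟩

theorem ComposableOn.add {m : ℕ} {D : Set (Fin (m + 1) → ℂ)} {Φ Ψ : Cochain B}
    (h : ComposableOn B D Φ) (h' : ComposableOn B D Ψ) : ComposableOn B D (Φ + Ψ) :=
  ⟨h.1.add h'.1 fun _ _ _ _ _ => IsSumI.add, h.2.add h'.2 fun _ _ _ _ _ => IsSumJ.add⟩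

theorem ComposableOn.smul {m : ℕ} {D : Set (Fin (m + 1) → ℂ)} {Φ : Cochain B} (a : ℂ)
    (h : ComposableOn B D Φ) : ComposableOn B D (a • Φ) :=
  ⟨h.1.smul a fun _ _ _ _ => IsSumI.smul a, h.2.smul a fun _ _ _ _ => IsSumJ.smul a⟩

theorem ComposableOn.zero {m : ℕ} {D : Set (Fin (m + 1) → ℂ)} :
    ComposableOn B D (0 : Cochain B) :=
  ⟨GivenByRationalFunction.zero fun v w' z ζ x _ => by simp [pair_zero, hasSum_zero],
    GivenByRationalFunction.zero fun v w' z _ _ =>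
      ⟨fun _ => 0, fun q => RationalValue.zero fun n y => by simp, hasSum_zero⟩⟩

theorem expL0_finite (a α : ℂ) {w : W} (hw : w ∈ B.gr α) :
    (Function.support fun k : ℕ =>
      (a ^ k / (k.factorial : ℂ)) • ((B.L0 - α • (1 : Module.End ℂ W)) ^ k) w).Finite := by
  obtain ⟨N, hN⟩ := B.L0_grading α w hw
  refine (Set.finite_lt_nat N).subset fun k hk => ?_
  by_contra hlt
  apply hk
  obtain ⟨j, rfl⟩ := Nat.exists_eq_add_of_le (not_lt.1 hlt)
  have h0 : ((B.L0 - α • (1 : Module.End ℂ W)) ^ (N + j)) w = 0 := by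
    rw [add_comm N j, pow_add (B.L0 - α • (1 : Module.End ℂ W)), Module.End.mul_apply, hN, map_zero]
  simp only [h0, smul_zero]

theorem Lm1Bar_add (x y : Completion B.gr) : B.Lm1Bar (x + y) = B.Lm1Bar x + B.Lm1Bar y :=
  Subtype.ext (funext fun _ => map_add B.Lm1 _ _)

theorem Lm1Bar_smul (a : ℂ) (x : Completion B.gr) : B.Lm1Bar (a • x) = a • B.Lm1Bar x :=
  Subtype.ext (funext fun _ => map_smul B.Lm1 _ _)

variable (B)

/-- The cochains with values in `𝒲_z`, as a subspace. -/
def wCochains : Submodule ℂ (Cochain B) where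
  carrier := {Φ | IsWValued B Φ}
  zero_mem' :=
    { rational := fun v w' => ⟨0, by simp [pair_zero]⟩
      derivative_V := fun v w' z => by simpa [pair_zero] using hasDerivAt_const z (0 : ℂ)
      derivative_W := fun v w' z => by
        have h : B.Lm1Bar 0 = 0 := by refine Subtype.ext (funext fun α => ?_); simp [Lm1Bar]
        simpa [pair_zero, h] using hasDerivAt_const z (0 : ℂ)
      conjugation := fun a v z α => by simp [expL0Component] }
  add_mem' := fun {Φ Ψ} h h' =>
    { rational := fun v w' => by
        obtain ⟨p, hp⟩ := h.rational v w'
        obtain ⟨q, hq⟩ := h'.rational v w'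
        exact ⟨p + q, fun z => by simp [pair_add, hp, hq]⟩
      derivative_V := fun v w' z => by
        simpa [pair_add] using (h.derivative_V v w' z).fun_add (h'.derivative_V v w' z)
      derivative_W := fun v w' z => by
        simpa [pair_add, Lm1Bar_add] using
          (h.derivative_W v w' z).fun_add (h'.derivative_W v w' z)
      conjugation := fun a v z α => by
        have e1 := h.conjugation a v z α
        have e2 := h'.conjugation a v z α
        simp only [LinearMap.add_apply, Pi.add_apply, Completion.add_val] at *
        rw [← e1, ← e2]
        unfold expL0Component
        rw [← smul_add, ← finsum_add_distrib
          (expL0_finite a α ((Φ z v).2 α (Set.mem_univ _)))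
          (expL0_finite a α ((Ψ z v).2 α (Set.mem_univ _)))]
        simp }
  smul_mem' := fun c Φ h =>
    { rational := fun v w' => by
        obtain ⟨p, hp⟩ := h.rational v w'
        exact ⟨Polynomial.C c * p, fun z => by simp [pair_smul, hp]⟩
      derivative_V := fun v w' z => by
        simpa [pair_smul] using (h.derivative_V v w' z).const_mul c
      derivative_W := fun v w' z => by
        simpa [pair_smul, Lm1Bar_smul] using (h.derivative_W v w' z).const_mul c
      conjugation := fun a v z α => by
        have e1 := h.conjugation a v z α
        simp only [LinearMap.smul_apply, Pi.smul_apply, Completion.smul_val] at *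
        rw [← e1]
        unfold expL0Component
        rw [smul_comm c, smul_finsum c]
        congr 2
        funext k
        rw [map_smul, smul_comm] }

/-! ## The two-point connection form -/

/-- The term `⟨w', ω_W(v_1, z_1) Φ(v_2, z_2)⟩` has the value `c` at `(z_1, z_2)`: it is the value
of the rational function to which `∑_q ⟨w', Y_W(v_1, x_1) P_q Φ(v_2, x_2)⟩` converges for
`|x_1| > |x_2| > 0`. -/
def IsLeftTerm (Φ : Cochain B) (v₁ v₂ : V) (w' : restrictedDual B.gr) (z₁ z₂ c : ℂ) : Prop :=
  RationalValue (orderedRegion 2)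
    (fun (i : ℂ × ℤ) x =>
      (w' : Module.Dual ℂ W) (mode B.Y v₁ i.2 ((Φ (x 1) v₂).1 i.1)) * x 0 ^ (-i.2 - 1))
    ![z₁, z₂] c

/-- The term `⟨w', Φ(ω_V(v_1, z_1 - z_2)v_2, z_2)⟩` has the value `c` at `(z_1, z_2)`. -/
def IsMiddleTerm (Φ : Cochain B) (v₁ v₂ : V) (w' : restrictedDual B.gr) (z₁ z₂ c : ℂ) : Prop :=
  RationalValue {x : Fin 2 → ℂ | x 0 ≠ x 1}
    (fun (n : ℤ) x => pair w' (Φ (x 1) (mode A.Y v₁ n v₂)) * (x 0 - x 1) ^ (-n - 1))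
    ![z₁, z₂] c

/-- The matrix element `⟨w', (δ^1 Φ)(v_1, z_1; v_2, z_2)⟩` of the two-point connection form
`ω_W(v_1, z_1)Φ(v_2, z_2) - Φ(ω_V(v_1, z_1 - z_2)v_2, z_2) + ω_W(v_2, z_2)Φ(v_1, z_1)` is defined
and vanishes. -/
def FormVanishes (Φ : Cochain B) (v₁ v₂ : V) (w' : restrictedDual B.gr) (z₁ z₂ : ℂ) : Prop :=
  ∃ c₁ c₂ c₃ : ℂ, IsLeftTerm B Φ v₁ v₂ w' z₁ z₂ c₁ ∧ IsMiddleTerm B Φ v₁ v₂ w' z₁ z₂ c₂ ∧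
    IsLeftTerm B Φ v₂ v₁ w' z₂ z₁ c₃ ∧ c₁ - c₂ + c₃ = 0

variable {B}

theorem FormVanishes.add {Φ Ψ : Cochain B} {v₁ v₂ : V} {w' : restrictedDual B.gr} {z₁ z₂ : ℂ}
    (h : FormVanishes B Φ v₁ v₂ w' z₁ z₂) (h' : FormVanishes B Ψ v₁ v₂ w' z₁ z₂) :
    FormVanishes B (Φ + Ψ) v₁ v₂ w' z₁ z₂ := by
  obtain ⟨a, b, c, h1, h2, h3, h4⟩ := h
  obtain ⟨a', b', c', h1', h2', h3', h4'⟩ := h'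
  exact ⟨a + a', b + b', c + c', RationalValue.add h1 h1' fun i x => by simp [add_mul],
    RationalValue.add h2 h2' fun i x => by simp [pair_add, add_mul],
    RationalValue.add h3 h3' fun i x => by simp [add_mul], by linear_combination h4 + h4'⟩

theorem FormVanishes.smul (s : ℂ) {Φ : Cochain B} {v₁ v₂ : V} {w' : restrictedDual B.gr}
    {z₁ z₂ : ℂ} (h : FormVanishes B Φ v₁ v₂ w' z₁ z₂) :
    FormVanishes B (s • Φ) v₁ v₂ w' z₁ z₂ := by
  obtain ⟨a, b, c, h1, h2, h3, h4⟩ := h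
  exact ⟨s * a, s * b, s * c, RationalValue.smul s h1 fun i x => by simp [mul_assoc],
    RationalValue.smul s h2 fun i x => by simp [pair_smul, mul_assoc],
    RationalValue.smul s h3 fun i x => by simp [mul_assoc], by linear_combination s * h4⟩

theorem FormVanishes.zero {v₁ v₂ : V} {w' : restrictedDual B.gr} {z₁ z₂ : ℂ} :
    FormVanishes B 0 v₁ v₂ w' z₁ z₂ :=
  ⟨0, 0, 0, RationalValue.zero fun i x => by simp, RationalValue.zero fun i x => by simp [pair_zero],
    RationalValue.zero fun i x => by simp, by simp⟩

variable (B)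

/-- The coboundary operator on cochains without entries, `C^0_{m+1} = W`:
`(δ^0 w)(v, z) = ω_W(v, z)w - ω_W(v, z)w`. -/
def delta0 : W →ₗ[ℂ] Cochain B where
  toFun w := fun z =>
    { toFun := fun v => B.actBar v z w - B.actBar v z w
      map_add' := fun v v' => by simp
      map_smul' := fun c v => by simp }
  map_add' w w' := by funext z; exact LinearMap.ext fun v => by simp
  map_smul' c w := by funext z; exact LinearMap.ext fun v => by simp

end GradingRestrictedVertexAlgebra.GeneralizedModule

end Vertex

/-! ## Codimension one foliations of a complex curve -/

section Foliation

variable (M : Type*) [TopologicalSpace M] [ChartedSpace ℂ M]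

/-- A smooth foliation of real codimension one on the real surface underlying a complex curve,
given by foliation charts with values in `ℝ × ℝ`. The plaques are the level sets of the second
coordinate. -/
structure CodimOneFoliation where
  /-- the foliation charts -/
  charts : Set (OpenPartialHomeomorph M (ℝ × ℝ))
  cover : ∀ p : M, ∃ φ ∈ charts, p ∈ φ.source
  smooth : ∀ φ ∈ charts, ∀ e ∈ atlas ℂ M,
    ContDiffOn ℝ ∞ (fun x => φ (e.symm x)) (e.symm.trans φ).source
  smooth_symm : ∀ φ ∈ charts, ∀ e ∈ atlas ℂ M,
    ContDiffOn ℝ ∞ (fun x => e (φ.symm x)) (φ.symm.trans e).source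
  /-- Changes of charts locally map plaques into plaques. -/
  plaques : ∀ φ ∈ charts, ∀ ψ ∈ charts, ∀ p ∈ φ.source ∩ ψ.source,
    ∃ g : ℝ → ℝ, ∀ᶠ q in nhds p, (ψ q).2 = g (φ q).2

variable {M}

namespace CodimOneFoliation

variable (F : CodimOneFoliation M)

/-- A transversal section: an embedded curve which is everywhere transverse to the leaves, that is,
in foliation charts it is locally the graph of a smooth function of the transverse coordinate. -/
def IsTransversalSection (U : Set M) : Prop :=
  ∀ p ∈ U, ∃ φ ∈ F.charts, ∃ O : Set M, IsOpen O ∧ p ∈ O ∧ O ⊆ φ.source ∧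
    ∃ (I : Set ℝ) (s : ℝ → ℝ), IsOpen I ∧ ContDiffOn ℝ ∞ s I ∧
      φ '' (U ∩ O) = (fun y => (s y, y)) '' I

/-- A path that stays in a leaf and is continuous there: locally its transverse coordinate is
constant. -/
def IsLeafwise (γ : unitInterval → M) : Prop :=
  ∀ t, ∃ φ ∈ F.charts, γ t ∈ φ.source ∧ ∀ᶠ s in nhds t, (φ (γ s)).2 = (φ (γ t)).2

/-- A holonomy embedding `h : U ↪ U'`: transport along the leaves (along a continuous family of
leafwise paths that starts at the points of `U`), defined on all of `U` and embedding `U`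
into `U'`. -/
def IsHolonomyEmbedding (U U' : Set M) (h : U → U') : Prop :=
  Topology.IsOpenEmbedding h ∧
    ∃ H : unitInterval × U → M, Continuous H ∧ (∀ x : U, H (0, x) = x) ∧
      (∀ x : U, H (1, x) = h x) ∧ ∀ x : U, F.IsLeafwise fun t => H (t, x)

/-- A transversal basis for the leaf space, where each section carries a coordinate induced by a
holomorphic coordinate of the curve that is defined on the whole section. -/
structure TransversalBasis where
  /-- the sections of the basis -/
  sections : Set (Set M)
  transversal : ∀ U ∈ sections, F.IsTransversalSection U
  basis : ∀ U' : Set M, F.IsTransversalSection U' → ∀ p ∈ U',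
    ∃ U ∈ sections, ∃ h : U → U', F.IsHolonomyEmbedding U U' h ∧ ∃ x : U, (h x : M) = p
  /-- the coordinates -/
  coord : sections → OpenPartialHomeomorph M ℂ
  coord_holomorphic : ∀ U, coord U ∈ IsManifold.maximalAtlas 𝓘(ℂ, ℂ) ω M
  coord_covers : ∀ U : sections, (U : Set M) ⊆ (coord U).source

end CodimOneFoliation

namespace CodimOneFoliation.TransversalBasis

variable {F : CodimOneFoliation M} (T : F.TransversalBasis)

/-- A sequence `U_1 ↪ U_2 ↪ ⋯ ↪ U_m` of holonomy embeddings between sections of the basis. -/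
def IsChain {m : ℕ} (U : Fin m → T.sections) : Prop :=
  ∀ i j : Fin m, (i : ℕ) + 1 = j →
    ∃ h : ↥(U i).1 → ↥(U j).1, F.IsHolonomyEmbedding (U i) (U j) h

/-- The parameters `(t_1(p'_1), …, t_m(p'_m), t_j(p))` with points `p'_i ∈ U_i`, `p ∈ U_j`. -/
def parameters {m : ℕ} (U : Fin m → T.sections) (j : Fin m) : Set (Fin (m + 1) → ℂ) :=
  {z | (∀ i : Fin m, z i.castSucc ∈ T.coord (U i) '' (U i)) ∧
    z (Fin.last m) ∈ T.coord (U j) '' (U j)}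

end CodimOneFoliation.TransversalBasis

end Foliation

/-! ## Cochain spaces, first cohomology and fixed-point connections of a foliation -/

section Cohomology

open GradingRestrictedVertexAlgebra GeneralizedModule

variable {M : Type*} [TopologicalSpace M] [ChartedSpace ℂ M] {F : CodimOneFoliation M}
  (T : F.TransversalBasis) {V W : Type*} [AddCommGroup V] [Module ℂ V] [AddCommGroup W]
  [Module ℂ W] {A : GradingRestrictedVertexAlgebra V} (B : A.GeneralizedModule W)

/-- `C^1_m(V, 𝒲, ℱ)`: the maps `Φ : V → 𝒲_z` composable with `m` vertex operators on the sections
of every sequence `U_1 ↪ ⋯ ↪ U_m` of holonomy embeddings. -/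
def cochains (m : ℕ) : Submodule ℂ (Cochain B) where
  carrier := {Φ | Φ ∈ wCochains B ∧ ∀ U : Fin m → T.sections, T.IsChain U → ∀ j : Fin m,
    ComposableOn B (T.parameters U j) Φ}
  zero_mem' := ⟨zero_mem _, fun _ _ _ => ComposableOn.zero⟩
  add_mem' := fun h h' =>
    ⟨add_mem h.1 h'.1, fun U hU j => (h.2 U hU j).add (h'.2 U hU j)⟩
  smul_mem' := fun c _ h =>
    ⟨Submodule.smul_mem _ c h.1, fun U hU j => (h.2 U hU j).smul c⟩

/-- The kernel of `δ^1_m`, that is, the closed connections in `C^1_m(V, 𝒲, ℱ)`. -/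
def closedCochains (m : ℕ) : Submodule ℂ (Cochain B) where
  carrier := {Φ | Φ ∈ cochains T B m ∧ ∀ (v₁ v₂ : V) (w' : restrictedDual B.gr) (z₁ z₂ : ℂ),
    z₁ ≠ z₂ → FormVanishes B Φ v₁ v₂ w' z₁ z₂}
  zero_mem' := ⟨zero_mem _, fun _ _ _ _ _ _ => FormVanishes.zero⟩
  add_mem' := fun h h' =>
    ⟨add_mem h.1 h'.1, fun v₁ v₂ w' z₁ z₂ hz => (h.2 v₁ v₂ w' z₁ z₂ hz).add (h'.2 v₁ v₂ w' z₁ z₂ hz)⟩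
  smul_mem' := fun c _ h =>
    ⟨Submodule.smul_mem _ c h.1, fun v₁ v₂ w' z₁ z₂ hz => (h.2 v₁ v₂ w' z₁ z₂ hz).smul c⟩

/-- `H^1_m(V, 𝒲, ℱ) = ker δ^1_m / im δ^0_{m+1}`, where `C^0_{m+1} = W`. -/
abbrev FirstCohomology (m : ℕ) : Type _ :=
  closedCochains T B m ⧸ (LinearMap.range (delta0 B)).submoduleOf (closedCochains T B m)

/-- `C^1_m(p'_r; V, 𝒲, ℱ)`: the maps `Φ : V → 𝒲_z` composable with `m` vertex operators on the
sections of every sequence of holonomy embeddings whose `r`-th section is `S`, where the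
parameter of the `r`-th vertex operator is the coordinate of the fixed point `p' ∈ S`. -/
def fixedPointCochains (m r : ℕ) (S : T.sections) (p' : M) : Submodule ℂ (Cochain B) where
  carrier := {Φ | Φ ∈ wCochains B ∧ ∀ U : Fin m → T.sections, T.IsChain U →
    ∀ i : Fin m, (i : ℕ) + 1 = r → U i = S → ∀ j : Fin m,
      ComposableOn B {z ∈ T.parameters U j | z i.castSucc = T.coord S p'} Φ}
  zero_mem' := ⟨zero_mem _, fun _ _ _ _ _ _ => ComposableOn.zero⟩
  add_mem' := fun h h' => ⟨add_mem h.1 h'.1,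
    fun U hU i hi hS j => (h.2 U hU i hi hS j).add (h'.2 U hU i hi hS j)⟩
  smul_mem' := fun c _ h => ⟨Submodule.smul_mem _ c h.1,
    fun U hU i hi hS j => (h.2 U hU i hi hS j).smul c⟩

/-- `Con_{p'_r}(m; V, 𝒲)`: the elements `Φ` of `C^1_m(p'_r; V, 𝒲, ℱ)` that satisfy the two-point
connection formula
`Φ(ω_V(v₁, c(p') - c(p))v₂, c(p)) = ω_W(v₁, c(p'))Φ(v₂, c(p)) + ω_W(v₂, c(p))Φ(v₁, c(p'))`
with the fixed point `p'` for all points `p ≠ p'` in the domain of the coordinate `c`. -/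
def fixedPointConnections (m r : ℕ) (S : T.sections) (p' : M) : Submodule ℂ (Cochain B) where
  carrier := {Φ | Φ ∈ fixedPointCochains T B m r S p' ∧
    ∀ (v₁ v₂ : V) (w' : restrictedDual B.gr), ∀ p ∈ (T.coord S).source, p ≠ p' →
      FormVanishes B Φ v₁ v₂ w' (T.coord S p') (T.coord S p)}
  zero_mem' := ⟨zero_mem _, fun _ _ _ _ _ _ => FormVanishes.zero⟩
  add_mem' := fun h h' => ⟨add_mem h.1 h'.1,
    fun v₁ v₂ w' p hp hne => (h.2 v₁ v₂ w' p hp hne).add (h'.2 v₁ v₂ w' p hp hne)⟩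
  smul_mem' := fun c _ h => ⟨Submodule.smul_mem _ c h.1,
    fun v₁ v₂ w' p hp hne => (h.2 v₁ v₂ w' p hp hne).smul c⟩

end Cohomology

end FoliationVertex

end

/-! The coboundary `delta0` is a difference of two equal terms, so the cohomology is the space of
closed cochains, and the claim is that this space equals the space of connections at the fixed
point. Two facts give the equality.

Composability is automatic. At `z = 0` the `L(0)`-conjugation property forces `Φ(v, 0)` to have the
weight of `v`, so `Φ(·, 0)` is a linear map `g : V → W`. The `L(-1)`-derivative properties then give
`Φ(v, z) = e^{z L(-1)} g(v)` and make `g` commute with `L(-1)`. Weights of `W` are bounded below, so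
the transpose of `L(-1)` is nilpotent on each functional and the exponential is a finite sum in
matrix elements. The first series becomes a vacuum correlator, which is translation invariant
because `L(-1)` kills the vacuum. The second becomes the Taylor series of a translated correlation
function. Both are rational with poles of uniformly bounded order once products of any number of
vertex operators are. That rationality is derived from two-point duality: duality implies weak
commutativity (`weak_commutativity`), and an induction moves the outermost operator to the right
(`exists_numerator`). The conclusion is `IsWValued.composableOn`.

Vanishing near the fixed point is vanishing everywhere. With the first point fixed at `z₀`, a matrix
element of the form is rational in the second point with its only pole at `z₀`. Zeros throughout a
punctured neighbourhood make it zero. Simultaneous translation of both points replaces the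
functional `f` by `f e^{t L(-1)}`, so the fixed point can be moved anywhere
(`IsWValued.formVanishes`). Since the domain of a chart has an open image, the connection condition
supplies such a neighbourhood. -/

noncomputable section

namespace FoliationVertex

/-! ## Formal series in several variables -/

section Formal

variable {G : Type*} [AddCommGroup G]

/-- Multiplication of a formal series by the difference of the outer variable and the variable
that belongs to the direction `d`, for series indexed by the modes. -/
def shiftDiff (d : G) : Module.End ℂ (ℤ → G → ℂ) where
  toFun f := fun a e => f (a + 1) e - f a (e + d)
  map_add' f g := by funext a e; simp only [Pi.add_apply]; ring
  map_smul' c f := by funext a e; simp only [Pi.smul_apply, smul_eq_mul, RingHom.id_apply]; ring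

theorem shiftDiff_apply (d : G) (f : ℤ → G → ℂ) (a : ℤ) (e : G) :
    shiftDiff d f a e = f (a + 1) e - f a (e + d) := rfl

theorem shiftDiff_commute (d d' : G) : Commute (shiftDiff d) (shiftDiff d') := by
  refine LinearMap.ext fun f => ?_
  funext a e
  simp only [Module.End.mul_apply, shiftDiff_apply]
  rw [add_right_comm e d' d]
  ring

/-- `S n` is a region of vanishing with a margin of `n` steps: each application of `shiftDiff` reads
one step further in either index, so it uses up one unit of margin. -/
theorem shiftDiff_pow_eq_zero (d : G) {f : ℤ → G → ℂ} (S : ℕ → ℤ → G → Prop)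
    (h : ∀ a e, S 0 a e → f a e = 0)
    (hS : ∀ n a e, S (n + 1) a e → S n (a + 1) e ∧ S n a (e + d)) (n : ℕ) (a : ℤ) (e : G)
    (hn : S n a e) : ((shiftDiff d ^ n) f) a e = 0 := by
  induction n generalizing a e with
  | zero => exact h a e hn
  | succ n ih =>
    rw [pow_succ', Module.End.mul_apply, shiftDiff_apply, ih _ _ (hS n a e hn).1,
      ih _ _ (hS n a e hn).2, sub_zero]

/-- The hypothesis on `χ` says that a shift by `d` divides the inner monomial by `y`. Reindexing
thus turns multiplication by `x` and by `y` into shifts of the coefficients. -/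
theorem hasSum_shiftDiff {d : G} {x y : ℂ} (hx : x ≠ 0) {χ : G → ℂ}
    (hχ : ∀ e, χ e = y * χ (e + d)) {f : ℤ → G → ℂ} {τ : ℂ}
    (h : HasSum (fun p : ℤ × G => f p.1 p.2 * (x ^ (-p.1 - 1) * χ p.2)) τ) :
    HasSum (fun p : ℤ × G => shiftDiff d f p.1 p.2 * (x ^ (-p.1 - 1) * χ p.2))
      ((x - y) * τ) := by
  have h1 : HasSum (fun p : ℤ × G => x * (f (p.1 + 1) p.2 * (x ^ (-(p.1 + 1) - 1) * χ p.2)))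
      (x * τ) :=
    (((Equiv.addRight (1 : ℤ)).prodCongr (Equiv.refl G)).hasSum_iff.2 h).mul_left x
  have h2 : HasSum (fun p : ℤ × G => y * (f p.1 (p.2 + d) * (x ^ (-p.1 - 1) * χ (p.2 + d))))
      (y * τ) :=
    (((Equiv.refl ℤ).prodCongr (Equiv.addRight d)).hasSum_iff.2 h).mul_left y
  rw [sub_mul]
  refine (h1.sub h2).congr_fun fun p => ?_
  have e1 : x ^ (-p.1 - 1) = x ^ (-(p.1 + 1) - 1) * x := by
    rw [← zpow_add_one₀ hx]
    congr 1
    ring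
  rw [shiftDiff_apply, e1]
  linear_combination -f p.1 (p.2 + d) * x ^ (-(p.1 + 1) - 1) * x * hχ p.2

theorem hasSum_shiftDiff_pow {d : G} {x y : ℂ} (hx : x ≠ 0) {χ : G → ℂ}
    (hχ : ∀ e, χ e = y * χ (e + d)) {f : ℤ → G → ℂ} {τ : ℂ}
    (h : HasSum (fun p : ℤ × G => f p.1 p.2 * (x ^ (-p.1 - 1) * χ p.2)) τ) (n : ℕ) :
    HasSum (fun p : ℤ × G => ((shiftDiff d ^ n) f) p.1 p.2 *
      (x ^ (-p.1 - 1) * χ p.2)) ((x - y) ^ n * τ) := by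
  induction n with
  | zero => simpa using h
  | succ n ih =>
    rw [pow_succ' (shiftDiff d), Module.End.mul_apply]
    convert hasSum_shiftDiff hx hχ ih using 1
    ring

/-- Telescoping along the diagonal that lowers the outer mode and raises the inner one. This inverts
`shiftDiff` on series that vanish for low outer modes. -/
theorem sum_range_shiftDiff (d : G) (f : ℤ → G → ℂ) (n : ℕ) (a : ℤ) (e : G) :
    ∑ l ∈ Finset.range n, shiftDiff d f (a - 1 - l) (e + l • d) =
      f a e - f (a - n) (e + n • d) := by
  induction n with
  | zero => simp
  | succ n ih =>
    rw [Finset.sum_range_succ, ih, shiftDiff_apply, succ_nsmul, ← add_assoc]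
    push_cast
    rw [show a - 1 - (n : ℤ) + 1 = a - n by ring, show a - 1 - (n : ℤ) = a - (n + 1) by ring]
    ring

theorem eq_pow_mul_of_eq_mul {d : G} {y : ℂ} {χ : G → ℂ} (hχ : ∀ e, χ e = y * χ (e + d)) (l : ℕ)
    (e : G) : χ e = y ^ l * χ (e + l • d) := by
  induction l generalizing e with
  | zero => simp
  | succ l ih =>
    rw [ih e, hχ (e + l • d), succ_nsmul, add_assoc]
    ring

/-- The shear permutes the index set of the product of the two series, so absolute convergence is
preserved. Summing over `ℕ` first then realises the telescoping. -/
theorem hasSum_mul_shear (d : G) {g : ℤ × G → ℂ} {r : ℕ → ℂ} {τ ρ : ℂ} (hg : HasSum g τ)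
    (hr : HasSum r ρ) :
    HasSum (fun q : (ℤ × G) × ℕ => g (q.1.1 - 1 - q.2, q.1.2 + q.2 • d) * r q.2) (τ * ρ) := by
  have hprod : HasSum (fun q : (ℤ × G) × ℕ => g q.1 * r q.2) (τ * ρ) :=
    hg.mul hr (summable_mul_of_summable_norm hg.summable.norm hr.summable.norm)
  let σ : (ℤ × G) × ℕ ≃ (ℤ × G) × ℕ :=
    { toFun := fun q => ((q.1.1 - 1 - q.2, q.1.2 + q.2 • d), q.2)
      invFun := fun q => ((q.1.1 + 1 + q.2, q.1.2 - q.2 • d), q.2)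
      left_inv := fun q => by
        refine Prod.ext (Prod.ext ?_ ?_) rfl
        · dsimp only; ring
        · exact add_sub_cancel_right _ _
      right_inv := fun q => by
        refine Prod.ext (Prod.ext ?_ ?_) rfl
        · dsimp only; ring
        · exact sub_add_cancel _ _ }
  exact σ.hasSum_iff.2 hprod

/-- A series that is truncated in the outer variable `x` converges wherever its product with
`x - y` does, provided that `|y| < |x|`. -/
theorem hasSum_of_shiftDiff {d : G} {x y : ℂ} (hy : y ≠ 0) (hxy : ‖y‖ < ‖x‖) {χ : G → ℂ}
    (hχ : ∀ e, χ e = y * χ (e + d)) {f : ℤ → G → ℂ} {lo : ℤ} (hf : ∀ a < lo, ∀ e, f a e = 0)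
    {τ : ℂ}
    (h : HasSum (fun p : ℤ × G => shiftDiff d f p.1 p.2 *
      (x ^ (-p.1 - 1) * χ p.2)) τ) :
    HasSum (fun p : ℤ × G => f p.1 p.2 * (x ^ (-p.1 - 1) * χ p.2)) (τ / (x - y)) := by
  have hx : x ≠ 0 := norm_pos_iff.1 ((norm_nonneg y).trans_lt hxy)
  have hxy' : x - y ≠ 0 := sub_ne_zero.2 fun h => by rw [h] at hxy; exact lt_irrefl _ hxy
  have hq : ‖y / x‖ < 1 := by rw [norm_div]; exact (div_lt_one (norm_pos_iff.2 hx)).2 hxy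
  -- The expansion of `1 / (x - y)` valid for `‖y‖ < ‖x‖`.
  have hgeo : HasSum (fun l : ℕ => x⁻¹ * (y / x) ^ l) (1 / (x - y)) := by
    have := (hasSum_geometric_of_norm_lt_one hq).mul_left x⁻¹
    rwa [← mul_inv, mul_sub, mul_one, mul_div_cancel₀ y hx, inv_eq_one_div (x - y)] at this
  set g : ℤ × G → ℂ := fun p => shiftDiff d f p.1 p.2 * (x ^ (-p.1 - 1) * χ p.2)
    with hg
  have hχ' := eq_pow_mul_of_eq_mul hχ
  have hterm : ∀ (p : ℤ × G) (l : ℕ), g (p.1 - 1 - l, p.2 + l • d) * (x⁻¹ * (y / x) ^ l) =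
      shiftDiff d f (p.1 - 1 - l) (p.2 + l • d) * (x ^ (-p.1 - 1) * χ p.2) := by
    intro p l
    simp only [hg]
    rw [hχ' l p.2, div_pow, show -(p.1 - 1 - (l : ℤ)) - 1 = (-p.1 - 1) + 1 + l by ring,
      zpow_add₀ hx, zpow_add_one₀ hx, zpow_natCast]
    field_simp
  have hfib : ∀ p : ℤ × G, HasSum (fun l : ℕ => g (p.1 - 1 - l, p.2 + l • d) *
      (x⁻¹ * (y / x) ^ l)) (f p.1 p.2 * (x ^ (-p.1 - 1) * χ p.2)) := by
    intro p
    simp only [hterm]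
    refine HasSum.mul_right _ ?_
    -- Beyond this cutoff both outer modes entering `shiftDiff` lie below `lo`.
    have hz : ∀ l ∉ Finset.range (p.1 - lo + 1).toNat,
        shiftDiff d f (p.1 - 1 - l) (p.2 + l • d) = 0 := by
      intro l hl
      rw [Finset.mem_range, not_lt, Int.toNat_le] at hl
      rw [shiftDiff_apply, hf _ (by omega), hf _ (by omega), sub_zero]
    have : HasSum (fun l : ℕ => shiftDiff d f (p.1 - 1 - l) (p.2 + l • d))
        (∑ l ∈ Finset.range (p.1 - lo + 1).toNat,
          shiftDiff d f (p.1 - 1 - l) (p.2 + l • d)) :=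
      hasSum_sum_of_ne_finset_zero hz
    rwa [sum_range_shiftDiff, hf (p.1 - ((p.1 - lo + 1).toNat : ℤ)) (by omega), sub_zero] at this
  have h5 : HasSum (fun q : (ℤ × G) × ℕ => g (q.1.1 - 1 - q.2, q.1.2 + q.2 • d) *
      (x⁻¹ * (y / x) ^ q.2)) (τ * (1 / (x - y))) :=
    hasSum_mul_shear (g := g) (r := fun l => x⁻¹ * (y / x) ^ l) d h hgeo
  rw [div_eq_mul_one_div]
  -- Summability of `f` is an output here: it comes from the absolutely convergent product, grouped
  -- into telescoping fibres.
  exact h5.prod_fiberwise hfib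

end Formal

/-! ## Uniqueness of convergent truncated expansions -/

theorem coeff_eq_zero_of_hasSum_pow {a : ℕ → ℂ} {r : ℝ} (hr : 0 < r)
    (h : ∀ s : ℂ, s ≠ 0 → ‖s‖ < r → HasSum (fun n => a n * s ^ n) 0) : a = 0 := by
  -- The hypothesis says nothing at `s = 0`, where the power series has the value `a 0`. Continuity
  -- of its sum then forces `a 0 = 0`.
  set f : ℂ → ℂ := fun s => if s = 0 then a 0 else 0 with hfdef
  have key : HasFPowerSeriesOnBall f (FormalMultilinearSeries.ofScalars ℂ a) 0
      (ENNReal.ofReal r) := by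
    refine ⟨?_, by simpa using hr, ?_⟩
    · refine ENNReal.le_of_forall_nnreal_lt fun t ht => ?_
      have htr : (t : ℝ) < r := by
        rw [← ENNReal.ofReal_coe_nnreal] at ht
        exact (ENNReal.ofReal_lt_ofReal_iff hr).1 ht
      rcases eq_or_ne t 0 with rfl | ht0
      · simp
      refine FormalMultilinearSeries.le_radius_of_summable_norm _ ?_
      have := (h (t : ℂ) (by exact_mod_cast ht0) (by simpa using htr)).summable.norm
      refine this.congr fun n => ?_
      simp
    · intro y hy
      simp only [zero_add, FormalMultilinearSeries.ofScalars_apply_eq, hfdef, smul_eq_mul]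
      rcases eq_or_ne y 0 with rfl | hy0
      · rw [if_pos rfl]
        simpa using hasSum_single (f := fun n => a n * (0 : ℂ) ^ n) 0 (fun n hn => by simp [hn])
      · rw [if_neg hy0]
        refine h y hy0 ?_
        rw [Metric.mem_eball, edist_zero_right, ← ofReal_norm] at hy
        exact (ENNReal.ofReal_lt_ofReal_iff hr).1 hy
  have hcont : ContinuousAt f 0 := key.analyticAt.continuousAt
  have h0 : f 0 = 0 := by
    refine tendsto_nhds_unique (hcont.tendsto.mono_left (nhdsWithin_le_nhds (s := {0}ᶜ))) ?_
    refine tendsto_const_nhds.congr' ?_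
    filter_upwards [self_mem_nhdsWithin] with s hs
    exact (if_neg hs).symm
  have hf0 : f = 0 := by
    funext s
    rcases eq_or_ne s 0 with rfl | hs
    · exact h0
    · simp [hfdef, hs]
  have := (hf0 ▸ key.hasFPowerSeriesAt).eq_zero
  funext n
  have hn := congrArg (fun p => p.coeff n) this
  rwa [FormalMultilinearSeries.coeff_ofScalars] at hn

theorem coeff_eq_zero_of_hasSum_zpow {c : ℤ → ℂ} {lo : ℤ} (hc : ∀ n < lo, c n = 0) {r : ℝ}
    (hr : 0 < r) (h : ∀ s : ℂ, s ≠ 0 → ‖s‖ < r → HasSum (fun n : ℤ => c n * s ^ n) 0) :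
    c = 0 := by
  have h1 : (fun n : ℕ => c (lo + n)) = 0 := by
    refine coeff_eq_zero_of_hasSum_pow hr fun s hs hsr => ?_
    have hinj : Function.Injective fun n : ℕ => lo + (n : ℤ) := fun m n hmn => by
      simpa using hmn
    have h2 := (hinj.hasSum_iff (f := fun n : ℤ => c n * s ^ n) (a := 0) fun n hn => by
      rw [hc n, zero_mul]
      by_contra hlt
      exact hn ⟨(n - lo).toNat, by simp; omega⟩).2 (h s hs hsr)
    have h3 := h2.mul_left (s ^ (-lo))
    rw [mul_zero] at h3
    refine h3.congr_fun fun n => ?_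
    simp only [Function.comp]
    rw [zpow_add₀ hs, zpow_neg, zpow_natCast]
    field_simp
  funext n
  by_cases hn : n < lo
  · exact hc n hn
  · have := congrFun h1 (n - lo).toNat
    simp only [Pi.zero_apply] at this
    rwa [Int.toNat_of_nonneg (by omega), add_sub_cancel] at this

/-- One variable at a time: for fixed `y` the series is a truncated Laurent series in `s = x⁻¹` on
`0 < ‖s‖ < ‖y‖⁻¹`, so each row sums to zero. Each row is itself a truncated Laurent series in `y`.
-/
theorem coeff_eq_zero_of_hasSum_zpow_zpow {g : ℤ → ℤ → ℂ} {lo hi : ℤ}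
    (hlo : ∀ a < lo, ∀ b, g a b = 0) (hhi : ∀ b, hi ≤ b → ∀ a, g a b = 0)
    (h : ∀ x y : ℂ, y ≠ 0 → ‖y‖ < ‖x‖ →
      HasSum (fun p : ℤ × ℤ => g p.1 p.2 * (x ^ (-p.1 - 1) * y ^ (-p.2 - 1))) 0) : g = 0 := by
  have hrow : ∀ (a : ℤ) (y : ℂ), y ≠ 0 →
      HasSum (fun b : ℤ => g a b * y ^ (-b - 1)) 0 := by
    intro a y hy
    have hsum : ∀ a, Summable fun b : ℤ => g a b * y ^ (-b - 1) := by
      intro a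
      -- The point `x = 2 * y` serves only as one point of the region from which summability of the
      -- rows is read off.
      have hyx : ‖y‖ < ‖2 * y‖ := by simp [hy]
      have hx : (2 * y) ≠ 0 := by simp [hy]
      have := ((h (2 * y) y hy hyx).summable.prod_factor a).mul_left ((2 * y) ^ (-a - 1))⁻¹
      refine this.congr fun b => ?_
      have := zpow_ne_zero (-a - 1) hx
      field_simp
    have hc : (fun n : ℤ => ∑' b, g (n - 1) b * y ^ (-b - 1)) = 0 := by
      refine coeff_eq_zero_of_hasSum_zpow (lo := lo + 1) (r := ‖y‖⁻¹) (fun n hn => ?_)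
        (by simpa using hy) fun s hs hsr => ?_
      · simp [hlo (n - 1) (by omega)]
      · have hys : ‖y‖ < ‖s⁻¹‖ := by
          rw [norm_inv]
          exact (lt_inv_comm₀ (norm_pos_iff.2 hs) (norm_pos_iff.2 hy)).1 hsr
        have h1 := (h s⁻¹ y hy hys).prod_fiberwise fun a =>
          ((hsum a).hasSum.mul_left (s⁻¹ ^ (-a - 1))).congr_fun fun b => by ring
        have h2 := (Equiv.subRight (1 : ℤ)).hasSum_iff.2 h1
        refine h2.congr_fun fun n => ?_
        simp only [Function.comp, Equiv.subRight_apply]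
        rw [inv_zpow', mul_comm]
        congr 2
        ring
    have h3 := (hsum a).hasSum
    have h4 := congrFun hc (a + 1)
    simp only [add_sub_cancel_right, Pi.zero_apply] at h4
    rwa [h4] at h3
  funext a b
  have hc : (fun n : ℤ => g a (-n - 1)) = 0 := by
    refine coeff_eq_zero_of_hasSum_zpow (lo := -hi) (r := 1) (fun n hn => hhi _ (by omega) _)
      one_pos fun s hs _ => ?_
    have h1 := ((Equiv.neg ℤ).trans (Equiv.subRight (1 : ℤ))).hasSum_iff.2 (hrow a s hs)
    refine h1.congr_fun fun n => ?_
    simp only [Function.comp, Equiv.trans_apply, Equiv.neg_apply, Equiv.subRight_apply]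
    congr 2
    ring
  have := congrFun hc (-b - 1)
  simpa using this

/-! ## Reduction of the order of the pole on the diagonal -/

/-- Modulo `X 0 - X 1` every polynomial is congruent to its restriction to the diagonal, a
polynomial in `X 1` alone. Infinitely many zeros make that restriction vanish. -/
theorem X_sub_X_dvd {P : MvPolynomial (Fin 2) ℂ}
    (h : ∀ y : ℂ, y ≠ 0 → MvPolynomial.eval ![y, y] P = 0) :
    (MvPolynomial.X 0 - MvPolynomial.X 1 : MvPolynomial (Fin 2) ℂ) ∣ P := by
  have h1 : ∀ Q : MvPolynomial (Fin 2) ℂ,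
      (MvPolynomial.X 0 - MvPolynomial.X 1 : MvPolynomial (Fin 2) ℂ) ∣
        Q - MvPolynomial.aeval (fun _ => (MvPolynomial.X 1 : MvPolynomial (Fin 2) ℂ)) Q := by
    intro Q
    induction Q using MvPolynomial.induction_on with
    | C a => simp [MvPolynomial.algebraMap_eq]
    | add p q hp hq =>
      rw [map_add, add_sub_add_comm]
      exact dvd_add hp hq
    | mul_X p i hp =>
      rw [map_mul, MvPolynomial.aeval_X]
      have hX : (MvPolynomial.X 0 - MvPolynomial.X 1 : MvPolynomial (Fin 2) ℂ) ∣
          MvPolynomial.X i - MvPolynomial.X 1 := by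
        fin_cases i
        · exact dvd_rfl
        · simp
      have e : p * MvPolynomial.X i - MvPolynomial.aeval
            (fun _ => (MvPolynomial.X 1 : MvPolynomial (Fin 2) ℂ)) p * MvPolynomial.X 1 =
          (p - MvPolynomial.aeval (fun _ => (MvPolynomial.X 1 : MvPolynomial (Fin 2) ℂ)) p) *
            MvPolynomial.X i + MvPolynomial.aeval
            (fun _ => (MvPolynomial.X 1 : MvPolynomial (Fin 2) ℂ)) p *
            (MvPolynomial.X i - MvPolynomial.X 1) := by ring
      rw [e]
      exact dvd_add (Dvd.dvd.mul_right hp _) (Dvd.dvd.mul_left hX _)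
  have h2 : MvPolynomial.aeval (fun _ => (MvPolynomial.X 1 : MvPolynomial (Fin 2) ℂ)) P = 0 := by
    refine MvPolynomial.funext_set (fun _ => {0}ᶜ)
      (fun _ => (Set.finite_singleton 0).infinite_compl)
      fun x hx => ?_
    have hx1 : x 1 ≠ 0 := hx 1 (Set.mem_univ _)
    rw [map_zero, ← h (x 1) hx1]
    have : (MvPolynomial.eval x).comp (MvPolynomial.aeval
        (fun _ => (MvPolynomial.X 1 : MvPolynomial (Fin 2) ℂ))).toRingHom =
        MvPolynomial.eval ![x 1, x 1] := by
      refine MvPolynomial.ringHom_ext (fun r => by simp [MvPolynomial.algebraMap_eq])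
        fun i => ?_
      fin_cases i <;> simp
    exact congrArg (fun φ => φ P) this
  have h3 := h1 P
  rwa [h2, sub_zero] at h3

/-- The expansion around the diagonal has pole order at most `N < l` in `t = x - y`. After
multiplication by `t ^ l` every term carries a positive power of `t`, so the sum is `O(‖t‖)` by
comparison with a fixed radius `ρ`. Letting `t → 0` kills the numerator on the diagonal. -/
theorem eval_diagonal_eq_zero {P : MvPolynomial (Fin 2) ℂ} {k l N : ℕ} (hl : N < l)
    {c : ℤ × ℤ → ℂ} (hc : ∀ n : ℤ × ℤ, (N : ℤ) ≤ n.1 → c n = 0)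
    (h : ∀ x y : ℂ, 0 < ‖x - y‖ → ‖x - y‖ < ‖y‖ →
      HasSum (fun n : ℤ × ℤ => c n * (x - y) ^ (-n.1 - 1) * y ^ (-n.2 - 1))
        (MvPolynomial.eval ![x, y] P / ((x * y) ^ k * (x - y) ^ l)))
    {y : ℂ} (hy : y ≠ 0) : MvPolynomial.eval ![y, y] P = 0 := by
  set ρ : ℝ := ‖y‖ / 2 with hρ
  have hypos := norm_pos_iff.2 hy
  have hρ0 : 0 < ρ := by positivity
  have hρy : ρ < ‖y‖ := by rw [hρ]; linarith
  have hsum := (h (y + ρ) y (by simpa using hρ0.ne')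
    (by simpa [abs_of_pos hρ0] using hρy)).summable.norm
  set C : ℝ := ∑' n : ℤ × ℤ, ‖c n * ((y + ρ : ℂ) - y) ^ (-n.1 - 1) * y ^ (-n.2 - 1)‖ with hC
  have hbound : ∀ t : ℂ, t ≠ 0 → ‖t‖ < ρ →
      ‖MvPolynomial.eval ![y + t, y] P / ((y + t) * y) ^ k‖ ≤ ‖t‖ / ρ * (ρ ^ l * C) := by
    intro t ht htρ
    have htpos := norm_pos_iff.2 ht
    have h1 := (h (y + t) y (by simpa using ht) (by simpa using htρ.trans hρy)).mul_left (t ^ l)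
    have h2 := (hsum.hasSum.mul_left (ρ ^ l)).mul_left (‖t‖ / ρ)
    have h3 := h1.norm_le_of_bounded h2 fun n => ?_
    · have e : t ^ l * (MvPolynomial.eval ![y + t, y] P / (((y + t) * y) ^ k * (y + t - y) ^ l)) =
          MvPolynomial.eval ![y + t, y] P / ((y + t) * y) ^ k := by
        rw [add_sub_cancel_left, ← mul_div_assoc, mul_comm,
          mul_div_mul_right _ _ (pow_ne_zero l ht)]
      rwa [e] at h3
    · by_cases hn : (N : ℤ) ≤ n.1
      · simp [hc n hn]
      · rw [add_sub_cancel_left, add_sub_cancel_left, norm_mul, norm_mul, norm_mul, norm_mul,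
          norm_mul, norm_zpow t, norm_zpow y, norm_pow, norm_zpow (ρ : ℂ), Complex.norm_real,
          Real.norm_of_nonneg hρ0.le]
        -- Here `n.1 ≤ N - 1` and `N + 1 ≤ l`, so the total exponent of `t` is at least one. One
        -- factor gives `‖t‖ / ρ`, and the others are bounded by powers of `ρ`.
        have e1 : ‖t‖ ^ l * ‖t‖ ^ (-n.1 - 1) ≤ ‖t‖ / ρ * (ρ ^ l * ρ ^ (-n.1 - 1)) := by
          rw [← zpow_natCast, ← zpow_natCast, ← zpow_add₀ htpos.ne', ← zpow_add₀ hρ0.ne']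
          obtain ⟨j, hj⟩ := Int.eq_ofNat_of_zero_le (a := (l : ℤ) + (-n.1 - 1) - 1) (by omega)
          rw [show (l : ℤ) + (-n.1 - 1) = j + 1 by omega, zpow_add_one₀ htpos.ne',
            zpow_add_one₀ hρ0.ne', zpow_natCast, zpow_natCast]
          have e2 : ‖t‖ / ρ * (ρ ^ j * ρ) = ρ ^ j * ‖t‖ := by field_simp
          rw [e2]
          gcongr
        calc ‖t‖ ^ l * (‖c n‖ * ‖t‖ ^ (-n.1 - 1) * ‖y‖ ^ (-n.2 - 1))
            = (‖t‖ ^ l * ‖t‖ ^ (-n.1 - 1)) * (‖c n‖ * ‖y‖ ^ (-n.2 - 1)) := by ring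
          _ ≤ (‖t‖ / ρ * (ρ ^ l * ρ ^ (-n.1 - 1))) * (‖c n‖ * ‖y‖ ^ (-n.2 - 1)) := by gcongr
          _ = _ := by ring
  have hcont : ContinuousAt (fun t : ℂ =>
      ‖MvPolynomial.eval ![y + t, y] P / ((y + t) * y) ^ k‖) 0 := by
    refine (ContinuousAt.div ?_ (by fun_prop) (by simp [hy])).norm
    refine (MvPolynomial.continuous_eval P).continuousAt.comp ?_
    refine continuousAt_pi.2 fun i => ?_
    fin_cases i
    · simp only [Fin.zero_eta, Matrix.cons_val_zero]; fun_prop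
    · simp only [Fin.mk_one, Matrix.cons_val_one]; fun_prop
  have hle : ‖MvPolynomial.eval ![y + 0, y] P / ((y + 0) * y) ^ k‖ ≤
      ‖(0 : ℂ)‖ / ρ * (ρ ^ l * C) := by
    refine le_of_tendsto_of_tendsto (b := nhdsWithin (0 : ℂ) {0}ᶜ)
      (hcont.tendsto.mono_left nhdsWithin_le_nhds) (g := fun t : ℂ => ‖t‖ / ρ * (ρ ^ l * C)) ?_ ?_
    · refine Filter.Tendsto.mono_left ?_ nhdsWithin_le_nhds
      exact (by fun_prop : Continuous fun t : ℂ => ‖t‖ / ρ * (ρ ^ l * C)).tendsto 0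
    · have : Metric.ball (0 : ℂ) ρ ∈ nhdsWithin (0 : ℂ) {0}ᶜ :=
        nhdsWithin_le_nhds (Metric.ball_mem_nhds 0 hρ0)
      filter_upwards [self_mem_nhdsWithin, this] with t ht ht'
      exact hbound t ht (by simpa using ht')
  simp only [add_zero, norm_zero, zero_div, zero_mul] at hle
  simpa [hy] using norm_le_zero_iff.1 hle

/-- While the exponent on the diagonal exceeds `N`, the numerator vanishes there and one factor `X 0
- X 1` cancels. The bound `N` comes from the expansion alone, so it depends neither on `k` nor on
`l`. -/
theorem exists_reduced_numerator (P : MvPolynomial (Fin 2) ℂ) (k l N : ℕ)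
    {c : ℤ × ℤ → ℂ} (hc : ∀ n : ℤ × ℤ, (N : ℤ) ≤ n.1 → c n = 0)
    (h : ∀ x y : ℂ, 0 < ‖x - y‖ → ‖x - y‖ < ‖y‖ →
      HasSum (fun n : ℤ × ℤ => c n * (x - y) ^ (-n.1 - 1) * y ^ (-n.2 - 1))
        (MvPolynomial.eval ![x, y] P / ((x * y) ^ k * (x - y) ^ l))) :
    ∃ P' : MvPolynomial (Fin 2) ℂ, ∀ x y : ℂ, x ≠ y →
      MvPolynomial.eval ![x, y] P / ((x * y) ^ k * (x - y) ^ l) =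
        MvPolynomial.eval ![x, y] P' / ((x * y) ^ k * (x - y) ^ N) := by
  induction l generalizing P with
  | zero =>
    refine ⟨P * (MvPolynomial.X 0 - MvPolynomial.X 1) ^ N, fun x y hxy => ?_⟩
    have := sub_ne_zero.2 hxy
    simp only [map_mul, map_pow, map_sub, MvPolynomial.eval_X, Matrix.cons_val_zero,
      Matrix.cons_val_one, pow_zero, mul_one]
    rw [mul_div_mul_right _ _ (pow_ne_zero _ this)]
  | succ l ih =>
    by_cases hl : l + 1 ≤ N
    · refine ⟨P * (MvPolynomial.X 0 - MvPolynomial.X 1) ^ (N - (l + 1)), fun x y hxy => ?_⟩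
      have := sub_ne_zero.2 hxy
      simp only [map_mul, map_pow, map_sub, MvPolynomial.eval_X, Matrix.cons_val_zero,
        Matrix.cons_val_one]
      obtain ⟨d, rfl⟩ := Nat.exists_eq_add_of_le hl
      rw [Nat.add_sub_cancel_left, pow_add (x - y) (l + 1) d, ← mul_assoc ((x * y) ^ k),
        mul_div_mul_right _ _ (pow_ne_zero _ this)]
    · obtain ⟨P₁, rfl⟩ := X_sub_X_dvd fun y hy => eval_diagonal_eq_zero (by omega) hc h hy
      have hred : ∀ x y : ℂ, x ≠ y →
          MvPolynomial.eval ![x, y] ((MvPolynomial.X 0 - MvPolynomial.X 1) * P₁) /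
            ((x * y) ^ k * (x - y) ^ (l + 1)) =
          MvPolynomial.eval ![x, y] P₁ / ((x * y) ^ k * (x - y) ^ l) := by
        intro x y hxy
        have := sub_ne_zero.2 hxy
        simp only [map_mul, map_sub, MvPolynomial.eval_X, Matrix.cons_val_zero,
          Matrix.cons_val_one]
        rw [pow_succ' (x - y), mul_left_comm, mul_div_mul_left _ _ this]
      obtain ⟨P', hP'⟩ := ih P₁ fun x y h1 h2 => by
        rw [← hred x y (sub_ne_zero.1 (norm_pos_iff.1 h1))]
        exact h x y h1 h2
      exact ⟨P', fun x y hxy => by rw [hred x y hxy, hP' x y hxy]⟩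

/-- The coefficients of the Laurent polynomial `P / (x y)^k`. -/
theorem exists_laurent_coeff (P : MvPolynomial (Fin 2) ℂ) (k : ℕ) :
    ∃ (g : ℤ → ℤ → ℂ) (K : ℤ), (∀ a b, a < -K ∨ K ≤ a ∨ b < -K ∨ K ≤ b → g a b = 0) ∧
      ∀ x y : ℂ, x ≠ 0 → y ≠ 0 →
        HasSum (fun p : ℤ × ℤ => g p.1 p.2 * (x ^ (-p.1 - 1) * y ^ (-p.2 - 1)))
          (MvPolynomial.eval ![x, y] P / (x * y) ^ k) := by
  induction P using MvPolynomial.induction_on' with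
  | monomial u a =>
    -- The exponent `u 0 - k` of `x` equals `-i - 1` for `i = k - 1 - u 0`, and similarly for `y`.
    -- The last witness is a crude bound on both indices.
    refine ⟨fun i j => if i = k - 1 - u 0 ∧ j = k - 1 - u 1 then a else 0, k + u 0 + u 1 + 2,
      fun i j hij => if_neg (by omega), fun x y hx hy => ?_⟩
    have h1 : MvPolynomial.eval ![x, y] (MvPolynomial.monomial u a) / (x * y) ^ k =
        (fun p : ℤ × ℤ => (if p.1 = k - 1 - u 0 ∧ p.2 = k - 1 - u 1 then a else 0) *
          (x ^ (-p.1 - 1) * y ^ (-p.2 - 1))) ((k : ℤ) - 1 - u 0, (k : ℤ) - 1 - u 1) := by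
      have e1 : ∀ (s : ℂ), s ≠ 0 → ∀ n : ℕ, s ^ (-((k : ℤ) - 1 - n) - 1) = s ^ n / s ^ k := by
        intro s hs n
        rw [show (-((k : ℤ) - 1 - n) - 1) = n - k by ring, zpow_sub₀ hs, zpow_natCast,
          zpow_natCast]
      simp only [and_self, if_true]
      rw [e1 x hx, e1 y hy, MvPolynomial.eval_monomial, Finsupp.prod_fintype _ _ (by simp)]
      simp only [Fin.prod_univ_two, Matrix.cons_val_zero, Matrix.cons_val_one]
      rw [mul_pow, div_mul_div_comm, mul_div_assoc]
    rw [h1]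
    refine hasSum_single _ fun p hp => ?_
    dsimp only
    rw [if_neg (fun h => hp (Prod.ext h.1 h.2)), zero_mul]
  | add p q hp hq =>
    obtain ⟨g, K, h1, h2⟩ := hp
    obtain ⟨g', K', h1', h2'⟩ := hq
    refine ⟨g + g', max K K', fun a b hab => ?_, fun x y hx hy => ?_⟩
    · simp only [Pi.add_apply]
      rw [h1 a b (by omega), h1' a b (by omega), add_zero]
    · rw [map_add, add_div]
      exact ((h2 x y hx hy).add (h2' x y hx hy)).congr_fun fun p => by
        simp only [Pi.add_apply]; ring

/-! ## Weights -/

/-- The smaller subspaces already span and the larger ones are independent, so the modular law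
leaves no room between them. It serves to identify gradings with the generalized eigenspaces of
`L(0)`. -/
theorem eq_of_le_of_iSupIndep {ι X : Type*} [AddCommGroup X] [Module ℂ X]
    {p q : ι → Submodule ℂ X} (hpq : ∀ i, p i ≤ q i) (hq : iSupIndep q) (hp : ⨆ i, p i = ⊤)
    (i : ι) : p i = q i := by
  refine le_antisymm (hpq i) ?_
  have h1 : p i ⊔ ⨆ (j) (_ : j ≠ i), p j = ⊤ := by
    rw [eq_top_iff, ← hp]
    refine iSup_le fun j => ?_
    by_cases hj : j = i
    · exact hj ▸ le_sup_left
    · exact le_sup_of_le_right (le_iSup₂_of_le j hj le_rfl)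
  calc q i = q i ⊓ (p i ⊔ ⨆ (j) (_ : j ≠ i), p j) := by rw [h1, inf_top_eq]
    _ = p i ⊔ q i ⊓ ⨆ (j) (_ : j ≠ i), p j := by
      rw [inf_comm, sup_inf_assoc_of_le _ (hpq i), inf_comm]
    _ ≤ p i ⊔ q i ⊓ ⨆ (j) (_ : j ≠ i), q j :=
      sup_le_sup_left (inf_le_inf_left _ (iSup₂_mono fun j _ => hpq j)) _
    _ = p i := by rw [(hq i).eq_bot, sup_bot_eq]

variable {V W : Type*} [AddCommGroup V] [Module ℂ V] [AddCommGroup W] [Module ℂ W]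

theorem mode_add (Y : V →ₗ[ℂ] VertexOperator ℂ W) (u v : V) (n : ℤ) :
    mode Y (u + v) n = mode Y u n + mode Y v n := by
  simp [mode]

theorem mode_smul (Y : V →ₗ[ℂ] VertexOperator ℂ W) (c : ℂ) (v : V) (n : ℤ) :
    mode Y (c • v) n = c • mode Y v n := by
  simp [mode]

theorem mode_zero (Y : V →ₗ[ℂ] VertexOperator ℂ W) (n : ℤ) : mode Y 0 n = 0 := by
  simp [mode]

/-- A bound for the modes of `Y(u, z)` that do not annihilate `x`. -/
def truncOrder (Y : V →ₗ[ℂ] VertexOperator ℂ W) (u : V) (x : W) : ℕ :=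
  (-((HahnModule.of ℂ).symm (Y u x)).order).toNat

theorem mode_eq_zero_of_truncOrder_le (Y : V →ₗ[ℂ] VertexOperator ℂ W) (u : V) (x : W) {n : ℤ}
    (hn : (truncOrder Y u x : ℤ) ≤ n) : mode Y u n x = 0 := by
  refine VertexOperator.ncoeff_eq_zero_of_lt_order _ _ _ ?_
  have := Int.self_le_toNat (-((HahnModule.of ℂ).symm (Y u x)).order)
  unfold truncOrder at hn
  omega

/-- By the bracket formula the mode intertwines `LW - α` with `LW - (α + a - n - 1)`, so the same
power annihilates the image. -/
theorem mode_mem_maxGenEigenspace {Y : V →ₗ[ℂ] VertexOperator ℂ W} {LV : Module.End ℂ V}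
    {LW : Module.End ℂ W}
    (hL : ∀ (u : V) (w : W) (n : ℤ),
      LW (mode Y u n w) - mode Y u n (LW w) = mode Y (LV u) n w + (-(n : ℂ) - 1) • mode Y u n w)
    {a α : ℂ} {u : V} (hu : LV u = a • u) {x : W} (hx : x ∈ LW.maxGenEigenspace α) (n : ℤ) :
    mode Y u n x ∈ LW.maxGenEigenspace (α + a - n - 1) := by
  rw [Module.End.mem_maxGenEigenspace] at hx ⊢
  obtain ⟨k, hk⟩ := hx
  refine ⟨k, ?_⟩
  have h1 : ∀ y, (LW - (α + a - n - 1) • (1 : Module.End ℂ W)) (mode Y u n y) =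
      mode Y u n ((LW - α • (1 : Module.End ℂ W)) y) := by
    intro y
    have := hL u y n
    rw [hu, mode_smul, LinearMap.smul_apply, sub_eq_iff_eq_add] at this
    simp only [LinearMap.sub_apply, LinearMap.smul_apply, Module.End.one_apply, map_sub, map_smul]
    rw [this]
    module
  have h2 : ∀ (j : ℕ) y, ((LW - (α + a - n - 1) • (1 : Module.End ℂ W)) ^ j) (mode Y u n y) =
      mode Y u n (((LW - α • (1 : Module.End ℂ W)) ^ j) y) := by
    intro j
    induction j with
    | zero => simp
    | succ j ih =>
      intro y
      rw [pow_succ, pow_succ, Module.End.mul_apply, Module.End.mul_apply, h1, ih]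
  rw [h2, hk, map_zero]

open GradingRestrictedVertexAlgebra

/-! ### The vertex algebra as a module over itself -/

namespace GradingRestrictedVertexAlgebra

variable (A : GradingRestrictedVertexAlgebra V)

theorem induction_homogeneous {motive : V → Prop} (v : V)
    (hom : ∀ (n : ℤ), ∀ u ∈ A.gr n, motive u)
    (add : ∀ u u', motive u → motive u' → motive (u + u')) : motive v := by
  have hv : v ∈ ⨆ n, A.gr n := by rw [A.internal.submodule_iSup_eq_top]; trivial
  exact Submodule.iSup_induction A.gr (motive := motive) hv hom (hom 0 0 (zero_mem _)) add

/-- In the bracket of `L(0)` with the mode `-1` of the vacuum, applied to the vacuum, the left side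
cancels and the right side is `L(0)` of the vacuum. -/
theorem L0_one : A.L0 A.one = 0 := by
  have h := A.L0_bracket A.one A.one (-1)
  rw [A.creation_limit, A.identity, if_pos rfl, A.creation_limit] at h
  simpa using h.symm

theorem gr_complex_eq (α : ℂ) :
    ⨆ (n : ℤ) (_ : (n : ℂ) = α), A.gr n = A.L0.maxGenEigenspace α := by
  refine eq_of_le_of_iSupIndep (p := fun α : ℂ => ⨆ (n : ℤ) (_ : (n : ℂ) = α), A.gr n)
    (q := fun α => A.L0.maxGenEigenspace α) (fun α => ?_)
    (Module.End.independent_maxGenEigenspace _) ?_ α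
  · refine iSup₂_le fun n hn v hv => ?_
    rw [Module.End.mem_maxGenEigenspace]
    refine ⟨1, ?_⟩
    rw [pow_one, LinearMap.sub_apply, A.L0_apply n v hv]
    simp [hn]
  · rw [eq_top_iff, ← A.internal.submodule_iSup_eq_top]
    exact iSup_le fun n => le_iSup_of_le (n : ℂ) (le_iSup₂_of_le n rfl le_rfl)

theorem gr_le_maxGenEigenspace (n : ℤ) : A.gr n ≤ A.L0.maxGenEigenspace n := by
  rw [← A.gr_complex_eq]
  exact le_iSup₂_of_le n rfl le_rfl

/-- Vacuum correlators are defined with the integer grading, correlators of modules with a complex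
one. This lets the same functionals be used for both. -/
theorem mem_restrictedDual_complex_iff (f : Module.Dual ℂ V) :
    f ∈ restrictedDual (fun α => A.L0.maxGenEigenspace α) ↔ f ∈ restrictedDual A.gr := by
  constructor
  · intro h
    refine Set.Finite.subset (h.preimage Int.cast_injective.injOn) ?_
    rintro n ⟨v, hv, hf⟩
    exact ⟨v, A.gr_le_maxGenEigenspace n hv, hf⟩
  · intro h
    refine Set.Finite.subset (h.image ((↑) : ℤ → ℂ)) ?_
    rintro α ⟨v, hv, hf⟩
    by_contra hα
    refine hf ?_
    have hle : ⨆ (n : ℤ) (_ : (n : ℂ) = α), A.gr n ≤ LinearMap.ker f := by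
      refine iSup₂_le fun n hn u hu => ?_
      by_contra hne
      exact hα ⟨n, ⟨u, hu, hne⟩, hn⟩
    rw [A.gr_complex_eq] at hle
    exact hle hv

/-- The operator `L(-1)` as a linear map. -/
def Lm1End : Module.End ℂ V where
  toFun := A.Lm1
  map_add' u v := by simp [Lm1, mode_add]
  map_smul' c v := by simp [Lm1, mode_smul]

/-- The vertex algebra as a module over itself. -/
def toModule : A.GeneralizedModule V where
  Y := A.Y
  L0 := A.L0
  Lm1 := A.Lm1End
  gr := fun α => A.L0.maxGenEigenspace α
  internal := by
    refine DirectSum.isInternal_submodule_of_iSupIndep_of_iSup_eq_top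
      (Module.End.independent_maxGenEigenspace _) ?_
    rw [eq_top_iff, ← A.internal.submodule_iSup_eq_top]
    exact iSup_le fun n => le_iSup_of_le (n : ℂ) (A.gr_le_maxGenEigenspace n)
  bounded_below := by
    obtain ⟨N, hN⟩ := A.bounded_below
    refine ⟨N, fun α hα => ?_⟩
    rw [← A.gr_complex_eq, eq_bot_iff]
    refine iSup₂_le fun n hn => ?_
    rw [hN n]
    rw [← hn, Complex.intCast_re] at hα
    exact_mod_cast hα
  identity := A.identity
  duality := fun u₁ u₂ w w' hw' =>
    A.duality u₁ u₂ w w' ((A.mem_restrictedDual_complex_iff w').1 hw')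
  L0_bracket := A.L0_bracket
  L0_grading := fun α w hw => (Module.End.mem_maxGenEigenspace _ _ _).1 hw
  Lm1_weight := by
    intro α v hv
    rw [← A.gr_complex_eq] at hv
    have h0 : A.one ∈ A.L0.maxGenEigenspace 0 := by
      rw [Module.End.mem_maxGenEigenspace]
      exact ⟨1, by simp [A.L0_one]⟩
    suffices hle : ⨆ (n : ℤ) (_ : (n : ℂ) = α), A.gr n ≤
        (A.L0.maxGenEigenspace (α + 1)).comap A.Lm1End from hle hv
    refine iSup₂_le fun n hn u hu => ?_
    have := mode_mem_maxGenEigenspace A.L0_bracket (A.L0_apply n u hu) h0 (-2)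
    rw [hn, show (0 + α - ((-2 : ℤ) : ℂ) - 1) = α + 1 by push_cast; ring] at this
    exact this
  derivative := A.derivative
  derivative_bracket := A.derivative_bracket

/-! ### Weights and functionals on a module -/

namespace GeneralizedModule

variable {A} (B : A.GeneralizedModule W)

theorem gr_eq_maxGenEigenspace (α : ℂ) : B.gr α = B.L0.maxGenEigenspace α := by
  refine eq_of_le_of_iSupIndep (fun α w hw => ?_) (Module.End.independent_maxGenEigenspace _)
    B.internal.submodule_iSup_eq_top α
  rw [Module.End.mem_maxGenEigenspace]
  exact B.L0_grading α w hw

theorem mode_mem_gr {n : ℤ} {u : V} (hu : u ∈ A.gr n) {α : ℂ} {x : W} (hx : x ∈ B.gr α) (k : ℤ) :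
    mode B.Y u k x ∈ B.gr (α + n - k - 1) := by
  rw [gr_eq_maxGenEigenspace] at hx ⊢
  exact mode_mem_maxGenEigenspace B.L0_bracket (A.L0_apply n u hu) hx k

theorem induction_homogeneous {motive : W → Prop} (w : W)
    (hom : ∀ (α : ℂ), ∀ x ∈ B.gr α, motive x)
    (add : ∀ x y, motive x → motive y → motive (x + y)) : motive w := by
  have hw : w ∈ ⨆ α, B.gr α := by rw [B.internal.submodule_iSup_eq_top]; trivial
  exact Submodule.iSup_induction B.gr (motive := motive) hw hom (hom 0 0 (zero_mem _)) add

theorem restrictedDual_comp_mode (v : V) (n : ℤ) {f : Module.Dual ℂ W}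
    (hf : f ∈ restrictedDual B.gr) : f ∘ₗ mode B.Y v n ∈ restrictedDual B.gr := by
  induction v using A.induction_homogeneous with
  | hom k u hu =>
    refine Set.Finite.subset (Set.Finite.image (s := {α | ∃ w ∈ B.gr α, f w ≠ 0})
      (fun β => β - k + n + 1) hf) ?_
    rintro α ⟨x, hx, hne⟩
    exact ⟨_, ⟨_, B.mode_mem_gr hu hx n, hne⟩, by ring⟩
  | add u u' hu hu' =>
    have : f ∘ₗ mode B.Y (u + u') n = f ∘ₗ mode B.Y u n + f ∘ₗ mode B.Y u' n := by
      ext x; simp [mode_add]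
    rw [this]
    exact add_mem hu hu'

/-- Very negative modes raise the weight beyond the finitely many weights seen by `f`, whatever the
vector, because weights are bounded below. This truncates the outermost variable of every product.
-/
theorem exists_dual_mode_eq_zero (v : V) {f : Module.Dual ℂ W} (hf : f ∈ restrictedDual B.gr) :
    ∃ lo : ℤ, ∀ n < lo, ∀ x, f (mode B.Y v n x) = 0 := by
  induction v using A.induction_homogeneous with
  | hom k u hu =>
    obtain ⟨N, hN⟩ := B.bounded_below
    obtain ⟨R, hR⟩ := (hf.image Complex.re).bddAbove
    obtain ⟨lo, hlo⟩ := exists_int_lt (N + k - 1 - R)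
    refine ⟨lo, fun n hn x => ?_⟩
    induction x using B.induction_homogeneous with
    | hom α x hx =>
      by_contra hne
      have h1 := hR ⟨_, ⟨_, B.mode_mem_gr hu hx n, hne⟩, rfl⟩
      have h2 : N ≤ α.re := by
        by_contra hlt
        rw [hN α (not_le.1 hlt), Submodule.mem_bot] at hx
        exact hne (by simp [hx])
      have h3 : (n : ℝ) < lo := by exact_mod_cast hn
      simp only [Complex.sub_re, Complex.add_re, Complex.intCast_re, Complex.one_re] at h1
      linarith
    | add x y hx hy => rw [map_add, map_add, hx, hy, add_zero]
  | add u u' hu hu' =>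
    obtain ⟨lo, h⟩ := hu
    obtain ⟨lo', h'⟩ := hu'
    refine ⟨min lo lo', fun n hn x => ?_⟩
    have e : mode B.Y (u + u') n x = mode B.Y u n x + mode B.Y u' n x := by simp [mode_add]
    rw [e, map_add, h n (by omega), h' n (by omega), add_zero]

theorem pow_Lm1_mem_gr {α : ℂ} {x : W} (hx : x ∈ B.gr α) (j : ℕ) :
    (B.Lm1 ^ j) x ∈ B.gr (α + j) := by
  induction j with
  | zero => simpa using hx
  | succ j ih =>
    rw [pow_succ', Module.End.mul_apply]
    have := B.Lm1_weight _ _ ih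
    push_cast
    rwa [← add_assoc]

/-- The transpose of `L_W(-1)` on the restricted dual. -/
def dualLm1 : Module.End ℂ (restrictedDual B.gr) where
  toFun f := ⟨(f : Module.Dual ℂ W) ∘ₗ B.Lm1, by
    refine Set.Finite.subset (f.2.image fun β => β - 1) ?_
    rintro α ⟨x, hx, hne⟩
    exact ⟨_, ⟨_, B.Lm1_weight α x hx, hne⟩, by ring⟩⟩
  map_add' f g := by ext; simp
  map_smul' c f := by ext; simp

theorem dualLm1_apply (f : restrictedDual B.gr) (x : W) :
    (B.dualLm1 f : Module.Dual ℂ W) x = (f : Module.Dual ℂ W) (B.Lm1 x) := rfl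

theorem dualLm1_pow_apply (f : restrictedDual B.gr) (j : ℕ) (x : W) :
    ((B.dualLm1 ^ j) f : Module.Dual ℂ W) x = (f : Module.Dual ℂ W) ((B.Lm1 ^ j) x) := by
  induction j generalizing x with
  | zero => simp
  | succ j ih =>
    rw [pow_succ', Module.End.mul_apply, dualLm1_apply, ih, pow_succ, Module.End.mul_apply]

/-- A high power of `L(-1)` pushes every weight above those seen by `f`. Hence `e^{t L(-1)}` acts on
functionals as a polynomial in `t`. -/
theorem exists_dualLm1_pow_eq_zero (f : restrictedDual B.gr) : ∃ K : ℕ, (B.dualLm1 ^ K) f = 0 := by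
  obtain ⟨N, hN⟩ := B.bounded_below
  obtain ⟨R, hR⟩ := (f.2.image Complex.re).bddAbove
  obtain ⟨K, hK⟩ := exists_nat_gt (R - N)
  refine ⟨K, Subtype.ext (LinearMap.ext fun x => ?_)⟩
  rw [dualLm1_pow_apply]
  induction x using B.induction_homogeneous with
  | hom α x hx =>
    by_contra hne
    have h1 := hR ⟨_, ⟨_, B.pow_Lm1_mem_gr hx K, hne⟩, rfl⟩
    have h2 : N ≤ α.re := by
      by_contra hlt
      rw [hN α (not_le.1 hlt), Submodule.mem_bot] at hx
      exact hne (by simp [hx])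
    simp only [Complex.add_re, Complex.natCast_re] at h1
    linarith
  | add x y hx hy => rw [map_add, map_add, hx, hy, ← map_add]

/-! ## Weak commutativity -/

/-- After multiplication by `(z₁ - z₂)^N` both products converge, in opposite regions, to one
Laurent polynomial. Truncated expansions are unique, so both coefficient families agree with its
coefficients. The order `N` is read from the iterate and depends only on `u₁` and `u₂`. -/
theorem weak_commutativity (u₁ u₂ : V) (x : W) {f : Module.Dual ℂ W}
    (hf : f ∈ restrictedDual B.gr) :
    (shiftDiff (1 : ℤ) ^ truncOrder A.Y u₁ u₂)
        (fun m n => f (mode B.Y u₁ m (mode B.Y u₂ n x))) =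
      (shiftDiff (1 : ℤ) ^ truncOrder A.Y u₁ u₂)
        (fun m n => f (mode B.Y u₂ n (mode B.Y u₁ m x))) := by
  set N := truncOrder A.Y u₁ u₂ with hN
  obtain ⟨P, k, hP⟩ := B.duality u₁ u₂ x f hf
  obtain ⟨P', hP'⟩ := exists_reduced_numerator P k k N
    (c := fun n : ℤ × ℤ => f (mode B.Y (mode A.Y u₁ n.1 u₂) n.2 x))
    (fun n hn => by simp [mode_eq_zero_of_truncOrder_le A.Y u₁ u₂ hn, mode_zero])
    (fun z₁ z₂ h1 h2 => by simpa only [mul_pow] using (hP z₁ z₂).2.2 h1 h2)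
  obtain ⟨g, K, hg0, hg⟩ := exists_laurent_coeff P' k
  have hval : ∀ z₁ z₂ : ℂ, z₁ ≠ z₂ → (z₁ - z₂) ^ N *
      (MvPolynomial.eval ![z₁, z₂] P / (z₁ * z₂ * (z₁ - z₂)) ^ k) =
      MvPolynomial.eval ![z₁, z₂] P' / (z₁ * z₂) ^ k := by
    intro z₁ z₂ h
    have := pow_ne_zero N (sub_ne_zero.2 h)
    rw [mul_pow (z₁ * z₂), hP' z₁ z₂ h, mul_comm ((z₁ * z₂) ^ k), ← div_div, mul_div_assoc',
      mul_div_cancel₀ _ this]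
  have hchi : ∀ z : ℂ, z ≠ 0 → ∀ e : ℤ, z ^ (-e - 1) = z * z ^ (-(e + 1) - 1) := by
    intro z hz e
    rw [← zpow_one_add₀ hz]
    congr 1
    ring
  have hne : ∀ {x y : ℂ}, ‖y‖ < ‖x‖ → x ≠ 0 ∧ x ≠ y := fun {x y} h =>
    ⟨norm_pos_iff.1 ((norm_nonneg y).trans_lt h), fun e => by rw [e] at h; exact lt_irrefl _ h⟩
  obtain ⟨lo₁, hlo₁⟩ := B.exists_dual_mode_eq_zero u₁ hf
  obtain ⟨lo₂, hlo₂⟩ := B.exists_dual_mode_eq_zero u₂ hf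
  have h₁ : (shiftDiff (1 : ℤ) ^ N) (fun m n => f (mode B.Y u₁ m (mode B.Y u₂ n x))) - g = 0 := by
    -- The `N` shifts can raise the outer mode by at most `N`, which costs `N` in the lower bound.
    -- The bounds `-K` and `K` account for the Laurent polynomial.
    refine coeff_eq_zero_of_hasSum_zpow_zpow (lo := min (lo₁ - N) (-K))
      (hi := max (truncOrder B.Y u₂ x) K) (fun m hm n => ?_) (fun n hn m => ?_)
      fun z₁ z₂ hz₂ hz => ?_
    · simp only [Pi.sub_apply]
      rw [hg0 m n (by omega), sub_zero]
      exact shiftDiff_pow_eq_zero 1 (fun j a _ => a < lo₁ - j)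
        (fun a e ha => hlo₁ a (by simpa using ha) _)
        (fun j a e ha => by push_cast at ha; constructor <;> linarith) N m n (by omega)
    · simp only [Pi.sub_apply]
      rw [hg0 m n (by omega), sub_zero]
      refine shiftDiff_pow_eq_zero 1 (fun _ _ e => (truncOrder B.Y u₂ x : ℤ) ≤ e) (fun a e he => ?_)
        (fun j a e he => ⟨he, by linarith⟩) N m n (by omega)
      rw [mode_eq_zero_of_truncOrder_le B.Y u₂ x he, map_zero, map_zero]
    · have hne' := hne hz
      have h1 := ((hP z₁ z₂).1 (norm_pos_iff.2 hz₂) hz).congr_fun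
        (g := fun p : ℤ × ℤ => f (mode B.Y u₁ p.1 (mode B.Y u₂ p.2 x)) *
          (z₁ ^ (-p.1 - 1) * z₂ ^ (-p.2 - 1))) fun p => by ring
      have h2 := hasSum_shiftDiff_pow (χ := fun e : ℤ => z₂ ^ (-e - 1)) hne'.1 (hchi z₂ hz₂)
        (f := fun m n => f (mode B.Y u₁ m (mode B.Y u₂ n x))) h1 N
      rw [hval z₁ z₂ hne'.2] at h2
      have h3 := h2.sub (hg z₁ z₂ hne'.1 hz₂)
      rw [sub_self] at h3
      exact h3.congr_fun fun p => by simp only [Pi.sub_apply]; ring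
  -- For the opposite product `z₂` is the outer variable, so the two indices are exchanged before
  -- uniqueness is applied.
  have h₂ : (fun n m => ((shiftDiff (1 : ℤ) ^ N)
      (fun m n => f (mode B.Y u₂ n (mode B.Y u₁ m x))) - g) m n) = 0 := by
    refine coeff_eq_zero_of_hasSum_zpow_zpow (lo := min (lo₂ - N) (-K))
      (hi := max (truncOrder B.Y u₁ x) K) (fun n hn m => ?_) (fun m hm n => ?_)
      fun z₂ z₁ hz₁ hz => ?_
    · simp only [Pi.sub_apply]
      rw [hg0 m n (by omega), sub_zero]
      exact shiftDiff_pow_eq_zero 1 (fun j _ e => e < lo₂ - j)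
        (fun a e ha => hlo₂ e (by simpa using ha) _)
        (fun j a e ha => by push_cast at ha; constructor <;> linarith) N m n (by omega)
    · simp only [Pi.sub_apply]
      rw [hg0 m n (by omega), sub_zero]
      refine shiftDiff_pow_eq_zero 1 (fun _ a _ => (truncOrder B.Y u₁ x : ℤ) ≤ a) (fun a e he => ?_)
        (fun j a e he => ⟨by linarith, he⟩) N m n (by omega)
      rw [mode_eq_zero_of_truncOrder_le B.Y u₁ x he, map_zero, map_zero]
    · have hne' := hne hz
      have h1 := ((hP z₁ z₂).2.1 (norm_pos_iff.2 hz₁) hz).congr_fun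
        (g := fun p : ℤ × ℤ => f (mode B.Y u₂ p.2 (mode B.Y u₁ p.1 x)) *
          (z₁ ^ (-p.1 - 1) * z₂ ^ (-p.2 - 1))) fun p => by ring
      have h2 := hasSum_shiftDiff_pow (χ := fun e : ℤ => z₂ ^ (-e - 1)) hz₁ (hchi z₂ hne'.1)
        (f := fun m n => f (mode B.Y u₂ n (mode B.Y u₁ m x))) h1 N
      rw [hval z₁ z₂ hne'.2.symm] at h2
      have h3 := h2.sub (hg z₁ z₂ hz₁ hne'.1)
      rw [sub_self] at h3
      exact ((Equiv.prodComm ℤ ℤ).hasSum_iff.2 h3).congr_fun fun p => by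
        simp only [Pi.sub_apply, Function.comp, Equiv.prodComm_apply, Prod.fst_swap, Prod.snd_swap]
        ring
  have h₂' : (shiftDiff (1 : ℤ) ^ N) (fun m n => f (mode B.Y u₂ n (mode B.Y u₁ m x))) - g = 0 := by
    funext m n
    exact congrFun (congrFun h₂ n) m
  rw [sub_eq_zero.1 h₁, sub_eq_zero.1 h₂']

end GeneralizedModule

end GradingRestrictedVertexAlgebra

/-! ## Rationality of products of vertex operators -/

section ShiftProd

variable {k : ℕ}

/-- Multiplication of a formal series by the product of the differences of the outer variable and
the variables with indices in a list. -/
def shiftProd (L : List (Fin k)) : Module.End ℂ (ℤ → (Fin k → ℤ) → ℂ) :=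
  (L.map fun j => shiftDiff (Pi.single j (1 : ℤ))).prod

theorem shiftProd_commute (d : Fin k → ℤ) (L : List (Fin k)) :
    Commute (shiftDiff d) (shiftProd L) := by
  refine Commute.list_prod_right _ _ fun x hx => ?_
  obtain ⟨j, -, rfl⟩ := List.mem_map.1 hx
  exact shiftDiff_commute _ _

theorem shiftProd_cons (j : Fin k) (L : List (Fin k)) (f : ℤ → (Fin k → ℤ) → ℂ) :
    shiftProd (j :: L) f = shiftProd L (shiftDiff (Pi.single j 1) f) := by
  have h := shiftProd_commute (Pi.single j 1) L
  rw [shiftProd, List.map_cons, List.prod_cons]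
  exact LinearMap.congr_fun h f

theorem shiftProd_replicate_append (n : ℕ) (j : Fin k) (L : List (Fin k))
    (f : ℤ → (Fin k → ℤ) → ℂ) :
    shiftProd (List.replicate n j ++ L) f = shiftProd L ((shiftDiff (Pi.single j 1) ^ n) f) := by
  induction n generalizing f with
  | zero => rfl
  | succ n ih =>
    rw [List.replicate_succ, List.cons_append, shiftProd_cons, ih, pow_succ, Module.End.mul_apply]

theorem cons_add_single_succ (b : ℤ) (e : Fin k → ℤ) (j : Fin k) :
    (Fin.cons b e : Fin (k + 1) → ℤ) + Pi.single j.succ 1 = Fin.cons b (e + Pi.single j 1) := by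
  funext i
  refine Fin.cases ?_ (fun i => ?_) i
  · simp
  · simp [Pi.single_apply]

theorem cons_add_single_zero (b : ℤ) (e : Fin k → ℤ) :
    (Fin.cons b e : Fin (k + 1) → ℤ) + Pi.single 0 1 = Fin.cons (b + 1) e := by
  funext i
  refine Fin.cases ?_ (fun i => ?_) i <;> simp

theorem shiftProd_map_succ (L : List (Fin k)) (f : ℤ → (Fin (k + 1) → ℤ) → ℂ) (a b : ℤ)
    (e : Fin k → ℤ) :
    shiftProd (L.map Fin.succ) f a (Fin.cons b e) =
      shiftProd L (fun a e => f a (Fin.cons b e)) a e := by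
  induction L generalizing f with
  | nil => rfl
  | cons j L ih =>
    rw [List.map_cons, shiftProd_cons, shiftProd_cons, ih]
    have h : (fun a e => shiftDiff (Pi.single j.succ 1) f a (Fin.cons b e)) =
        shiftDiff (Pi.single j 1) fun a e => f a (Fin.cons b e) := by
      funext a e
      rw [shiftDiff_apply, shiftDiff_apply, cons_add_single_succ]
    rw [h]

/-- The shift by the first inner variable involves only the two outermost modes, which reduces it to
the two-variable setting of weak commutativity. -/
theorem shiftDiff_zero_pow (n : ℕ) (f : ℤ → (Fin (k + 1) → ℤ) → ℂ) (a b : ℤ) (e : Fin k → ℤ) :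
    ((shiftDiff (Pi.single 0 1) ^ n) f) a (Fin.cons b e) =
      ((shiftDiff (1 : ℤ) ^ n) fun a b => f a (Fin.cons b e)) a b := by
  induction n generalizing f with
  | zero => rfl
  | succ n ih =>
    rw [pow_succ, pow_succ, Module.End.mul_apply, Module.End.mul_apply, ih]
    have h : (fun a b => shiftDiff (Pi.single 0 1) f a (Fin.cons b e)) =
        shiftDiff (1 : ℤ) fun a b => f a (Fin.cons b e) := by
      funext a b
      rw [shiftDiff_apply, shiftDiff_apply, cons_add_single_zero]
    rw [h]

/-- The list in which the index `i` is repeated `N i` times. -/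
def repList : {k : ℕ} → (Fin k → ℕ) → List (Fin k)
  | 0, _ => []
  | _ + 1, N => List.replicate (N 0) 0 ++ (repList fun i => N i.succ).map Fin.succ

theorem prod_map_repList (N : Fin k → ℕ) (g : Fin k → ℂ) :
    ((repList N).map g).prod = ∏ i, g i ^ N i := by
  induction k with
  | zero => simp [repList]
  | succ k ih =>
    rw [repList, List.map_append, List.prod_append, List.map_replicate, List.prod_replicate,
      List.map_map, Fin.prod_univ_succ, ← ih (fun i => N i.succ) fun i => g i.succ]
    rfl

theorem monomial_eq_mul_shift {z : Fin k → ℂ} (hz : ∀ i, z i ≠ 0) (j : Fin k) (e : Fin k → ℤ) :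
    ∏ i, z i ^ (-e i - 1) = z j * ∏ i, z i ^ (-(e + Pi.single j 1 : Fin k → ℤ) i - 1) := by
  rw [Fintype.prod_eq_mul_prod_compl j, Fintype.prod_eq_mul_prod_compl j, ← mul_assoc]
  congr 1
  · rw [Pi.add_apply, Pi.single_eq_same, ← zpow_one_add₀ (hz j)]
    congr 1
    ring
  · refine Finset.prod_congr rfl fun i hi => ?_
    rw [Finset.mem_compl, Finset.mem_singleton] at hi
    rw [Pi.add_apply, Pi.single_eq_of_ne hi, add_zero]

theorem tail_mem_orderedRegion {z : Fin (k + 1) → ℂ} (hz : z ∈ orderedRegion (k + 1)) :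
    (fun i : Fin k => z i.succ) ∈ orderedRegion k :=
  ⟨fun _ _ hij => hz.1 _ _ (Fin.succ_lt_succ_iff.2 hij), fun _ => hz.2 _⟩

/-- Only finitely many outer modes `a` survive. Their contributions are put over the common
denominator `z 0 ^ M`, leaving the exponent `M - 1 - a` in the numerator. -/
theorem exists_numerator_of_bounded (q : (Fin k → ℂ) → ℂ) {f : ℤ → (Fin k → ℤ) → ℂ} {lo : ℤ}
    {M : ℕ} (hlo : ∀ a < lo, ∀ e, f a e = 0) (hhi : ∀ a, (M : ℤ) ≤ a → ∀ e, f a e = 0)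
    (hs : ∀ a, ∃ P : MvPolynomial (Fin k) ℂ, ∀ z ∈ orderedRegion k,
      HasSum (fun e => f a e * ∏ i, z i ^ (-e i - 1)) (MvPolynomial.eval z P / q z)) :
    ∃ P : MvPolynomial (Fin (k + 1)) ℂ, ∀ z ∈ orderedRegion (k + 1),
      HasSum (fun p : ℤ × (Fin k → ℤ) =>
          f p.1 p.2 * (z 0 ^ (-p.1 - 1) * ∏ i, z (Fin.succ i) ^ (-p.2 i - 1)))
        (MvPolynomial.eval z P / (z 0 ^ M * q fun i => z i.succ)) := by
  choose P hP using hs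
  refine ⟨∑ a ∈ Finset.Ico lo (M : ℤ), MvPolynomial.X 0 ^ ((M : ℤ) - 1 - a).toNat *
    MvPolynomial.rename Fin.succ (P a), fun z hz => ?_⟩
  have hz0 : z 0 ≠ 0 := norm_pos_iff.1 (hz.2 0)
  have hslice : ∀ a ∈ Finset.Ico lo (M : ℤ), HasSum (fun p : ℤ × (Fin k → ℤ) =>
      if p.1 = a then f p.1 p.2 * (z 0 ^ (-p.1 - 1) * ∏ i, z (Fin.succ i) ^ (-p.2 i - 1)) else 0)
      (z 0 ^ ((M : ℤ) - 1 - a).toNat * MvPolynomial.eval (fun i => z i.succ) (P a) /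
        (z 0 ^ M * q fun i => z i.succ)) := by
    intro a ha
    have hinj : Function.Injective fun e : Fin k → ℤ => (a, e) := fun e e' h => (Prod.mk.inj h).2
    refine (hinj.hasSum_iff fun p hp => if_neg fun h => hp ⟨p.2, by rw [← h]⟩).1 ?_
    have h1 := (hP a _ (tail_mem_orderedRegion hz)).mul_left (z 0 ^ (-a - 1))
    have e1 : z 0 ^ (-a - 1) = z 0 ^ ((M : ℤ) - 1 - a).toNat / z 0 ^ M := by
      rw [eq_div_iff (pow_ne_zero _ hz0), ← zpow_natCast, ← zpow_natCast, ← zpow_add₀ hz0,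
        Int.toNat_of_nonneg (by have := (Finset.mem_Ico.1 ha).2; omega)]
      congr 1
      ring
    have e2 : z 0 ^ (-a - 1) * (MvPolynomial.eval (fun i => z i.succ) (P a) /
        q fun i => z i.succ) = z 0 ^ ((M : ℤ) - 1 - a).toNat *
        MvPolynomial.eval (fun i => z i.succ) (P a) / (z 0 ^ M * q fun i => z i.succ) := by
      rw [e1, div_mul_div_comm]
    rw [e2] at h1
    refine h1.congr_fun fun e => ?_
    simp only [Function.comp, if_true]
    ring
  have h2 := hasSum_sum hslice
  have e3 : MvPolynomial.eval z (∑ a ∈ Finset.Ico lo (M : ℤ),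
      MvPolynomial.X 0 ^ ((M : ℤ) - 1 - a).toNat * MvPolynomial.rename Fin.succ (P a)) /
      (z 0 ^ M * q fun i => z i.succ) = ∑ a ∈ Finset.Ico lo (M : ℤ),
      z 0 ^ ((M : ℤ) - 1 - a).toNat * MvPolynomial.eval (fun i => z i.succ) (P a) /
        (z 0 ^ M * q fun i => z i.succ) := by
    rw [map_sum, Finset.sum_div]
    refine Finset.sum_congr rfl fun a _ => ?_
    rw [map_mul, map_pow, MvPolynomial.eval_X, MvPolynomial.eval_rename]
    rfl
  rw [e3]
  refine h2.congr_fun fun p => ?_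
  rw [Finset.sum_ite_eq]
  split_ifs with hp
  · rfl
  · rw [Finset.mem_Ico, not_and_or] at hp
    rcases hp with hp | hp
    · rw [hlo _ (by omega), zero_mul]
    · rw [hhi _ (by omega), zero_mul]

/-- Each factor `z 0 - z j.succ` is divided out by `hasSum_of_shiftDiff`, available since `z 0` is
the larger variable. The hypotheses survive multiplication by a factor, with the lower bound relaxed
by one. -/
theorem exists_numerator_of_shiftProd (L : List (Fin k)) (q : (Fin k → ℂ) → ℂ)
    {f : ℤ → (Fin k → ℤ) → ℂ} {lo : ℤ} {M : ℕ} (hlo : ∀ a < lo, ∀ e, f a e = 0)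
    (hhi : ∀ a, (M : ℤ) ≤ a → ∀ e, shiftProd L f a e = 0)
    (hs : ∀ a, ∃ P : MvPolynomial (Fin k) ℂ, ∀ z ∈ orderedRegion k,
      HasSum (fun e => f a e * ∏ i, z i ^ (-e i - 1)) (MvPolynomial.eval z P / q z)) :
    ∃ P : MvPolynomial (Fin (k + 1)) ℂ, ∀ z ∈ orderedRegion (k + 1),
      HasSum (fun p : ℤ × (Fin k → ℤ) =>
          f p.1 p.2 * (z 0 ^ (-p.1 - 1) * ∏ i, z (Fin.succ i) ^ (-p.2 i - 1)))
        (MvPolynomial.eval z P /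
          ((L.map fun j => z 0 - z (Fin.succ j)).prod * (z 0 ^ M * q fun i => z i.succ))) := by
  induction L generalizing f lo with
  | nil => simpa using exists_numerator_of_bounded q hlo hhi hs
  | cons j L ih =>
    obtain ⟨P, hP⟩ := ih (f := shiftDiff (Pi.single j 1) f) (lo := lo - 1)
      (fun a ha e => by rw [shiftDiff_apply, hlo _ (by omega), hlo _ (by omega), sub_zero])
      (fun a ha e => by rw [← shiftProd_cons]; exact hhi a ha e)
      (fun a => by
        obtain ⟨P₁, h₁⟩ := hs (a + 1)
        obtain ⟨P₀, h₀⟩ := hs a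
        refine ⟨P₁ - MvPolynomial.X j * P₀, fun z hz => ?_⟩
        have hz0 : ∀ i, z i ≠ 0 := fun i => norm_pos_iff.1 (hz.2 i)
        have h2 := ((Equiv.addRight (Pi.single j (1 : ℤ))).hasSum_iff.2 (h₀ z hz)).mul_left (z j)
        have h3 := (h₁ z hz).sub h2
        rw [map_sub, map_mul, MvPolynomial.eval_X, sub_div, mul_div_assoc]
        refine h3.congr_fun fun e => ?_
        simp only [Function.comp, Equiv.coe_addRight]
        rw [shiftDiff_apply, sub_mul, monomial_eq_mul_shift hz0 j e]
        ring)
    refine ⟨P, fun z hz => ?_⟩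
    have h0 : ∀ i, z i ≠ 0 := fun i => norm_pos_iff.1 (hz.2 i)
    have h1 := hasSum_of_shiftDiff (f := f) (h0 j.succ) (hz.1 0 j.succ (Fin.succ_pos j))
      (χ := fun e : Fin k → ℤ => ∏ i, z (Fin.succ i) ^ (-e i - 1))
      (monomial_eq_mul_shift (z := fun i => z i.succ) (fun i => h0 i.succ) j) hlo (hP z hz)
    rwa [div_div, mul_comm _ (z 0 - z j.succ), ← mul_assoc] at h1

end ShiftProd

theorem poleDenominator_succ {V : Type*} {k : ℕ} (N : V → V → ℕ+) (v : Fin (k + 1) → V)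
    (z : Fin (k + 1) → ℂ) :
    poleDenominator N v z = (∏ j : Fin k, (z 0 - z j.succ) ^ (N (v 0) (v j.succ) : ℕ)) *
      poleDenominator N (fun i => v i.succ) (fun i => z i.succ) := by
  unfold poleDenominator
  rw [Fin.prod_univ_succ, Fin.prod_Ioi_zero]
  simp only [Fin.prod_Ioi_succ]

/-- The product of modes `v_1(n_1) ⋯ v_k(n_k)`. -/
abbrev modeProd (Y : V →ₗ[ℂ] VertexOperator ℂ W) {k : ℕ} (v : Fin k → V) (n : Fin k → ℤ) :
    Module.End ℂ W :=
  (List.ofFn fun i => mode Y (v i) (n i)).prod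

theorem modeProd_succ (Y : V →ₗ[ℂ] VertexOperator ℂ W) {k : ℕ} (v : Fin (k + 1) → V)
    (n : Fin (k + 1) → ℤ) (w : W) :
    modeProd Y v n w = mode Y (v 0) (n 0)
      (modeProd Y (fun i => v i.succ) (fun i => n i.succ) w) := by
  rw [modeProd, List.ofFn_succ, List.prod_cons, Module.End.mul_apply]

namespace GradingRestrictedVertexAlgebra.GeneralizedModule

variable {A : GradingRestrictedVertexAlgebra V} (B : A.GeneralizedModule W)

theorem weak_commutativity_of_le (u₁ u₂ : V) (x : W) {f : Module.Dual ℂ W}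
    (hf : f ∈ restrictedDual B.gr) {N : ℕ} (hN : truncOrder A.Y u₁ u₂ ≤ N) :
    (shiftDiff (1 : ℤ) ^ N) (fun m n => f (mode B.Y u₁ m (mode B.Y u₂ n x))) =
      (shiftDiff (1 : ℤ) ^ N) (fun m n => f (mode B.Y u₂ n (mode B.Y u₁ m x))) := by
  obtain ⟨d, rfl⟩ := Nat.exists_eq_add_of_le' hN
  rw [pow_add, Module.End.mul_apply, Module.End.mul_apply, B.weak_commutativity u₁ u₂ x hf]

/-- The product of the factors `(z₀ - z_i)^N` allows `u` to be moved past every `v i` until it acts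
on `w`, where its modes from `M` on vanish. -/
theorem shiftProd_mode_eq_zero {N : V → V → ℕ} (hN : ∀ u v, truncOrder A.Y u v ≤ N u v) {u : V}
    {w : W} {M : ℤ} (hM : ∀ n, M ≤ n → mode B.Y u n w = 0) {k : ℕ} (v : Fin k → V)
    {f : Module.Dual ℂ W} (hf : f ∈ restrictedDual B.gr) (a : ℤ) (ha : M ≤ a) (e : Fin k → ℤ) :
    shiftProd (repList fun i => N u (v i)) (fun a e => f (mode B.Y u a (modeProd B.Y v e w))) a e =
      0 := by
  induction k generalizing f a with
  | zero =>
    rw [repList, shiftProd, List.map_nil, List.prod_nil, Module.End.one_apply, modeProd,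
      List.ofFn_zero, List.prod_nil, Module.End.one_apply, hM a ha, map_zero]
  | succ k ih =>
    have h1 : (shiftDiff (Pi.single 0 1) ^ N u (v 0))
        (fun a e => f (mode B.Y u a (modeProd B.Y v e w))) =
        (shiftDiff (Pi.single 0 1) ^ N u (v 0)) (fun a e => f (mode B.Y (v 0) (e 0)
          (mode B.Y u a (modeProd B.Y (fun i => v i.succ) (fun i => e i.succ) w)))) := by
      funext a e
      rw [← Fin.cons_self_tail e, shiftDiff_zero_pow, shiftDiff_zero_pow]
      simp only [modeProd_succ B.Y v, Fin.cons_zero, Fin.cons_succ]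
      rw [B.weak_commutativity_of_le u (v 0) _ hf (hN u (v 0))]
    -- The block for the first inner variable is commuted to the outside. The remaining factors then
    -- act behind the fixed mode of `v 0`, which is absorbed into the functional for the induction.
    rw [repList, shiftProd_replicate_append, h1, ← Module.End.mul_apply,
      ← ((shiftProd_commute (Pi.single 0 1) _).pow_left _).eq, Module.End.mul_apply]
    refine shiftDiff_pow_eq_zero _ (fun _ a _ => M ≤ a) (fun a e ha => ?_)
      (fun n a e ha => ⟨by linarith, ha⟩) _ a e ha
    rw [← Fin.cons_self_tail e, shiftProd_map_succ]
    simp only [Fin.cons_zero, Fin.cons_succ]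
    exact ih (fun i => v i.succ) (B.restrictedDual_comp_mode (v 0) (e 0) hf) a ha _

/-- Products of vertex operators converge to rational functions with poles at most on the
diagonals and at the origin, of uniformly bounded order. -/
theorem exists_numerator {N : V → V → ℕ+} (hN : ∀ u v, truncOrder A.Y u v ≤ N u v) {w : W}
    {M : V → ℕ} (hM : ∀ (u : V) (n : ℤ), (M u : ℤ) ≤ n → mode B.Y u n w = 0) {k : ℕ}
    (v : Fin k → V) {f : Module.Dual ℂ W} (hf : f ∈ restrictedDual B.gr) :
    ∃ P : MvPolynomial (Fin k) ℂ, ∀ z ∈ orderedRegion k,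
      HasSum (fun n : Fin k → ℤ => f (modeProd B.Y v n w) * ∏ i, z i ^ (-n i - 1))
        (MvPolynomial.eval z P / ((∏ i, z i ^ M (v i)) * poleDenominator N v z)) := by
  induction k generalizing f with
  | zero =>
    refine ⟨MvPolynomial.C (f w), fun z hz => ?_⟩
    convert hasSum_unique (fun n : Fin 0 → ℤ => f (modeProd B.Y v n w) * ∏ i, z i ^ (-n i - 1))
      using 1
    simp [poleDenominator, modeProd]
  | succ k ih =>
    obtain ⟨lo, hlo⟩ := B.exists_dual_mode_eq_zero (v 0) hf
    obtain ⟨P, hP⟩ := exists_numerator_of_shiftProd (repList fun i => (N (v 0) (v i.succ) : ℕ))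
      (fun z : Fin k → ℂ => (∏ i, z i ^ M (v i.succ)) * poleDenominator N (fun i => v i.succ) z)
      (f := fun a e => f (mode B.Y (v 0) a (modeProd B.Y (fun i => v i.succ) e w)))
      (fun a ha e => hlo a ha _)
      (B.shiftProd_mode_eq_zero (N := fun u v => (N u v : ℕ)) hN (hM (v 0)) _ hf)
      (fun a => by
        have := ih (fun i => v i.succ) (B.restrictedDual_comp_mode (v 0) a hf)
        simpa only [LinearMap.comp_apply] using this)
    refine ⟨P, fun z hz => ?_⟩
    have h1 := hP z hz
    rw [prod_map_repList] at h1
    refine (Fin.consEquiv fun _ => ℤ).hasSum_iff.1 ?_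
    have e1 : (∏ i, z i ^ M (v i)) * poleDenominator N v z =
        (∏ i : Fin k, (z 0 - z i.succ) ^ (N (v 0) (v i.succ) : ℕ)) * (z 0 ^ M (v 0) *
          ((∏ i : Fin k, z i.succ ^ M (v i.succ)) *
            poleDenominator N (fun i => v i.succ) fun i => z i.succ)) := by
      rw [poleDenominator_succ, Fin.prod_univ_succ]
      ring
    rw [e1]
    refine h1.congr_fun fun p => ?_
    simp only [Function.comp, Fin.consEquiv_apply]
    rw [modeProd_succ B.Y v, Fin.prod_univ_succ]
    simp only [Fin.cons_zero, Fin.cons_succ]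
    rfl

end GradingRestrictedVertexAlgebra.GeneralizedModule

/-! ## Uniqueness of rational extensions -/

/-- The region contains a box of infinite sets, the real intervals `(k - i, k - i + 1)`, on which a
polynomial is determined. -/
theorem MvPolynomial_eq_of_orderedRegion {k : ℕ} {P Q : MvPolynomial (Fin k) ℂ}
    (h : ∀ z ∈ orderedRegion k, MvPolynomial.eval z P = MvPolynomial.eval z Q) : P = Q := by
  refine MvPolynomial.funext_set
    (fun i : Fin k => (fun t : ℝ => (t : ℂ)) '' Set.Ioo ((k : ℝ) - i) (k - i + 1)) (fun i => ?_)
    fun z hz => h z ⟨fun i j hij => ?_, fun i => ?_⟩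
  · exact (Set.Ioo_infinite (by linarith)).image Complex.ofReal_injective.injOn
  · obtain ⟨s, hs, hsz⟩ := hz i (Set.mem_univ _)
    obtain ⟨t, ht, htz⟩ := hz j (Set.mem_univ _)
    have hi : ((i : ℕ) : ℝ) + 1 ≤ k := by exact_mod_cast i.2
    have hj : ((j : ℕ) : ℝ) + 1 ≤ k := by exact_mod_cast j.2
    have hij' : ((i : ℕ) : ℝ) + 1 ≤ (j : ℕ) := by exact_mod_cast hij
    rw [← hsz, ← htz, Complex.norm_real, Complex.norm_real,
      Real.norm_of_nonneg (by linarith [ht.1] : (0 : ℝ) ≤ t),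
      Real.norm_of_nonneg (by linarith [hs.1] : (0 : ℝ) ≤ s)]
    linarith [hs.1, ht.2]
  · obtain ⟨s, hs, hsz⟩ := hz i (Set.mem_univ _)
    have hi : ((i : ℕ) : ℝ) + 1 ≤ k := by exact_mod_cast i.2
    rw [← hsz, Complex.norm_real, Real.norm_of_nonneg (by linarith [hs.1])]
    linarith [hs.1]

theorem RationalValue.unique {κ : Type*} {k : ℕ} {s : κ → (Fin k → ℂ) → ℂ} {z : Fin k → ℂ}
    {c d : ℂ} (h : RationalValue (orderedRegion k) s z c)
    (h' : RationalValue (orderedRegion k) s z d) : c = d := by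
  obtain ⟨P, Q, h1, h2, h3⟩ := h
  obtain ⟨P', Q', h1', h2', h3'⟩ := h'
  have key : P * Q' = P' * Q := MvPolynomial_eq_of_orderedRegion fun x hx => by
    have e := (h1 x hx).2.unique (h1' x hx).2
    rw [div_eq_div_iff (h1 x hx).1 (h1' x hx).1] at e
    simpa using e
  rw [h3, h3', div_eq_div_iff h2 h2']
  simpa using congrArg (MvPolynomial.eval z) key

/-! ## Derivatives of rational functions and of their expansions -/

section Derivative

variable {k : ℕ}

theorem hasDerivAt_eval_update (P : MvPolynomial (Fin k) ℂ) (z : Fin k → ℂ) (i : Fin k) (s : ℂ) :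
    HasDerivAt (fun t => MvPolynomial.eval (Function.update z i t) P)
      (MvPolynomial.eval (Function.update z i s) (MvPolynomial.pderiv i P)) s := by
  induction P using MvPolynomial.induction_on with
  | C a => simpa using hasDerivAt_const s a
  | add p q hp hq => simpa using hp.fun_add hq
  | mul_X p j hp =>
    have hX : HasDerivAt (fun t => Function.update z i t j)
        (if i = j then 1 else 0) s := by
      by_cases h : i = j
      · subst h; simpa using hasDerivAt_id' s
      · simpa [h, Function.update_of_ne (Ne.symm h)] using hasDerivAt_const s (z j)
    have := hp.fun_mul hX
    simp only [map_mul, MvPolynomial.eval_X, Derivation.leibniz, MvPolynomial.pderiv_X,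
      smul_eq_mul, map_add]
    refine this.congr_deriv ?_
    by_cases h : i = j
    · subst h; simp; ring
    · simp [h, Ne.symm h]; ring

theorem hasDerivAt_eval_sub (P : MvPolynomial (Fin k) ℂ) (z : Fin k → ℂ) (s : ℂ) :
    HasDerivAt (fun t => MvPolynomial.eval (fun i => z i - t) P)
      (-∑ i, MvPolynomial.eval (fun i => z i - s) (MvPolynomial.pderiv i P)) s := by
  induction P using MvPolynomial.induction_on with
  | C a => simpa using hasDerivAt_const s a
  | add p q hp hq =>
    have := hp.fun_add hq
    simp only [map_add, Finset.sum_add_distrib, neg_add]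
    exact this
  | mul_X p j hp =>
    have hX : HasDerivAt (fun t => z j - t) (-1) s := by
      simpa using (hasDerivAt_id s).const_sub (z j)
    have := hp.fun_mul hX
    simp only [map_mul, MvPolynomial.eval_X, Derivation.leibniz, MvPolynomial.pderiv_X,
      smul_eq_mul, map_add, Finset.sum_add_distrib]
    refine this.congr_deriv ?_
    simp only [← Finset.mul_sum]
    have : ∑ i, MvPolynomial.eval (fun i => z i - s)
        ((Pi.single i 1 : Fin k → MvPolynomial (Fin k) ℂ) j) = 1 := by
      rw [Finset.sum_eq_single j]
      · simp
      · intro b _ hb; simp [hb.symm]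
      · simp
    rw [this]
    ring

/-- The condition bears on `‖t‖` alone, so it also admits the real points `‖z i‖ ± δ`, which need
not be close to `z i`. -/
theorem exists_update_mem_orderedRegion {z : Fin k → ℂ} (hz : z ∈ orderedRegion k) (i : Fin k) :
    ∃ ε > 0, ∀ t : ℂ, |‖t‖ - ‖z i‖| < ε → Function.update z i t ∈ orderedRegion k := by
  have h1 : ∀ᶠ s : ℝ in nhds ‖z i‖, (∀ j, j < i → s < ‖z j‖) ∧
      (∀ j, i < j → ‖z j‖ < s) ∧ 0 < s := by
    refine Filter.Eventually.and ?_ (Filter.Eventually.and ?_ (eventually_gt_nhds (hz.2 i)))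
    · refine Filter.eventually_all.2 fun j => ?_
      by_cases hj : j < i
      · filter_upwards [eventually_lt_nhds (hz.1 j i hj)] with s hs _ using hs
      · exact Filter.Eventually.of_forall fun s h => absurd h hj
    · refine Filter.eventually_all.2 fun j => ?_
      by_cases hj : i < j
      · filter_upwards [eventually_gt_nhds (hz.1 i j hj)] with s hs _ using hs
      · exact Filter.Eventually.of_forall fun s h => absurd h hj
  obtain ⟨ε, hε, h⟩ := Metric.eventually_nhds_iff.1 h1
  refine ⟨ε, hε, fun t ht => ?_⟩
  obtain ⟨ha, hb, hc⟩ := h (y := ‖t‖) (by rwa [Real.dist_eq])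
  refine ⟨fun a b hab => ?_, fun a => ?_⟩
  · by_cases hai : a = i
    · subst hai
      rw [Function.update_self, Function.update_of_ne hab.ne']
      exact hb b hab
    · by_cases hbi : b = i
      · subst hbi
        rw [Function.update_self, Function.update_of_ne hai]
        exact ha a hab
      · rw [Function.update_of_ne hai, Function.update_of_ne hbi]
        exact hz.1 a b hab
  · by_cases hai : a = i
    · subst hai; rwa [Function.update_self]
    · rw [Function.update_of_ne hai]; exact hz.2 a

/-- Exponents of both signs occur, so both ends of the annulus are needed for a common majorant. -/
theorem zpow_le_add_zpow {r₁ r₂ s : ℝ} (h0 : 0 < r₁) (h1 : r₁ ≤ s) (h2 : s ≤ r₂) (m : ℤ) :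
    s ^ m ≤ r₁ ^ m + r₂ ^ m := by
  have hs := h0.trans_le h1
  rcases le_total 0 m with hm | hm
  · have := zpow_le_zpow_left₀ hm hs.le h2
    have := zpow_nonneg h0.le m
    linarith
  · have h3 : s ^ m ≤ r₁ ^ m := by
      obtain ⟨n, rfl⟩ := Int.exists_eq_neg_ofNat hm
      rw [zpow_neg, zpow_neg, zpow_natCast, zpow_natCast]
      gcongr
    have := zpow_nonneg (hs.le.trans h2) m
    linarith

/-- Expansions of rational functions in the ordered region can be differentiated term by term. -/
theorem hasSum_pderiv {c : (Fin k → ℤ) → ℂ} {P Q : MvPolynomial (Fin k) ℂ}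
    (h : ∀ z ∈ orderedRegion k, MvPolynomial.eval z Q ≠ 0 ∧
      HasSum (fun n => c n * ∏ i, z i ^ (-n i - 1))
        (MvPolynomial.eval z P / MvPolynomial.eval z Q))
    {z : Fin k → ℂ} (hz : z ∈ orderedRegion k) (i : Fin k) :
    HasSum (fun n : Fin k → ℤ => (-(n i : ℂ)) * c (n - Pi.single i 1) * ∏ j, z j ^ (-n j - 1))
      ((MvPolynomial.eval z (MvPolynomial.pderiv i P) * MvPolynomial.eval z Q -
        MvPolynomial.eval z P * MvPolynomial.eval z (MvPolynomial.pderiv i Q)) /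
          MvPolynomial.eval z Q ^ 2) := by
  obtain ⟨ε, hε, hreg⟩ := exists_update_mem_orderedRegion hz i
  have hzi := hz.2 i
  set δ : ℝ := min (ε / 2) (‖z i‖ / 2) with hδ
  have hδ0 : 0 < δ := lt_min (by linarith) (by linarith)
  have hδε : δ < ε := (min_le_left _ _).trans_lt (by linarith)
  have hδz : δ < ‖z i‖ := (min_le_right _ _).trans_lt (by linarith)
  set K : (Fin k → ℤ) → ℂ := fun n => ∏ j ∈ {i}ᶜ, z j ^ (-n j - 1) with hK
  have hprod : ∀ (t : ℂ) (n : Fin k → ℤ),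
      ∏ j, Function.update z i t j ^ (-n j - 1) = t ^ (-n i - 1) * K n := by
    intro t n
    rw [Fintype.prod_eq_mul_prod_compl i, Function.update_self]
    congr 1
    refine Finset.prod_congr rfl fun j hj => ?_
    rw [Finset.mem_compl, Finset.mem_singleton] at hj
    rw [Function.update_of_ne hj]
  have hsum : ∀ t : ℂ, |‖t‖ - ‖z i‖| < ε → HasSum (fun n => c n * (t ^ (-n i - 1) * K n))
      (MvPolynomial.eval (Function.update z i t) P /
        MvPolynomial.eval (Function.update z i t) Q) := by
    intro t ht
    simpa only [hprod] using (h _ (hreg t ht)).2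
  have hball : ∀ t ∈ Metric.ball (z i) δ, |‖t‖ - ‖z i‖| < δ := fun t ht =>
    (abs_norm_sub_norm_le t (z i)).trans_lt (by rwa [← dist_eq_norm])
  -- Absolute convergence at two real points, inside and outside the circle of radius `‖z i‖`, gives
  -- a summable majorant on the whole ball around `z i`.
  have hr₁ := (hsum ((‖z i‖ - δ : ℝ) : ℂ) (by
    rw [Complex.norm_real, Real.norm_of_nonneg (by linarith), abs_lt]
    constructor <;> linarith)).summable.norm
  have hr₂ := (hsum ((‖z i‖ + δ : ℝ) : ℂ) (by
    rw [Complex.norm_real, Real.norm_of_nonneg (by linarith), abs_lt]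
    constructor <;> linarith)).summable.norm
  have hderiv : ∀ (n : Fin k → ℤ) (t : ℂ), t ≠ 0 →
      HasDerivAt (fun t => c n * (t ^ (-n i - 1) * K n))
        (c n * (((-n i - 1 : ℤ) : ℂ) * t ^ (-n i - 1 - 1) * K n)) t := fun n t ht =>
    ((hasDerivAt_zpow _ t (Or.inl ht)).mul_const _).const_mul _
  have hne : ∀ t ∈ Metric.ball (z i) δ, t ≠ 0 := by
    intro t ht h0
    have := abs_lt.1 (hball t ht)
    rw [h0, norm_zero] at this
    linarith [this.1]
  have hD := Complex.hasSum_deriv_of_summable_norm (F := fun n t => c n * (t ^ (-n i - 1) * K n))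
    (hr₁.add hr₂) (U := Metric.ball (z i) δ)
    (fun n t ht => (hderiv n t (hne t ht)).differentiableAt.differentiableWithinAt)
    Metric.isOpen_ball (fun n t ht => by
      have h1 := abs_lt.1 (hball t ht)
      have h2 := zpow_le_add_zpow (r₁ := ‖z i‖ - δ) (r₂ := ‖z i‖ + δ) (s := ‖t‖) (by linarith)
        (by linarith) (by linarith) (-n i - 1)
      rw [norm_mul, norm_mul, norm_mul, norm_mul, norm_mul, norm_mul, norm_zpow, norm_zpow,
        norm_zpow, Complex.norm_real, Complex.norm_real, Real.norm_of_nonneg (by linarith),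
        Real.norm_of_nonneg (by linarith), ← mul_add, ← add_mul]
      gcongr) (Metric.mem_ball_self hδ0)
  have hz_upd : Function.update z i (z i) = z := Function.update_eq_self i z
  have hrat : HasDerivAt (fun t => MvPolynomial.eval (Function.update z i t) P /
      MvPolynomial.eval (Function.update z i t) Q)
      ((MvPolynomial.eval z (MvPolynomial.pderiv i P) * MvPolynomial.eval z Q -
        MvPolynomial.eval z P * MvPolynomial.eval z (MvPolynomial.pderiv i Q)) /
          MvPolynomial.eval z Q ^ 2) (z i) := by
    have := (hasDerivAt_eval_update P z i (z i)).fun_div (hasDerivAt_eval_update Q z i (z i))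
      (by rw [hz_upd]; exact (h z hz).1)
    simpa only [hz_upd] using this
  have heq : (fun t => ∑' n, c n * (t ^ (-n i - 1) * K n)) =ᶠ[nhds (z i)]
      fun t => MvPolynomial.eval (Function.update z i t) P /
        MvPolynomial.eval (Function.update z i t) Q := by
    filter_upwards [Metric.ball_mem_nhds (z i) hδ0] with t ht
    exact (hsum t ((hball t ht).trans hδε)).tsum_eq
  rw [heq.deriv_eq, hrat.deriv] at hD
  refine (Equiv.addRight (Pi.single i (1 : ℤ))).hasSum_iff.1 ?_
  refine hD.congr_fun fun n => ?_
  have hz0 : ∀ j, z j ≠ 0 := fun j => norm_pos_iff.1 (hz.2 j)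
  rw [(hderiv n (z i) (hz0 i)).deriv]
  simp only [Function.comp, Equiv.coe_addRight, add_sub_cancel_right, Pi.add_apply,
    Pi.single_eq_same]
  rw [Fintype.prod_eq_mul_prod_compl i]
  have hK' : ∏ j ∈ {i}ᶜ, z j ^ (-(n j + (Pi.single i 1 : Fin k → ℤ) j) - 1) = K n := by
    refine Finset.prod_congr rfl fun j hj => ?_
    rw [Finset.mem_compl, Finset.mem_singleton] at hj
    rw [Pi.single_eq_of_ne hj, add_zero]
  rw [hK', Pi.single_eq_same, show -(n i + 1) - 1 = -n i - 1 - 1 by ring]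
  push_cast
  ring

end Derivative

/-! ## Correlation functions and their translation covariance -/

namespace GradingRestrictedVertexAlgebra.GeneralizedModule

variable {A : GradingRestrictedVertexAlgebra V} (B : A.GeneralizedModule W) {k : ℕ}

theorem Lm1_modeProd (v : Fin k → V) (n : Fin k → ℤ) (w : W) :
    B.Lm1 (modeProd B.Y v n w) = modeProd B.Y v n (B.Lm1 w) +
      ∑ i, (-(n i : ℂ)) • modeProd B.Y v (n - Pi.single i 1) w := by
  induction k with
  | zero => simp [modeProd]
  | succ k ih =>
    rw [modeProd_succ, modeProd_succ, Fin.sum_univ_succ, modeProd_succ]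
    have h1 := B.derivative_bracket (v 0)
      (modeProd B.Y (fun i => v i.succ) (fun i => n i.succ) w) (n 0)
    rw [sub_eq_iff_eq_add] at h1
    rw [h1, ih, map_add, map_sum]
    have e0 : (fun i : Fin k => (n - Pi.single 0 1 : Fin (k + 1) → ℤ) i.succ) =
        fun i => n i.succ := by
      funext i; simp
    have e1 : ∀ i : Fin k, modeProd B.Y v (n - Pi.single i.succ 1) w =
        mode B.Y (v 0) (n 0) (modeProd B.Y (fun i => v i.succ)
          ((fun i => n i.succ) - Pi.single i 1) w) := by
      intro i
      rw [modeProd_succ]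
      have e2 : (fun j : Fin k => (n - Pi.single i.succ 1 : Fin (k + 1) → ℤ) j.succ) =
          (fun i => n i.succ) - Pi.single i 1 := by
        funext j; simp [Pi.single_apply]
      rw [e2]
      simp
    simp only [e1, e0, map_smul]
    simp only [Pi.sub_apply, Pi.single_eq_same]
    abel

/-- The correlation function `⟨f, E_W(v_1, z_1; …; v_k, z_k; w)⟩`. -/
def corr (v : Fin k → V) (f : restrictedDual B.gr) (w : W) (z : Fin k → ℂ) : ℂ :=
  open Classical in if h : ∃ c, IsCorrelatorValue B v w f z c then h.choose else 0

/-- All matrix elements of `E_W(v_1, z_1; …; v_k, z_k; w)` are defined. -/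
def IsRegular (v : Fin k → V) (w : W) (z : Fin k → ℂ) : Prop :=
  ∀ f : restrictedDual B.gr, ∃ c, IsCorrelatorValue B v w f z c

variable {B} {v : Fin k → V} {w : W} {z : Fin k → ℂ}

theorem corr_eq {f : restrictedDual B.gr} {c : ℂ} (h : IsCorrelatorValue B v w f z c) :
    B.corr v f w z = c := by
  have hex : ∃ c, IsCorrelatorValue B v w f z c := ⟨c, h⟩
  rw [corr, dif_pos hex]
  exact RationalValue.unique hex.choose_spec h

theorem IsRegular.isCorrelatorValue (h : B.IsRegular v w z) (f : restrictedDual B.gr) :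
    IsCorrelatorValue B v w f z (B.corr v f w z) := by
  obtain ⟨c, hc⟩ := h f
  rwa [corr_eq hc]

theorem isRegular_zero : B.IsRegular v 0 z :=
  fun _ => ⟨0, RationalValue.zero fun n y => by simp⟩

theorem corr_zero (f : restrictedDual B.gr) : B.corr v f 0 z = 0 :=
  corr_eq (RationalValue.zero fun n y => by simp)

theorem corr_add {w' : W} (h : B.IsRegular v w z) (h' : B.IsRegular v w' z)
    (f : restrictedDual B.gr) : B.corr v f (w + w') z = B.corr v f w z + B.corr v f w' z :=
  corr_eq (RationalValue.add (h.isCorrelatorValue f) (h'.isCorrelatorValue f)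
    fun n y => by simp [add_mul])

theorem corr_smul (h : B.IsRegular v w z) (c : ℂ) (f : restrictedDual B.gr) :
    B.corr v f (c • w) z = c * B.corr v f w z :=
  corr_eq (RationalValue.smul c (h.isCorrelatorValue f) fun n y => by simp [mul_assoc])

/-- The correlation function as a linear functional on the restricted dual. -/
def IsRegular.corrₗ (h : B.IsRegular v w z) : restrictedDual B.gr →ₗ[ℂ] ℂ where
  toFun f := B.corr v f w z
  map_add' f g := corr_eq (RationalValue.add (h.isCorrelatorValue f) (h.isCorrelatorValue g)
    fun n y => by simp [add_mul])
  map_smul' c f := corr_eq (RationalValue.smul c (h.isCorrelatorValue f)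
    fun n y => by simp [mul_assoc])

/-- The case `M (v i) = 0` keeps points with a zero coordinate admissible, as is needed for vacuum
correlators. -/
theorem exists_corr_eq_div {N : V → V → ℕ+} (hN : ∀ u v, truncOrder A.Y u v ≤ N u v)
    {M : V → ℕ} (hM : ∀ (u : V) (n : ℤ), (M u : ℤ) ≤ n → mode B.Y u n w = 0) (v : Fin k → V)
    (f : restrictedDual B.gr) :
    ∃ P : MvPolynomial (Fin k) ℂ, ∀ z : Fin k → ℂ, Function.Injective z →
      (∀ i, M (v i) = 0 ∨ z i ≠ 0) → IsCorrelatorValue B v w f z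
        (MvPolynomial.eval z P / ((∏ i, z i ^ M (v i)) * poleDenominator N v z)) := by
  obtain ⟨P, hP⟩ := B.exists_numerator hN hM v f.2
  have hev : ∀ z, MvPolynomial.eval z ((∏ i, MvPolynomial.X i ^ M (v i)) * polePolynomial N v) =
      (∏ i, z i ^ M (v i)) * poleDenominator N v z := by
    intro z
    rw [map_mul, eval_polePolynomial]
    simp
  have hne : ∀ z : Fin k → ℂ, Function.Injective z → (∀ i, M (v i) = 0 ∨ z i ≠ 0) →
      (∏ i, z i ^ M (v i)) * poleDenominator N v z ≠ 0 := by
    intro z hz h0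
    refine mul_ne_zero (Finset.prod_ne_zero_iff.2 fun i _ => ?_) (poleDenominator_ne_zero N v hz)
    rcases h0 i with h | h
    · simp [h]
    · exact pow_ne_zero _ h
  refine ⟨P, fun z hz h0 => ⟨P, (∏ i, MvPolynomial.X i ^ M (v i)) * polePolynomial N v,
    fun x hx => ?_, ?_, ?_⟩⟩
  · rw [hev]
    refine ⟨hne x (fun i j hij => ?_) fun i => Or.inr (norm_pos_iff.1 (hx.2 i)), hP x hx⟩
    by_contra h
    rcases lt_or_gt_of_ne h with h | h
    · exact (hx.1 _ _ h).ne (by rw [hij])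
    · exact (hx.1 _ _ h).ne (by rw [hij])
  · rw [hev]; exact hne z hz h0
  · rw [hev]

variable (B) in
theorem isRegular_of_ne_zero (v : Fin k → V) (w : W) (hz : Function.Injective z)
    (h0 : ∀ i, z i ≠ 0) : B.IsRegular v w z := by
  intro f
  obtain ⟨P, hP⟩ := exists_corr_eq_div (B := B)
    (N := fun u v => ⟨truncOrder A.Y u v + 1, Nat.succ_pos _⟩)
    (fun u v => Nat.le_succ _) (fun u n hn => mode_eq_zero_of_truncOrder_le B.Y u w hn) v f
  exact ⟨_, hP z hz fun i => Or.inr (h0 i)⟩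

/-- Commuting `L(-1)` through a product differentiates it in each variable. This identity of
expansions in the ordered region becomes a polynomial identity after clearing denominators, hence
holds at every regular point. -/
theorem hasDerivAt_corr (f : restrictedDual B.gr) (h : B.IsRegular v w z)
    (hL : B.IsRegular v (B.Lm1 w) z) :
    HasDerivAt (fun t : ℂ => B.corr v f w fun i => z i - t)
      (B.corr v f (B.Lm1 w) z - B.corr v (B.dualLm1 f) w z) 0 := by
  obtain ⟨P, Q, h1, h2, -⟩ := h.isCorrelatorValue f
  obtain ⟨P₁, Q₁, h1₁, h2₁, h3₁⟩ := hL.isCorrelatorValue f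
  obtain ⟨P₂, Q₂, h1₂, h2₂, h3₂⟩ := h.isCorrelatorValue (B.dualLm1 f)
  have key : (∑ i, (MvPolynomial.pderiv i P * Q - P * MvPolynomial.pderiv i Q)) * (Q₁ * Q₂) =
      (P₂ * Q₁ - P₁ * Q₂) * Q ^ 2 := by
    refine MvPolynomial_eq_of_orderedRegion fun x hx => ?_
    have hd := hasSum_sum fun i (_ : i ∈ Finset.univ) => hasSum_pderiv h1 hx i
    have hs := (h1₂ x hx).2.sub (h1₁ x hx).2
    have e := hd.unique (hs.congr_fun fun n => ?_)
    · have a := (h1 x hx).1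
      have b := (h1₁ x hx).1
      have c := (h1₂ x hx).1
      rw [← Finset.sum_div, div_sub_div _ _ c b, div_eq_div_iff (pow_ne_zero 2 a)
        (mul_ne_zero c b)] at e
      simp only [map_mul, map_sum, map_sub, map_pow] at e ⊢
      linear_combination e
    · rw [← sub_mul, dualLm1_apply, B.Lm1_modeProd v n w, map_add, add_sub_cancel_left, map_sum,
        Finset.sum_mul]
      refine Finset.sum_congr rfl fun i _ => ?_
      rw [map_smul, smul_eq_mul]
  have hQ : HasDerivAt (fun t : ℂ => MvPolynomial.eval (fun i => z i - t) P /
      MvPolynomial.eval (fun i => z i - t) Q)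
      (B.corr v f (B.Lm1 w) z - B.corr v (B.dualLm1 f) w z) 0 := by
    refine ((hasDerivAt_eval_sub P z 0).fun_div (hasDerivAt_eval_sub Q z 0)
      (by simpa using h2)).congr_deriv ?_
    have e := congrArg (MvPolynomial.eval z) key
    simp only [map_mul, map_sum, map_sub, map_pow, Finset.sum_sub_distrib, ← Finset.sum_mul,
      ← Finset.mul_sum] at e
    simp only [sub_zero]
    rw [h3₁, h3₂, div_sub_div _ _ h2₁ h2₂, div_eq_div_iff (pow_ne_zero 2 h2) (mul_ne_zero h2₁ h2₂)]
    linear_combination -e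
  refine hQ.congr_of_eventuallyEq ?_
  have hcont : Continuous fun t : ℂ => MvPolynomial.eval (fun i => z i - t) Q :=
    (MvPolynomial.continuous_eval Q).comp (by fun_prop)
  have hev : ∀ᶠ t in nhds (0 : ℂ), MvPolynomial.eval (fun i => z i - t) Q ≠ 0 :=
    hcont.continuousAt.eventually_ne (by simpa using h2)
  filter_upwards [hev] with t ht
  exact corr_eq ⟨P, Q, h1, ht, rfl⟩

theorem hasDerivAt_corr_sub (f : restrictedDual B.gr) {s : ℂ}
    (h : B.IsRegular v w fun i => z i - s) (hL : B.IsRegular v (B.Lm1 w) fun i => z i - s) :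
    HasDerivAt (fun t : ℂ => B.corr v f w fun i => z i - t)
      (B.corr v f (B.Lm1 w) (fun i => z i - s) - B.corr v (B.dualLm1 f) w fun i => z i - s) s := by
  have h1 := hasDerivAt_corr f h hL
  have h2 : HasDerivAt (fun t : ℂ => t - s) 1 s := by simpa using (hasDerivAt_id' s).sub_const s
  have h3 := HasDerivAt.comp (h₂ := fun t : ℂ => B.corr v f w fun i => z i - s - t)
    (h := fun t => t - s) s (by simpa using h1) h2
  refine (h3.congr_deriv (mul_one _)).congr_of_eventuallyEq
    (Filter.Eventually.of_forall fun t => ?_)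
  simp

variable (B) in
/-- `∑_a t^a / a! ⟨f L_W(-1)^a, E_W(v_1, z_1 - t; …; v_k, z_k - t; w)⟩`, where `K` bounds the
number of non-zero terms. -/
def transl (K : ℕ) (v : Fin k → V) (f : restrictedDual B.gr) (w : W) (z : Fin k → ℂ) (t : ℂ) : ℂ :=
  ∑ a ∈ Finset.range K, t ^ a / (a.factorial : ℂ) *
    B.corr v ((B.dualLm1 ^ a) f) w fun i => z i - t

/-- Differentiating `t ^ a / a!` cancels against the terms with one more `L(-1)` on the functional,
the last of which vanishes by `hK`. Only `L(-1)` acting on `w` remains. -/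
theorem hasDerivAt_transl {K : ℕ} {f : restrictedDual B.gr} (hK : (B.dualLm1 ^ K) f = 0) {s : ℂ}
    (h : B.IsRegular v w fun i => z i - s) (hL : B.IsRegular v (B.Lm1 w) fun i => z i - s) :
    HasDerivAt (B.transl K v f w z) (B.transl K v f (B.Lm1 w) z s) s := by
  have hterm : ∀ a ∈ Finset.range K, HasDerivAt (fun t : ℂ => t ^ a / (a.factorial : ℂ) *
      B.corr v ((B.dualLm1 ^ a) f) w fun i => z i - t)
      ((a * s ^ (a - 1) / (a.factorial : ℂ)) * B.corr v ((B.dualLm1 ^ a) f) w (fun i => z i - s) +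
        s ^ a / (a.factorial : ℂ) * (B.corr v ((B.dualLm1 ^ a) f) (B.Lm1 w) (fun i => z i - s) -
          B.corr v ((B.dualLm1 ^ (a + 1)) f) w fun i => z i - s)) s := by
    intro a _
    have h1 := hasDerivAt_corr_sub ((B.dualLm1 ^ a) f) h hL
    rw [← Module.End.mul_apply, ← pow_succ'] at h1
    exact ((hasDerivAt_pow a s).div_const _).fun_mul h1
  refine (HasDerivAt.fun_sum hterm).congr_deriv ?_
  rw [transl, Finset.sum_add_distrib]
  simp only [mul_sub, Finset.sum_sub_distrib]
  have hshift : ∑ a ∈ Finset.range K, (a * s ^ (a - 1) / (a.factorial : ℂ)) *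
      B.corr v ((B.dualLm1 ^ a) f) w (fun i => z i - s) =
      ∑ a ∈ Finset.range K, s ^ a / (a.factorial : ℂ) *
        B.corr v ((B.dualLm1 ^ (a + 1)) f) w fun i => z i - s := by
    cases K with
    | zero => simp
    | succ K =>
      rw [Finset.sum_range_succ' _ K, Finset.sum_range_succ _ K, hK]
      have h0 : B.corr v (0 : restrictedDual B.gr) w (fun i => z i - s) = 0 := h.corrₗ.map_zero
      rw [h0]
      simp only [Nat.cast_zero, zero_mul, zero_div, mul_zero, add_zero]
      refine Finset.sum_congr rfl fun a _ => ?_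
      rw [Nat.factorial_succ, Nat.add_sub_cancel]
      push_cast
      have : (a : ℂ) + 1 ≠ 0 := by exact_mod_cast Nat.succ_ne_zero a
      have : (a.factorial : ℂ) ≠ 0 := by exact_mod_cast a.factorial_ne_zero
      field_simp
  rw [hshift]
  ring

theorem transl_zero {K : ℕ} {f : restrictedDual B.gr} (hK : (B.dualLm1 ^ K) f = 0)
    (h : B.IsRegular v w z) : B.transl K v f w z 0 = B.corr v f w z := by
  cases K with
  | zero =>
    have hf : f = 0 := hK
    rw [hf]
    exact h.corrₗ.map_zero.symm
  | succ K =>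
    rw [transl, Finset.sum_range_succ']
    simp

-- The function `transl` is holomorphic in `t` as long as no `z i - t` vanishes, and its `j`-th
-- derivative at `0` is the correlator of `L(-1)^j w`. The series is its Taylor series.
variable (B) in
theorem hasSum_transl {K : ℕ} {f : restrictedDual B.gr} (hK : (B.dualLm1 ^ K) f = 0)
    (v : Fin k → V) (w : W) (hz : Function.Injective z) {t : ℂ} (ht : ∀ i, ‖t‖ < ‖z i‖) :
    HasSum (fun j : ℕ => t ^ j / (j.factorial : ℂ) * B.corr v f ((B.Lm1 ^ j) w) z)
      (B.transl K v f w z t) := by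
  obtain ⟨r, hr, hrz⟩ : ∃ r : ℝ, ‖t‖ < r ∧ ∀ i, r ≤ ‖z i‖ := by
    rcases isEmpty_or_nonempty (Fin k) with hk | hk
    · exact ⟨‖t‖ + 1, by linarith, fun i => hk.elim i⟩
    · obtain ⟨i, hi⟩ := Finite.exists_min fun i => ‖z i‖
      exact ⟨‖z i‖, ht i, hi⟩
  have hreg : ∀ s ∈ Metric.ball (0 : ℂ) r, ∀ w, B.IsRegular v w fun i => z i - s := by
    intro s hs w
    refine B.isRegular_of_ne_zero v w (fun i j hij => hz (by simpa using hij)) fun i => ?_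
    rw [sub_ne_zero]
    intro h
    rw [mem_ball_zero_iff, ← h] at hs
    exact absurd hs (not_lt.2 (hrz i))
  have hd : ∀ w, ∀ s ∈ Metric.ball (0 : ℂ) r,
      HasDerivAt (B.transl K v f w z) (B.transl K v f (B.Lm1 w) z s) s := fun w s hs =>
    hasDerivAt_transl hK (hreg s hs _) (hreg s hs _)
  have h0 : (0 : ℂ) ∈ Metric.ball (0 : ℂ) r :=
    Metric.mem_ball_self ((norm_nonneg t).trans_lt hr)
  have hiter : ∀ (j : ℕ) (w : W), ∀ s ∈ Metric.ball (0 : ℂ) r,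
      iteratedDeriv j (B.transl K v f w z) s = B.transl K v f ((B.Lm1 ^ j) w) z s := by
    intro j
    induction j with
    | zero => intro w s _; simp
    | succ j ih =>
      intro w s hs
      rw [iteratedDeriv_succ]
      have heq : iteratedDeriv j (B.transl K v f w z) =ᶠ[nhds s]
          B.transl K v f ((B.Lm1 ^ j) w) z := by
        filter_upwards [Metric.isOpen_ball.mem_nhds hs] with s' hs' using ih w s' hs'
      rw [heq.deriv_eq, (hd _ s hs).deriv, pow_succ', Module.End.mul_apply]
  have hdiff : DifferentiableOn ℂ (B.transl K v f w z) (Metric.ball 0 r) := fun s hs =>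
    (hd w s hs).differentiableAt.differentiableWithinAt
  have hT := Complex.hasSum_taylorSeries_on_ball hdiff (mem_ball_zero_iff.2 hr)
  refine hT.congr_fun fun j => ?_
  have hz' : B.IsRegular v ((B.Lm1 ^ j) w) z := by simpa using hreg 0 h0 ((B.Lm1 ^ j) w)
  rw [hiter j w 0 h0, transl_zero hK hz', sub_zero, smul_eq_mul, smul_eq_mul]
  ring

end GradingRestrictedVertexAlgebra.GeneralizedModule

/-! ## Cochains with one entry are composable -/

theorem homComponent_of_mem {ι W : Type*} [AddCommGroup W] [Module ℂ W] [DecidableEq ι]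
    {gr : ι → Submodule ℂ W} (h : DirectSum.IsInternal gr) {i : ι} {x : W} (hx : x ∈ gr i) (j : ι) :
    homComponent h j x = if i = j then x else 0 := by
  have h1 : (LinearEquiv.ofBijective (DirectSum.coeLinearMap gr) h).symm x =
      DirectSum.lof ℂ ι (fun i => gr i) i ⟨x, hx⟩ :=
    (LinearEquiv.symm_apply_eq _).2 (DirectSum.coeLinearMap_lof gr i ⟨x, hx⟩).symm
  rw [homComponent, LinearMap.comp_apply, LinearMap.comp_apply, LinearEquiv.coe_coe, h1]
  by_cases hij : i = j
  · subst hij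
    rw [if_pos rfl, DirectSum.component.lof_self]
    rfl
  · rw [if_neg hij, DirectSum.component.of, dif_neg hij]
    rfl

theorem poleDenominator_castSucc {V : Type*} {m : ℕ} (N : V → V → ℕ+) (v : Fin (m + 1) → V)
    (z : Fin (m + 1) → ℂ) :
    poleDenominator N v z =
      (∏ i : Fin m, (z i.castSucc - z (Fin.last m)) ^ (N (v i.castSucc) (v (Fin.last m)) : ℕ)) *
        poleDenominator N (fun i : Fin m => v i.castSucc) fun i => z i.castSucc := by
  induction m with
  | zero => simp [poleDenominator]
  | succ m ih =>
    rw [poleDenominator_succ, ih, poleDenominator_succ N (fun i : Fin (m + 1) => v i.castSucc),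
      Fin.prod_univ_castSucc, Fin.prod_univ_succ]
    simp only [Fin.succ_castSucc, Fin.succ_last, Fin.castSucc_zero]
    ring

theorem poleDenominator_sub {V : Type*} {m : ℕ} (N : V → V → ℕ+) (v : Fin m → V)
    (z : Fin m → ℂ) (t : ℂ) : poleDenominator N v (fun i => z i - t) = poleDenominator N v z := by
  simp [poleDenominator]

theorem GradingRestrictedVertexAlgebra.expL0_of_mem (A : GradingRestrictedVertexAlgebra V) (a : ℂ)
    {n : ℤ} {v : V} (hv : v ∈ A.gr n) : A.expL0 a v = Complex.exp (a * n) • v := by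
  rw [GradingRestrictedVertexAlgebra.expL0, finsum_eq_single _ n]
  · rw [homComponent_of_mem A.internal hv, if_pos rfl]
  · intro m hm
    rw [homComponent_of_mem A.internal hv, if_neg hm.symm, smul_zero]

theorem GradingRestrictedVertexAlgebra.Lm1_one (A : GradingRestrictedVertexAlgebra V) :
    A.Lm1 A.one = 0 := by
  rw [GradingRestrictedVertexAlgebra.Lm1, A.identity, if_neg (by norm_num)]

namespace GradingRestrictedVertexAlgebra.GeneralizedModule

variable {A : GradingRestrictedVertexAlgebra V} {B : A.GeneralizedModule W}

theorem pair_Lm1Bar (f : restrictedDual B.gr) (x : Completion B.gr) :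
    pair f (B.Lm1Bar x) = pair (B.dualLm1 f) x := by
  unfold pair
  exact finsum_comp_equiv (Equiv.subRight (1 : ℂ))
    (f := fun α => (B.dualLm1 f : Module.Dual ℂ W) (x.1 α))

/-- Applying the last non-zero power of `L(0) - α` removes the nilpotent part of the exponential, so
`e^{aα} = e^{aβ}` for all `a`. The choice `a = 1 / (α - β)` gives `e = 1`. -/
theorem eq_zero_of_expL0Component_eq {α β : ℂ} (hαβ : α ≠ β) {x : W} (hx : x ∈ B.gr α)
    (h : ∀ a : ℂ, B.expL0Component a α x = Complex.exp (a * β) • x) : x = 0 := by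
  by_contra hx0
  set D : Module.End ℂ W := B.L0 - α • (1 : Module.End ℂ W) with hD
  have hex : ∃ N : ℕ, (D ^ N) x = 0 := B.L0_grading α x hx
  classical
  obtain ⟨N, hN, hmin⟩ : ∃ N : ℕ, (D ^ (N + 1)) x = 0 ∧ (D ^ N) x ≠ 0 := by
    have h0 : Nat.find hex ≠ 0 := fun h0 => hx0 (by simpa [h0] using Nat.find_spec hex)
    obtain ⟨N, hN⟩ := Nat.exists_eq_succ_of_ne_zero h0
    exact ⟨N, by simpa [hN] using Nat.find_spec hex, Nat.find_min hex (by omega)⟩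
  have h1 : ∀ a : ℂ, Complex.exp (a * α) • (D ^ N) x = Complex.exp (a * β) • (D ^ N) x := by
    intro a
    have h2 := congrArg (D ^ N) (h a)
    rw [expL0Component, map_smul, map_smul, map_finsum (D ^ N) (expL0_finite a α hx)] at h2
    rw [finsum_eq_single _ 0] at h2
    · simpa using h2
    · intro j hj
      obtain ⟨j, rfl⟩ := Nat.exists_eq_succ_of_ne_zero hj
      rw [map_smul, ← Module.End.mul_apply, ← hD, ← pow_add,
        show N + (j + 1) = j + (N + 1) by ring, pow_add, Module.End.mul_apply, hN, map_zero,
        smul_zero]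
  have h3 := h1 (1 / (α - β))
  rw [← sub_eq_zero, ← sub_smul, smul_eq_zero, or_iff_left hmin, sub_eq_zero] at h3
  have hne := sub_ne_zero.2 hαβ
  have h4 : Complex.exp 1 = 1 := by
    have e : 1 / (α - β) * α - 1 / (α - β) * β = 1 := by
      rw [← mul_sub, one_div, inv_mul_cancel₀ hne]
    rw [← e, Complex.exp_sub, h3, div_self (Complex.exp_ne_zero _), e]
  have h5 : Real.exp 1 = 1 := Complex.ofReal_injective (by simpa using h4)
  have := Real.add_one_lt_exp (one_ne_zero)
  linarith

/-- `∑_a t^a / a! f L_W(-1)^a`, where `K` bounds the number of non-zero terms. -/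
def expDual (B : A.GeneralizedModule W) (K : ℕ) (t : ℂ) (f : restrictedDual B.gr) :
    restrictedDual B.gr :=
  ∑ a ∈ Finset.range K, (t ^ a / (a.factorial : ℂ)) • (B.dualLm1 ^ a) f

theorem expDual_apply (K : ℕ) (t : ℂ) (f : restrictedDual B.gr) (x : W) :
    (B.expDual K t f : Module.Dual ℂ W) x =
      ∑ a ∈ Finset.range K,
        t ^ a / (a.factorial : ℂ) * ((B.dualLm1 ^ a) f : Module.Dual ℂ W) x := by
  simp [expDual]

theorem corr_expDual {k : ℕ} {v : Fin k → V} {w : W} {z : Fin k → ℂ} {t : ℂ}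
    (h : B.IsRegular v w fun i => z i - t) (K : ℕ) (f : restrictedDual B.gr) :
    B.corr v (B.expDual K t f) w (fun i => z i - t) = B.transl K v f w z t := by
  have := map_sum h.corrₗ (fun a => (t ^ a / (a.factorial : ℂ)) • (B.dualLm1 ^ a) f)
    (Finset.range K)
  simp only [map_smul, smul_eq_mul] at this
  exact this

theorem transl_add {k : ℕ} {v : Fin k → V} {w w' : W} {z : Fin k → ℂ} {t : ℂ}
    (h : B.IsRegular v w fun i => z i - t) (h' : B.IsRegular v w' fun i => z i - t) (K : ℕ)
    (f : restrictedDual B.gr) :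
    B.transl K v f (w + w') z t = B.transl K v f w z t + B.transl K v f w' z t := by
  rw [transl, transl, transl, ← Finset.sum_add_distrib]
  exact Finset.sum_congr rfl fun a _ => by rw [corr_add h h', mul_add]

/-! ### Cochains as exponentials of their value at the origin -/

section Cochain

variable {Φ : Cochain B}

/-- Scaling fixes the origin, so the conjugation property makes `e^{a L(0)}` act on `Φ(v, 0)` by the
scalar `e^{an}`. -/
theorem IsWValued.component_zero_eq_zero (h : IsWValued B Φ) {n : ℤ} {v : V} (hv : v ∈ A.gr n)
    {α : ℂ} (hα : α ≠ n) : (Φ 0 v).1 α = 0 := by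
  refine eq_zero_of_expL0Component_eq (B := B) hα ((Φ 0 v).2 α (Set.mem_univ _)) fun a => ?_
  have := h.conjugation a v 0 α
  rwa [mul_zero, A.expL0_of_mem a hv, map_smul, Completion.smul_val, Pi.smul_apply] at this

theorem IsWValued.finite_support (h : IsWValued B Φ) (v : V) :
    (Function.support (Φ 0 v).1).Finite := by
  induction v using A.induction_homogeneous with
  | hom n v hv =>
    refine (Set.finite_singleton (n : ℂ)).subset fun α hα => ?_
    by_contra hne
    exact hα (h.component_zero_eq_zero hv hne)
  | add u v hu hv =>
    rw [map_add, Completion.add_val]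
    exact (hu.union hv).subset (Function.support_add _ _)

/-- The value at the origin of a cochain, as a linear map to the module itself. -/
def IsWValued.atZero (h : IsWValued B Φ) : V →ₗ[ℂ] W where
  toFun v := ∑ᶠ α, (Φ 0 v).1 α
  map_add' u v := by
    rw [map_add, Completion.add_val]
    exact finsum_add_distrib (h.finite_support u) (h.finite_support v)
  map_smul' c v := by
    rw [map_smul, Completion.smul_val, RingHom.id_apply, smul_finsum' _ (h.finite_support v)]
    rfl

theorem IsWValued.atZero_of_mem (h : IsWValued B Φ) {n : ℤ} {v : V} (hv : v ∈ A.gr n) :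
    h.atZero v = (Φ 0 v).1 n :=
  finsum_eq_single _ _ fun _ hα => h.component_zero_eq_zero hv hα

theorem IsWValued.atZero_mem (h : IsWValued B Φ) {n : ℤ} {v : V} (hv : v ∈ A.gr n) :
    h.atZero v ∈ B.gr n := by
  rw [h.atZero_of_mem hv]
  exact (Φ 0 v).2 _ (Set.mem_univ _)

theorem IsWValued.pair_zero_eq (h : IsWValued B Φ) (f : restrictedDual B.gr) (v : V) :
    pair f (Φ 0 v) = (f : Module.Dual ℂ W) (h.atZero v) :=
  (map_finsum (f : Module.Dual ℂ W) (h.finite_support v)).symm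

theorem IsWValued.hasDerivAt_pair (h : IsWValued B Φ) (f : restrictedDual B.gr) (v : V) (z : ℂ) :
    HasDerivAt (fun x => pair f (Φ x v)) (pair (B.dualLm1 f) (Φ z v)) z := by
  rw [← pair_Lm1Bar]
  exact h.derivative_W v f z

/-- In matrix elements, `Φ(v, z) = e^{z L(-1)} Φ(v, 0)`. By induction on the nilpotency order the
two sides have equal derivatives, and they agree at the origin. -/
theorem IsWValued.pair_eq (h : IsWValued B Φ) {K : ℕ} {f : restrictedDual B.gr}
    (hK : (B.dualLm1 ^ K) f = 0) (v : V) (z : ℂ) :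
    pair f (Φ z v) = (B.expDual K z f : Module.Dual ℂ W) (h.atZero v) := by
  rw [expDual_apply]
  induction K generalizing f z with
  | zero =>
    have hf : f = 0 := hK
    rw [hf]
    simp [pair]
  | succ K ih =>
    set g : ℂ → ℂ := fun z => ∑ a ∈ Finset.range (K + 1), z ^ a / (a.factorial : ℂ) *
      ((B.dualLm1 ^ a) f : Module.Dual ℂ W) (h.atZero v) with hg
    have hK' : (B.dualLm1 ^ K) (B.dualLm1 f) = 0 := by
      rwa [← Module.End.mul_apply, ← pow_succ]
    have hgd : ∀ s, HasDerivAt g (pair (B.dualLm1 f) (Φ s v)) s := by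
      intro s
      have h1 : ∀ a ∈ Finset.range (K + 1), HasDerivAt (fun z : ℂ => z ^ a / (a.factorial : ℂ) *
          ((B.dualLm1 ^ a) f : Module.Dual ℂ W) (h.atZero v))
          (a * s ^ (a - 1) / (a.factorial : ℂ) *
            ((B.dualLm1 ^ a) f : Module.Dual ℂ W) (h.atZero v)) s := fun a _ =>
        ((hasDerivAt_pow a s).div_const _).mul_const _
      refine (HasDerivAt.fun_sum h1).congr_deriv ?_
      rw [ih hK' s, Finset.sum_range_succ']
      simp only [Nat.cast_zero, zero_mul, zero_div, add_zero]
      refine Finset.sum_congr rfl fun a _ => ?_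
      rw [Nat.factorial_succ, Nat.add_sub_cancel, pow_succ B.dualLm1, Module.End.mul_apply]
      push_cast
      have : (a : ℂ) + 1 ≠ 0 := by exact_mod_cast Nat.succ_ne_zero a
      have : (a.factorial : ℂ) ≠ 0 := by exact_mod_cast a.factorial_ne_zero
      field_simp
    have hconst : ∀ s, HasDerivAt (fun z => pair f (Φ z v) - g z) 0 s := fun s =>
      ((h.hasDerivAt_pair f v s).fun_sub (hgd s)).congr_deriv (sub_self _)
    have h2 := is_const_of_deriv_eq_zero (fun s => (hconst s).differentiableAt)
      (fun s => (hconst s).deriv) z 0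
    have h3 : g 0 = (f : Module.Dual ℂ W) (h.atZero v) := by
      simp only [hg]
      rw [Finset.sum_range_succ']
      simp
    simp only [h3, h.pair_zero_eq, sub_self] at h2
    exact sub_eq_zero.1 h2

/-- A linear functional on `W` restricted to one homogeneous subspace. -/
def componentDual (B : A.GeneralizedModule W) (g : Module.Dual ℂ W) (q : ℂ) :
    restrictedDual B.gr :=
  ⟨g ∘ₗ homComponent B.internal q, by
    refine (Set.finite_singleton q).subset ?_
    rintro α ⟨x, hx, hne⟩
    by_contra hα
    refine hne ?_
    rw [LinearMap.comp_apply, homComponent_of_mem B.internal hx,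
      if_neg (show ¬α = q from hα), map_zero]⟩

theorem componentDual_apply (g : Module.Dual ℂ W) (q : ℂ) (x : W) :
    (B.componentDual g q : Module.Dual ℂ W) x = g (homComponent B.internal q x) := rfl

theorem pair_componentDual (g : Module.Dual ℂ W) (q : ℂ) (x : Completion B.gr) :
    pair (B.componentDual g q) x = g (x.1 q) := by
  rw [pair, finsum_eq_single _ q]
  · rw [componentDual_apply, homComponent_of_mem B.internal (x.2 q (Set.mem_univ _)), if_pos rfl]
  · intro α hα
    rw [componentDual_apply, homComponent_of_mem B.internal (x.2 α (Set.mem_univ _)), if_neg hα,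
      map_zero]

/-- Testing against functionals supported in one weight turns the exponential formula into one for
single components. -/
theorem IsWValued.dual_component (h : IsWValued B Φ) {n : ℤ} {v : V} (hv : v ∈ A.gr n) (z q : ℂ)
    (g : Module.Dual ℂ W) {K : ℕ} (hK : (B.dualLm1 ^ K) (B.componentDual g q) = 0) :
    g ((Φ z v).1 q) = ∑ a ∈ Finset.range K, z ^ a / (a.factorial : ℂ) *
      if (n : ℂ) + a = q then g ((B.Lm1 ^ a) (h.atZero v)) else 0 := by
  rw [← pair_componentDual, h.pair_eq hK, expDual_apply]
  refine Finset.sum_congr rfl fun a _ => ?_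
  rw [dualLm1_pow_apply, componentDual_apply,
    homComponent_of_mem B.internal (B.pow_Lm1_mem_gr (h.atZero_mem hv) a)]
  split_ifs <;> simp

theorem IsWValued.component_add_natCast (h : IsWValued B Φ) {n : ℤ} {v : V} (hv : v ∈ A.gr n)
    (z : ℂ) (j : ℕ) :
    (Φ z v).1 (n + j) = (z ^ j / (j.factorial : ℂ)) • (B.Lm1 ^ j) (h.atZero v) := by
  rw [← sub_eq_zero, ← Module.forall_dual_apply_eq_zero_iff ℂ]
  intro g
  obtain ⟨K, hK⟩ := B.exists_dualLm1_pow_eq_zero (B.componentDual g (n + j))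
  -- The nilpotency bound is enlarged by `j + 1` so that the summand `a = j` certainly lies in the
  -- range.
  rw [map_sub, map_smul, smul_eq_mul, sub_eq_zero, h.dual_component hv z _ g (K := j + 1 + K)
    (by rw [pow_add, Module.End.mul_apply, hK, map_zero]), Finset.sum_eq_single j]
  · rw [if_pos rfl]
  · intro a _ ha
    rw [if_neg (by simpa using ha), mul_zero]
  · intro hj
    exact absurd (Finset.mem_range.2 (by omega)) hj

theorem IsWValued.component_eq_zero (h : IsWValued B Φ) {n : ℤ} {v : V} (hv : v ∈ A.gr n)
    (z : ℂ) {q : ℂ} (hq : ∀ j : ℕ, (n : ℂ) + j ≠ q) : (Φ z v).1 q = 0 := by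
  rw [← Module.forall_dual_apply_eq_zero_iff ℂ]
  intro g
  obtain ⟨K, hK⟩ := B.exists_dualLm1_pow_eq_zero (B.componentDual g q)
  rw [h.dual_component hv z q g hK]
  exact Finset.sum_eq_zero fun a _ => by rw [if_neg (hq a), mul_zero]

/-- For `u` of weight `n` only the components `q = n + j` survive, and they equal `t ^ j / j!
L(-1)^j` applied to the value at the origin: the sum over `q` is the Taylor series of `transl`. -/
theorem IsWValued.hasSum_corr (h : IsWValued B Φ) {K : ℕ} {f : restrictedDual B.gr}
    (hK : (B.dualLm1 ^ K) f = 0) {k : ℕ} (v : Fin k → V) (u : V) {y : Fin k → ℂ}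
    (hy : Function.Injective y) {t : ℂ} (ht : ∀ i, ‖t‖ < ‖y i‖) :
    HasSum (fun q => B.corr v f ((Φ t u).1 q) y) (B.transl K v f (h.atZero u) y t) := by
  have hreg : ∀ w, B.IsRegular v w y := fun w =>
    B.isRegular_of_ne_zero v w hy fun i => norm_pos_iff.1 ((norm_nonneg t).trans_lt (ht i))
  have hreg' : ∀ w, B.IsRegular v w fun i => y i - t := fun w =>
    B.isRegular_of_ne_zero v w (fun i j hij => hy (by simpa using hij)) fun i =>
      sub_ne_zero.2 fun e => (ht i).ne (by rw [e])
  induction u using A.induction_homogeneous with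
  | hom n u hu =>
    have hinj : Function.Injective fun j : ℕ => (n : ℂ) + j := fun a b hab => by simpa using hab
    refine (hinj.hasSum_iff fun q hq => ?_).1 ?_
    · rw [h.component_eq_zero hu t fun j hj => hq ⟨j, hj⟩, corr_zero]
    · refine (B.hasSum_transl hK v (h.atZero u) hy ht).congr_fun fun j => ?_
      simp only [Function.comp]
      rw [h.component_add_natCast hu, corr_smul (hreg _)]
  | add u u' hu hu' =>
    rw [map_add h.atZero, transl_add (hreg' _) (hreg' _)]
    refine (hu.add hu').congr_fun fun q => ?_
    rw [map_add, Completion.add_val, Pi.add_apply, corr_add (hreg _) (hreg _)]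

/-- Pole orders for the correlation functions of a cochain. -/
def IsWValued.poleOrder (h : IsWValued B Φ) (u v : V) : ℕ+ :=
  ⟨truncOrder A.Y u v + truncOrder B.Y u (h.atZero v) + 1, Nat.succ_pos _⟩

/-- The correlators are taken at `z_i - z_{m+1}`, so their poles at the origin become poles on the
diagonals with the last variable. `poleOrder` dominates both truncation orders, hence works for all
pairs at once. -/
theorem IsWValued.exists_transl_eq_div (h : IsWValued B Φ) (K : ℕ) (f : restrictedDual B.gr)
    {m : ℕ} (v : Fin (m + 1) → V) :
    ∃ P : MvPolynomial (Fin (m + 1)) ℂ, ∀ z : Fin (m + 1) → ℂ, Function.Injective z →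
      B.transl K (fun i : Fin m => v i.castSucc) f (h.atZero (v (Fin.last m)))
        (fun i => z i.castSucc) (z (Fin.last m)) =
      MvPolynomial.eval z P / poleDenominator h.poleOrder v z := by
  have hN : ∀ u v, truncOrder A.Y u v ≤ h.poleOrder u v := fun u v => by
    simp only [poleOrder, PNat.mk_coe]; omega
  have hM : ∀ (u : V) (n : ℤ), ((h.poleOrder u (v (Fin.last m)) : ℕ) : ℤ) ≤ n →
      mode B.Y u n (h.atZero (v (Fin.last m))) = 0 := fun u n hn =>
    mode_eq_zero_of_truncOrder_le B.Y u _ (by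
      simp only [poleOrder, PNat.mk_coe] at hn; push_cast at hn; omega)
  choose P hP using fun a : ℕ => exists_corr_eq_div (B := B) hN
    (M := fun u => (h.poleOrder u (v (Fin.last m)) : ℕ)) hM
    (fun i : Fin m => v i.castSucc) ((B.dualLm1 ^ a) f)
  refine ⟨∑ a ∈ Finset.range K, MvPolynomial.C (1 / (a.factorial : ℂ)) *
    MvPolynomial.X (Fin.last m) ^ a * MvPolynomial.aeval (fun i : Fin m =>
      (MvPolynomial.X i.castSucc - MvPolynomial.X (Fin.last m) : MvPolynomial (Fin (m + 1)) ℂ))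
      (P a), fun z hz => ?_⟩
  rw [transl, map_sum, Finset.sum_div]
  refine Finset.sum_congr rfl fun a _ => ?_
  rw [corr_eq (hP a (fun i => z i.castSucc - z (Fin.last m))
    (fun i j hij => Fin.castSucc_injective m (hz (by simpa using hij)))
    fun i => Or.inr (sub_ne_zero.2 fun e => (Fin.castSucc_lt_last i).ne (hz e))),
    poleDenominator_sub, ← poleDenominator_castSucc]
  have hcomp : MvPolynomial.eval z (MvPolynomial.aeval (fun i : Fin m =>
      (MvPolynomial.X i.castSucc - MvPolynomial.X (Fin.last m) : MvPolynomial (Fin (m + 1)) ℂ))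
      (P a)) = MvPolynomial.eval (fun i => z i.castSucc - z (Fin.last m)) (P a) := by
    have : (MvPolynomial.eval z).comp (MvPolynomial.aeval (fun i : Fin m =>
        (MvPolynomial.X i.castSucc - MvPolynomial.X (Fin.last m) :
          MvPolynomial (Fin (m + 1)) ℂ))).toRingHom =
        MvPolynomial.eval (fun i => z i.castSucc - z (Fin.last m)) :=
      MvPolynomial.ringHom_ext (fun r => by simp [MvPolynomial.algebraMap_eq]) fun i => by simp
    exact congrArg (fun φ => φ (P a)) this
  rw [map_mul, map_mul, hcomp, map_pow, MvPolynomial.eval_C, MvPolynomial.eval_X]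
  ring

theorem IsWValued.givenByRationalFunction_isSumJ (h : IsWValued B Φ) {m : ℕ}
    (D : Set (Fin (m + 1) → ℂ)) : GivenByRationalFunction B D (IsSumJ B Φ) := by
  refine ⟨h.poleOrder, fun v f => ?_⟩
  obtain ⟨K, hK⟩ := B.exists_dualLm1_pow_eq_zero f
  obtain ⟨P, hP⟩ := h.exists_transl_eq_div K f v
  refine ⟨P, fun z _ hz h1 h2 => ?_⟩
  have hinj : Function.Injective fun i : Fin m => z i.castSucc :=
    hz.comp (Fin.castSucc_injective m)
  refine ⟨fun q => B.corr (fun i : Fin m => v i.castSucc) f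
    ((Φ (z (Fin.last m)) (v (Fin.last m))).1 q) fun i => z i.castSucc, fun q => ?_, ?_⟩
  · exact (B.isRegular_of_ne_zero _ _ hinj fun i =>
      norm_pos_iff.1 (h2.trans (h1 i))).isCorrelatorValue f
  · rw [← hP z hz]
    exact h.hasSum_corr hK _ _ hinj h1

/-- The transpose of the value of a cochain at the origin. -/
def IsWValued.pullback (h : IsWValued B Φ) :
    restrictedDual B.gr →ₗ[ℂ] restrictedDual A.toModule.gr where
  toFun f := ⟨(f : Module.Dual ℂ W) ∘ₗ h.atZero, by
    refine (A.mem_restrictedDual_complex_iff _).2 ?_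
    refine Set.Finite.subset (f.2.preimage Int.cast_injective.injOn) ?_
    rintro n ⟨v, hv, hne⟩
    exact ⟨_, h.atZero_mem hv, hne⟩⟩
  map_add' f g := by ext; simp
  map_smul' c f := by ext; simp

/-- Comparing the two `L(-1)`-derivative properties at the origin shows that the value at the origin
intertwines `L(-1)` on `V` and `W`. -/
theorem IsWValued.dualLm1_pullback (h : IsWValued B Φ) (f : restrictedDual B.gr) :
    A.toModule.dualLm1 (h.pullback f) = h.pullback (B.dualLm1 f) := by
  refine Subtype.ext (LinearMap.ext fun v => ?_)
  have h1 := (h.derivative_V v f 0).unique (h.derivative_W v f 0)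
  rw [pair_Lm1Bar, h.pair_zero_eq, h.pair_zero_eq] at h1
  exact h1

theorem IsWValued.dualLm1_pow_pullback (h : IsWValued B Φ) (f : restrictedDual B.gr) (a : ℕ) :
    (A.toModule.dualLm1 ^ a) (h.pullback f) = h.pullback ((B.dualLm1 ^ a) f) := by
  induction a with
  | zero => rfl
  | succ a ih =>
    rw [pow_succ', pow_succ', Module.End.mul_apply, Module.End.mul_apply, ih, h.dualLm1_pullback]

theorem IsWValued.pullback_expDual (h : IsWValued B Φ) (K : ℕ) (t : ℂ) (f : restrictedDual B.gr) :
    h.pullback (B.expDual K t f) = A.toModule.expDual K t (h.pullback f) := by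
  rw [expDual, expDual, map_sum]
  exact Finset.sum_congr rfl fun a _ => by rw [map_smul, h.dualLm1_pow_pullback]

/-- The creation property permits `M = 0`, so there is no pole at the origin. -/
theorem exists_vacuum_corr_eq_div {k : ℕ} (v : Fin k → V) (f : restrictedDual A.toModule.gr) :
    ∃ P : MvPolynomial (Fin k) ℂ, ∀ z : Fin k → ℂ, Function.Injective z →
      IsCorrelatorValue A.toModule v A.one f z (MvPolynomial.eval z P /
        poleDenominator (fun u v => ⟨truncOrder A.Y u v + 1, Nat.succ_pos _⟩) v z) := by
  obtain ⟨P, hP⟩ := exists_corr_eq_div (B := A.toModule)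
    (N := fun u v => ⟨truncOrder A.Y u v + 1, Nat.succ_pos _⟩) (fun u v => Nat.le_succ _)
    (w := A.one) (M := fun _ => 0) (fun u n hn => A.creation u n (by simpa using hn)) v f
  exact ⟨P, fun z hz => by simpa using hP z hz fun i => Or.inl rfl⟩

/-- `L(-1)` annihilates the vacuum, so the derivative in `t` is zero. -/
theorem vacuum_transl_eq {k : ℕ} {v : Fin k → V} {K : ℕ} {f : restrictedDual A.toModule.gr}
    (hK : (A.toModule.dualLm1 ^ K) f = 0) {z : Fin k → ℂ} (hz : Function.Injective z) (t : ℂ) :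
    A.toModule.transl K v f A.one z t = A.toModule.corr v f A.one z := by
  have hreg : ∀ s : ℂ, A.toModule.IsRegular v A.one fun i => z i - s := fun s g => by
    obtain ⟨P, hP⟩ := exists_vacuum_corr_eq_div v g
    exact ⟨_, hP _ fun i j hij => hz (by simpa using hij)⟩
  have hL : A.toModule.Lm1 A.one = 0 := A.Lm1_one
  have hd : ∀ s, HasDerivAt (A.toModule.transl K v f A.one z) 0 s := by
    intro s
    refine (hasDerivAt_transl hK (hreg s) (by rw [hL]; exact isRegular_zero)).congr_deriv ?_
    rw [hL, transl]
    exact Finset.sum_eq_zero fun a _ => by rw [corr_zero, mul_zero]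
  rw [is_const_of_deriv_eq_zero (fun s => (hd s).differentiableAt) (fun s => (hd s).deriv) t 0,
    transl_zero hK (by simpa using hreg 0)]

/-- Pairing `Φ(·, ζ)` with `f` is the functional `μ` in the restricted dual of `V`, so the sum over
`r` is finite and equals a vacuum correlator at `z - ζ`. Translation invariance removes `ζ`. -/
theorem IsWValued.givenByRationalFunction_isSumI (h : IsWValued B Φ) {k : ℕ}
    (D : Set (Fin k → ℂ)) : GivenByRationalFunction B D (IsSumI B Φ) := by
  refine ⟨fun u v => ⟨truncOrder A.Y u v + 1, Nat.succ_pos _⟩, fun v f => ?_⟩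
  obtain ⟨K, hK⟩ := B.exists_dualLm1_pow_eq_zero f
  obtain ⟨P, hP⟩ := exists_vacuum_corr_eq_div v (h.pullback f)
  refine ⟨P, fun z _ hz ζ x hx => ?_⟩
  have hK' : (A.toModule.dualLm1 ^ K) (h.pullback f) = 0 := by
    rw [h.dualLm1_pow_pullback, hK, map_zero]
  set μ := h.pullback (B.expDual K ζ f) with hμ
  have hμA : (μ : Module.Dual ℂ V) ∈ restrictedDual A.gr :=
    (A.mem_restrictedDual_complex_iff _).1 μ.2
  have hreg : A.toModule.IsRegular v A.one fun i => z i - ζ := fun g => by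
    obtain ⟨P, hP⟩ := exists_vacuum_corr_eq_div v g
    exact ⟨_, hP _ fun i j hij => hz (by simpa using hij)⟩
  have hval : pair (⟨μ, hμA⟩ : restrictedDual A.gr) x =
      MvPolynomial.eval z P /
        poleDenominator (fun u v => ⟨truncOrder A.Y u v + 1, Nat.succ_pos _⟩) v z := by
    have h1 : IsCorrelatorValue A.toModule v A.one μ (fun i => z i - ζ)
        (pair (⟨μ, hμA⟩ : restrictedDual A.gr) x) := hx ⟨μ, hμA⟩
    rw [← corr_eq h1, ← corr_eq (hP z hz), ← vacuum_transl_eq hK' hz ζ, hμ, h.pullback_expDual,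
      corr_expDual hreg]
  rw [← hval, pair, ← tsum_eq_finsum (L := SummationFilter.unconditional _) (pair_finite _ x)]
  have hs : HasSum (fun r => (μ : Module.Dual ℂ V) (x.1 r))
      (∑' r, (μ : Module.Dual ℂ V) (x.1 r)) :=
    (summable_of_hasFiniteSupport (pair_finite (⟨μ, hμA⟩ : restrictedDual A.gr) x)).hasSum
  refine hs.congr_fun fun r => ?_
  exact h.pair_eq hK (x.1 r) ζ

theorem IsWValued.composableOn (h : IsWValued B Φ) {m : ℕ} (D : Set (Fin (m + 1) → ℂ)) :
    ComposableOn B D Φ :=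
  ⟨h.givenByRationalFunction_isSumI D, h.givenByRationalFunction_isSumJ D⟩

end Cochain

end GradingRestrictedVertexAlgebra.GeneralizedModule

/-! ## The two-point connection form as a rational function -/

theorem RationalValue.mono {κ : Type*} {k : ℕ} {U U' : Set (Fin k → ℂ)}
    {s : κ → (Fin k → ℂ) → ℂ} {z : Fin k → ℂ} {c : ℂ} (h : RationalValue U s z c) (hU : U' ⊆ U) :
    RationalValue U' s z c := by
  obtain ⟨P, Q, h1, h2, h3⟩ := h
  exact ⟨P, Q, fun x hx => h1 x (hU hx), h2, h3⟩

theorem apply_zero_ne_of_mem_orderedRegion {x : Fin 2 → ℂ} (hx : x ∈ orderedRegion 2) :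
    x 0 ≠ x 1 := fun e => by
  have := hx.1 0 1 (by decide)
  rw [e] at this
  exact lt_irrefl _ this

theorem eval_aeval_X {k : ℕ} (p : Polynomial ℂ) (i : Fin k) (x : Fin k → ℂ) :
    MvPolynomial.eval x (Polynomial.aeval (MvPolynomial.X i : MvPolynomial (Fin k) ℂ) p) =
      p.eval (x i) := by
  simp [Polynomial.aeval_eq_sum_range, Polynomial.eval_eq_sum_range]

namespace GradingRestrictedVertexAlgebra.GeneralizedModule

variable {A : GradingRestrictedVertexAlgebra V} {B : A.GeneralizedModule W}

theorem dualLm1_pow_eq_zero_of_le {K j : ℕ} {f : restrictedDual B.gr}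
    (hK : (B.dualLm1 ^ K) f = 0) (hj : K ≤ j) : (B.dualLm1 ^ j) f = 0 := by
  rw [← Nat.sub_add_cancel hj, pow_add, Module.End.mul_apply, hK, map_zero]

theorem dualLm1_pow_expDual {K : ℕ} {f : restrictedDual B.gr} (hK : (B.dualLm1 ^ K) f = 0)
    (t : ℂ) : (B.dualLm1 ^ K) (B.expDual K t f) = 0 := by
  rw [expDual, map_sum]
  refine Finset.sum_eq_zero fun a _ => ?_
  rw [map_smul, ← Module.End.mul_apply, ← pow_add,
    dualLm1_pow_eq_zero_of_le hK (Nat.le_add_right K a), smul_zero]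

/-- The binomial theorem. Truncating both exponentials at `K` does no harm, since terms with `a + b
≥ K` vanish. -/
theorem expDual_expDual {K : ℕ} {f : restrictedDual B.gr} (hK : (B.dualLm1 ^ K) f = 0)
    (s t : ℂ) : B.expDual K s (B.expDual K t f) = B.expDual K (s + t) f := by
  have h1 : B.expDual K s (B.expDual K t f) = ∑ a ∈ Finset.range K, ∑ b ∈ Finset.range (K - a),
      (s ^ a / (a.factorial : ℂ) * (t ^ b / (b.factorial : ℂ))) • (B.dualLm1 ^ (a + b)) f := by
    rw [expDual]
    refine Finset.sum_congr rfl fun a _ => ?_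
    rw [expDual, map_sum, Finset.smul_sum]
    refine (Finset.sum_subset (Finset.range_mono (Nat.sub_le K a)) fun b _ hb => ?_).symm.trans
      (Finset.sum_congr rfl fun b _ => ?_)
    · rw [Finset.mem_range, not_lt] at hb
      rw [map_smul, ← Module.End.mul_apply, ← pow_add, dualLm1_pow_eq_zero_of_le hK (by omega),
        smul_zero, smul_zero]
    · rw [map_smul, ← Module.End.mul_apply, ← pow_add, smul_smul]
  rw [h1, ← Finset.sum_range_diag_flip K fun a b =>
    (s ^ a / (a.factorial : ℂ) * (t ^ b / (b.factorial : ℂ))) • (B.dualLm1 ^ (a + b)) f, expDual]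
  refine Finset.sum_congr rfl fun c _ => ?_
  rw [add_pow, Finset.sum_div, Finset.sum_smul]
  refine Finset.sum_congr rfl fun a ha => ?_
  have hac : a ≤ c := Nat.lt_succ_iff.1 (Finset.mem_range.1 ha)
  rw [Nat.add_sub_cancel' hac, Nat.cast_choose ℂ hac]
  congr 1
  have := c.factorial_ne_zero
  have := a.factorial_ne_zero
  have := (c - a).factorial_ne_zero
  field_simp

theorem hasSum_corr_singleton (v : V) (f : restrictedDual B.gr) (w : W) {x : ℂ} (hx : x ≠ 0) :
    HasSum (fun n : ℤ => (f : Module.Dual ℂ W) (mode B.Y v n w) * x ^ (-n - 1))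
      (B.corr (fun _ : Fin 1 => v) f w fun _ => x) := by
  have hreg : B.IsRegular (fun _ : Fin 1 => v) w fun _ => x :=
    B.isRegular_of_ne_zero _ _ (Function.injective_of_subsingleton _) fun _ => hx
  obtain ⟨P, Q, h1, h2, h3⟩ := hreg.isCorrelatorValue f
  have hmem : (fun _ => x) ∈ orderedRegion 1 :=
    ⟨fun i j hij => absurd hij (by simp [Subsingleton.elim i j]), fun _ => norm_pos_iff.2 hx⟩
  have h4 := (Equiv.funUnique (Fin 1) ℤ).symm.hasSum_iff.2 (h1 _ hmem).2
  rw [h3]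
  refine h4.congr_fun fun n => ?_
  simp

section Cochain

variable {Φ : Cochain B}

theorem IsWValued.pair_add_eq (h : IsWValued B Φ) {K : ℕ} {f : restrictedDual B.gr}
    (hK : (B.dualLm1 ^ K) f = 0) (v : V) (z t : ℂ) :
    pair f (Φ (z + t) v) = pair (B.expDual K t f) (Φ z v) := by
  rw [h.pair_eq hK, h.pair_eq (dualLm1_pow_expDual hK t), expDual_expDual hK]

/-- The value at `(z₁, z₂)` of the rational function `⟨f, Y_W(v₁, z₁) Φ(v₂, z₂)⟩`. -/
def IsWValued.leftValue (h : IsWValued B Φ) (K : ℕ) (v₁ v₂ : V) (f : restrictedDual B.gr)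
    (z₁ z₂ : ℂ) : ℂ :=
  B.transl K (fun _ : Fin 1 => v₁) f (h.atZero v₂) (fun _ => z₁) z₂

/-- The value at `(z₁, z₂)` of the rational function `⟨f, Φ(Y_V(v₁, z₁ - z₂)v₂, z₂)⟩`. -/
def middleValue (Φ : Cochain B) (v₁ v₂ : V) (f : restrictedDual B.gr) (z₁ z₂ : ℂ) : ℂ :=
  ∑ᶠ n : ℤ, pair f (Φ z₂ (mode A.Y v₁ n v₂)) * (z₁ - z₂) ^ (-n - 1)

/-- The value depends on the points only through `z₁ - z₂` and `f e^{z₂ L(-1)}`, and the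
exponentials compose. -/
theorem IsWValued.leftValue_add (h : IsWValued B Φ) {K : ℕ} {f : restrictedDual B.gr}
    (hK : (B.dualLm1 ^ K) f = 0) (v₁ v₂ : V) {z₁ z₂ : ℂ} (hz : z₁ ≠ z₂) (t : ℂ) :
    h.leftValue K v₁ v₂ f (z₁ + t) (z₂ + t) = h.leftValue K v₁ v₂ (B.expDual K t f) z₁ z₂ := by
  have hreg : B.IsRegular (fun _ : Fin 1 => v₁) (h.atZero v₂) fun _ => z₁ - z₂ :=
    B.isRegular_of_ne_zero _ _ (Function.injective_of_subsingleton _) fun _ => sub_ne_zero.2 hz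
  rw [leftValue, leftValue, ← corr_expDual (by simpa using hreg), ← corr_expDual hreg,
    expDual_expDual hK]
  simp

theorem IsWValued.middleValue_add (h : IsWValued B Φ) {K : ℕ} {f : restrictedDual B.gr}
    (hK : (B.dualLm1 ^ K) f = 0) (v₁ v₂ : V) (z₁ z₂ t : ℂ) :
    middleValue Φ v₁ v₂ f (z₁ + t) (z₂ + t) = middleValue Φ v₁ v₂ (B.expDual K t f) z₁ z₂ := by
  rw [middleValue, middleValue]
  exact finsum_congr fun n => by rw [h.pair_add_eq hK, add_sub_add_right_eq_sub]

theorem IsWValued.exists_leftValue_eq_div (h : IsWValued B Φ) (K : ℕ) (v₁ v₂ : V)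
    (f : restrictedDual B.gr) :
    ∃ (P : MvPolynomial (Fin 2) ℂ) (N : ℕ), ∀ x : Fin 2 → ℂ, x 0 ≠ x 1 →
      h.leftValue K v₁ v₂ f (x 0) (x 1) = MvPolynomial.eval x P / (x 0 - x 1) ^ N := by
  obtain ⟨P, hP⟩ := h.exists_transl_eq_div K f (m := 1) ![v₁, v₂]
  refine ⟨P, h.poleOrder v₁ v₂, fun x hx => ?_⟩
  have hinj : Function.Injective x := by
    intro i j hij
    fin_cases i <;> fin_cases j <;> simp_all
  have h1 := hP x hinj
  have e1 : (fun i : Fin 1 => ![v₁, v₂] i.castSucc) = fun _ => v₁ := by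
    funext i; simp [Subsingleton.elim i 0]
  have e2 : (fun i : Fin 1 => x i.castSucc) = fun _ => x 0 := by
    funext i; simp [Subsingleton.elim i 0]
  rw [e1, e2, poleDenominator_castSucc] at h1
  simpa [poleDenominator, leftValue, Fin.last] using h1

/-- Absolute convergence of the double series is a statement about the whole region, so the
hypothesis at one point supplies it for all. Summing over modes and then over weights identifies the
sum as `leftValue`, whose only pole is the diagonal. -/
theorem IsWValued.isLeftTerm (h : IsWValued B Φ) {K : ℕ} {f : restrictedDual B.gr}
    (hK : (B.dualLm1 ^ K) f = 0) {v₁ v₂ : V} {y₁ y₂ c : ℂ}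
    (hleft : IsLeftTerm B Φ v₁ v₂ f y₁ y₂ c) {z₁ z₂ : ℂ} (hz : z₁ ≠ z₂) :
    IsLeftTerm B Φ v₁ v₂ f z₁ z₂ (h.leftValue K v₁ v₂ f z₁ z₂) := by
  obtain ⟨P₀, Q₀, h1, -, -⟩ := hleft
  obtain ⟨P, N, hP⟩ := h.exists_leftValue_eq_div K v₁ v₂ f
  have hQ : ∀ x : Fin 2 → ℂ, MvPolynomial.eval x
      ((MvPolynomial.X 0 - MvPolynomial.X 1 : MvPolynomial (Fin 2) ℂ) ^ N) = (x 0 - x 1) ^ N :=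
    fun x => by simp
  refine ⟨P, (MvPolynomial.X 0 - MvPolynomial.X 1) ^ N, fun x hx => ?_, ?_, ?_⟩
  · have hne := apply_zero_ne_of_mem_orderedRegion hx
    have h0 : x 0 ≠ 0 := norm_pos_iff.1 (hx.2 0)
    have h2 := (h1 x hx).2
    have h3 := h2.prod_fiberwise fun q =>
      hasSum_corr_singleton v₁ f ((Φ (x 1) v₂).1 q) h0
    have h4 := h.hasSum_corr hK (fun _ : Fin 1 => v₁) v₂ (y := fun _ => x 0)
      (Function.injective_of_subsingleton _) (t := x 1) fun _ => hx.1 0 1 (by decide)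
    rw [hQ, ← hP x hne, leftValue, ← h3.unique h4]
    exact ⟨pow_ne_zero _ (sub_ne_zero.2 hne), h2⟩
  · rw [hQ]
    exact pow_ne_zero _ (sub_ne_zero.2 hz)
  · rw [hQ]
    exact hP ![z₁, z₂] hz

/-- The finitely many functionals `f L(-1)^a`, pulled back to `V`, give a bound uniform in `v₂` and
`z`. -/
theorem IsWValued.exists_pair_mode_eq_zero (h : IsWValued B Φ) (v₁ : V)
    (f : restrictedDual B.gr) :
    ∃ lo : ℤ, ∀ n < lo, ∀ (v₂ : V) (z : ℂ), pair f (Φ z (mode A.Y v₁ n v₂)) = 0 := by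
  obtain ⟨K, hK⟩ := B.exists_dualLm1_pow_eq_zero f
  choose lo hlo using fun a : ℕ =>
    A.toModule.exists_dual_mode_eq_zero v₁ (h.pullback ((B.dualLm1 ^ a) f)).2
  obtain ⟨M, hM⟩ := ((Finset.range K).image fun a => -lo a).exists_le
  refine ⟨-M, fun n hn v₂ z => ?_⟩
  rw [h.pair_eq hK, expDual_apply]
  refine Finset.sum_eq_zero fun a ha => ?_
  have h1 := hM _ (Finset.mem_image_of_mem _ ha)
  have h2 : ((B.dualLm1 ^ a) f : Module.Dual ℂ W) (h.atZero (mode A.Y v₁ n v₂)) = 0 :=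
    hlo a n (by omega) v₂
  rw [h2, mul_zero]

theorem IsWValued.exists_middleValue_eq_div (h : IsWValued B Φ) (v₁ v₂ : V)
    (f : restrictedDual B.gr) :
    ∃ (P : MvPolynomial (Fin 2) ℂ) (N : ℕ), ∀ x : Fin 2 → ℂ, x 0 ≠ x 1 →
      middleValue Φ v₁ v₂ f (x 0) (x 1) = MvPolynomial.eval x P / (x 0 - x 1) ^ N ∧
      HasSum (fun n : ℤ => pair f (Φ (x 1) (mode A.Y v₁ n v₂)) * (x 0 - x 1) ^ (-n - 1))
        (MvPolynomial.eval x P / (x 0 - x 1) ^ N) := by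
  obtain ⟨lo, hlo⟩ := h.exists_pair_mode_eq_zero v₁ f
  choose p hp using fun n : ℤ => h.rational (mode A.Y v₁ n v₂) f
  set N := truncOrder A.Y v₁ v₂ with hN
  refine ⟨∑ n ∈ Finset.Ico lo N, Polynomial.aeval (MvPolynomial.X 1) (p n) *
    (MvPolynomial.X 0 - MvPolynomial.X 1) ^ ((N : ℤ) - 1 - n).toNat, N, fun x hx => ?_⟩
  have hne : x 0 - x 1 ≠ 0 := sub_ne_zero.2 hx
  have hzero : ∀ n ∉ Finset.Ico lo (N : ℤ),
      pair f (Φ (x 1) (mode A.Y v₁ n v₂)) * (x 0 - x 1) ^ (-n - 1) = 0 := by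
    intro n hn
    rw [Finset.mem_Ico, not_and_or, not_le, not_lt] at hn
    rcases hn with hn | hn
    · rw [hlo n hn, zero_mul]
    · rw [mode_eq_zero_of_truncOrder_le A.Y v₁ v₂ hn, map_zero, pair_zero, zero_mul]
  have hval : MvPolynomial.eval x (∑ n ∈ Finset.Ico lo (N : ℤ),
      Polynomial.aeval (MvPolynomial.X 1) (p n) *
        (MvPolynomial.X 0 - MvPolynomial.X 1) ^ ((N : ℤ) - 1 - n).toNat) / (x 0 - x 1) ^ N =
      ∑ n ∈ Finset.Ico lo (N : ℤ),
        pair f (Φ (x 1) (mode A.Y v₁ n v₂)) * (x 0 - x 1) ^ (-n - 1) := by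
    rw [map_sum, Finset.sum_div]
    refine Finset.sum_congr rfl fun n hn => ?_
    rw [Finset.mem_Ico] at hn
    rw [map_mul, eval_aeval_X, ← hp, map_pow, map_sub, MvPolynomial.eval_X, MvPolynomial.eval_X,
      mul_div_assoc, ← zpow_natCast, ← zpow_natCast, ← zpow_sub₀ hne,
      Int.toNat_of_nonneg (by omega)]
    congr 2
    ring
  rw [hval]
  refine ⟨finsum_eq_sum_of_support_subset _ fun n hn => ?_, hasSum_sum_of_ne_finset_zero hzero⟩
  by_contra hn'
  exact hn (hzero n hn')

theorem IsWValued.isMiddleTerm (h : IsWValued B Φ) (v₁ v₂ : V) (f : restrictedDual B.gr)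
    {z₁ z₂ : ℂ} (hz : z₁ ≠ z₂) :
    IsMiddleTerm B Φ v₁ v₂ f z₁ z₂ (middleValue Φ v₁ v₂ f z₁ z₂) := by
  obtain ⟨P, N, hP⟩ := h.exists_middleValue_eq_div v₁ v₂ f
  have hQ : ∀ x : Fin 2 → ℂ, MvPolynomial.eval x
      ((MvPolynomial.X 0 - MvPolynomial.X 1 : MvPolynomial (Fin 2) ℂ) ^ N) = (x 0 - x 1) ^ N :=
    fun x => by simp
  refine ⟨P, (MvPolynomial.X 0 - MvPolynomial.X 1) ^ N, fun x hx => ?_, ?_, ?_⟩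
  · rw [hQ]
    exact ⟨pow_ne_zero _ (sub_ne_zero.2 hx), (hP x hx).2⟩
  · rw [hQ]
    exact pow_ne_zero _ (sub_ne_zero.2 hz)
  · rw [hQ]
    exact (hP ![z₁, z₂] hz).1

/-- The value at `(z₁, z₂)` of a matrix element of the two-point connection form. -/
def IsWValued.formValue (h : IsWValued B Φ) (K : ℕ) (v₁ v₂ : V) (f : restrictedDual B.gr)
    (z₁ z₂ : ℂ) : ℂ :=
  h.leftValue K v₁ v₂ f z₁ z₂ - middleValue Φ v₁ v₂ f z₁ z₂ + h.leftValue K v₂ v₁ f z₂ z₁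

theorem FormVanishes.formValue_eq_zero {v₁ v₂ : V} {f : restrictedDual B.gr} {z₁ z₂ : ℂ}
    (hv : FormVanishes B Φ v₁ v₂ f z₁ z₂) (h : IsWValued B Φ) {K : ℕ}
    (hK : (B.dualLm1 ^ K) f = 0) (hz : z₁ ≠ z₂) : h.formValue K v₁ v₂ f z₁ z₂ = 0 := by
  obtain ⟨c₁, c₂, c₃, h1, h2, h3, h4⟩ := hv
  -- Values of rational extensions are unique. For the middle term this is applied after restriction
  -- to the ordered region.
  have e1 : c₁ = _ := RationalValue.unique h1 (h.isLeftTerm hK h1 hz)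
  have e3 : c₃ = _ := RationalValue.unique h3 (h.isLeftTerm hK h3 hz.symm)
  have e2 : c₂ = _ := RationalValue.unique
    (RationalValue.mono h2 fun x hx => apply_zero_ne_of_mem_orderedRegion hx)
    (RationalValue.mono (h.isMiddleTerm v₁ v₂ f hz) fun x hx =>
      apply_zero_ne_of_mem_orderedRegion hx)
  rw [IsWValued.formValue, ← e1, ← e2, ← e3, h4]

/-- Vanishing at one pair of points is used only for the convergence it contains. -/
theorem FormVanishes.of_formValue_eq_zero {v₁ v₂ : V} {f : restrictedDual B.gr} {y₁ y₂ : ℂ}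
    (hv : FormVanishes B Φ v₁ v₂ f y₁ y₂) (h : IsWValued B Φ) {K : ℕ}
    (hK : (B.dualLm1 ^ K) f = 0) {z₁ z₂ : ℂ} (hz : z₁ ≠ z₂)
    (h0 : h.formValue K v₁ v₂ f z₁ z₂ = 0) : FormVanishes B Φ v₁ v₂ f z₁ z₂ := by
  obtain ⟨c₁, c₂, c₃, h1, h2, h3, h4⟩ := hv
  exact ⟨_, _, _, h.isLeftTerm hK h1 hz, h.isMiddleTerm v₁ v₂ f hz, h.isLeftTerm hK h3 hz.symm, h0⟩

theorem IsWValued.formValue_add (h : IsWValued B Φ) {K : ℕ} {f : restrictedDual B.gr}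
    (hK : (B.dualLm1 ^ K) f = 0) (v₁ v₂ : V) {z₁ z₂ : ℂ} (hz : z₁ ≠ z₂) (t : ℂ) :
    h.formValue K v₁ v₂ f (z₁ + t) (z₂ + t) = h.formValue K v₁ v₂ (B.expDual K t f) z₁ z₂ := by
  rw [formValue, formValue, h.leftValue_add hK _ _ hz, h.leftValue_add hK _ _ hz.symm,
    h.middleValue_add hK]

theorem IsWValued.exists_formValue_eq_div (h : IsWValued B Φ) (K : ℕ) (v₁ v₂ : V)
    (f : restrictedDual B.gr) (z₁ : ℂ) :
    ∃ (p : Polynomial ℂ) (N : ℕ), ∀ z₂, z₂ ≠ z₁ →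
      h.formValue K v₁ v₂ f z₁ z₂ = p.eval z₂ / (z₁ - z₂) ^ N := by
  obtain ⟨P₁, N₁, h1⟩ := h.exists_leftValue_eq_div K v₁ v₂ f
  obtain ⟨P₂, N₂, h2⟩ := h.exists_middleValue_eq_div v₁ v₂ f
  obtain ⟨P₃, N₃, h3⟩ := h.exists_leftValue_eq_div K v₂ v₁ f
  have hpoly : ∀ (P : MvPolynomial (Fin 2) ℂ) (g : Fin 2 → Polynomial ℂ) (x : ℂ),
      (MvPolynomial.aeval g P).eval x = MvPolynomial.eval (fun i => (g i).eval x) P := by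
    intro P g x
    have : (Polynomial.evalRingHom x).comp (MvPolynomial.aeval g).toRingHom =
        MvPolynomial.eval fun i => (g i).eval x :=
      MvPolynomial.ringHom_ext (fun r => by simp) fun i => by simp
    exact congrArg (fun φ => φ P) this
  -- Common denominator of the three terms. The sign accounts for `(z₂ - z₁)^N₃` in the third.
  refine ⟨MvPolynomial.aeval ![Polynomial.C z₁, Polynomial.X] P₁ *
      (Polynomial.C z₁ - Polynomial.X) ^ (N₂ + N₃) -
    MvPolynomial.aeval ![Polynomial.C z₁, Polynomial.X] P₂ *
      (Polynomial.C z₁ - Polynomial.X) ^ (N₁ + N₃) +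
    (-1) ^ N₃ * MvPolynomial.aeval ![Polynomial.X, Polynomial.C z₁] P₃ *
      (Polynomial.C z₁ - Polynomial.X) ^ (N₁ + N₂), N₁ + N₂ + N₃, fun z₂ hz => ?_⟩
  have hne : z₁ - z₂ ≠ 0 := sub_ne_zero.2 hz.symm
  have e1 : (fun i => (![Polynomial.C z₁, Polynomial.X] i).eval z₂) = ![z₁, z₂] := by
    funext i; fin_cases i <;> simp
  have e2 : (fun i => (![Polynomial.X, Polynomial.C z₁] i).eval z₂) = ![z₂, z₁] := by
    funext i; fin_cases i <;> simp
  have h1' : h.leftValue K v₁ v₂ f z₁ z₂ = MvPolynomial.eval ![z₁, z₂] P₁ / (z₁ - z₂) ^ N₁ :=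
    h1 ![z₁, z₂] hz.symm
  have h2' : middleValue Φ v₁ v₂ f z₁ z₂ = MvPolynomial.eval ![z₁, z₂] P₂ / (z₁ - z₂) ^ N₂ :=
    (h2 ![z₁, z₂] hz.symm).1
  have h3' : h.leftValue K v₂ v₁ f z₂ z₁ =
      MvPolynomial.eval ![z₂, z₁] P₃ * (-1) ^ N₃ / (z₁ - z₂) ^ N₃ := by
    have h4 : h.leftValue K v₂ v₁ f z₂ z₁ = MvPolynomial.eval ![z₂, z₁] P₃ / (z₂ - z₁) ^ N₃ :=
      h3 ![z₂, z₁] hz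
    rw [h4, ← neg_sub z₁ z₂, neg_pow, ← div_div, div_eq_mul_inv _ ((-1) ^ N₃), ← inv_pow,
      inv_neg_one]
  rw [formValue, h1', h2', h3']
  simp only [Polynomial.eval_add, Polynomial.eval_sub, Polynomial.eval_mul, Polynomial.eval_pow,
    Polynomial.eval_neg, Polynomial.eval_one, Polynomial.eval_C, Polynomial.eval_X, hpoly, e1, e2,
    pow_add]
  field_simp

theorem IsWValued.formVanishes (h : IsWValued B Φ) {z₀ : ℂ} {s : Set ℂ} (hs : s ∈ nhds z₀)
    (hv : ∀ (v₁ v₂ : V) (f : restrictedDual B.gr), ∀ z ∈ s, z ≠ z₀ →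
      FormVanishes B Φ v₁ v₂ f z₀ z)
    (v₁ v₂ : V) (f : restrictedDual B.gr) {z₁ z₂ : ℂ} (hz : z₁ ≠ z₂) :
    FormVanishes B Φ v₁ v₂ f z₁ z₂ := by
  obtain ⟨K, hK⟩ := B.exists_dualLm1_pow_eq_zero f
  have hinf : (s \ {z₀}).Infinite := (infinite_of_mem_nhds z₀ hs).sdiff (Set.finite_singleton z₀)
  obtain ⟨y, hys, hy⟩ := hinf.nonempty
  -- All functionals killed by the same power `K` are treated at once, because translation will
  -- replace `f` by `expDual`, which is killed by that power too.
  have key : ∀ g : restrictedDual B.gr, (B.dualLm1 ^ K) g = 0 → ∀ z, z ≠ z₀ →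
      h.formValue K v₁ v₂ g z₀ z = 0 := by
    intro g hg z hz
    obtain ⟨p, N, hp⟩ := h.exists_formValue_eq_div K v₁ v₂ g z₀
    have hp0 : p = 0 := by
      refine p.eq_zero_of_infinite_isRoot (hinf.mono fun x hx => ?_)
      have hx0 : x ≠ z₀ := hx.2
      have := (hv v₁ v₂ g x hx.1 hx0).formValue_eq_zero h hg hx0.symm
      rw [hp x hx0, div_eq_zero_iff, or_iff_left (pow_ne_zero _ (sub_ne_zero.2 hx0.symm))] at this
      exact this
    rw [hp z hz, hp0, Polynomial.eval_zero, zero_div]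
  refine (hv v₁ v₂ f y hys hy).of_formValue_eq_zero h hK hz ?_
  -- Translation by `z₁ - z₀` carries the pair `(z₀, z₂ - (z₁ - z₀))` to `(z₁, z₂)`.
  have hz' : z₀ ≠ z₂ - (z₁ - z₀) := fun e => hz (by linear_combination e)
  have h1 := h.formValue_add hK v₁ v₂ hz' (z₁ - z₀)
  rw [add_sub_cancel, sub_add_cancel, key _ (dualLm1_pow_expDual hK _) _ hz'.symm] at h1
  exact h1

end Cochain

theorem delta0_eq_zero (B : A.GeneralizedModule W) : delta0 B = 0 :=
  LinearMap.ext fun _ => funext fun _ => LinearMap.ext fun _ => sub_self _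

end GradingRestrictedVertexAlgebra.GeneralizedModule

/-! ### Comparison of closed cochains with connections at the fixed point -/

open GradingRestrictedVertexAlgebra GeneralizedModule in
theorem closedCochains_eq_fixedPointConnections {M : Type*} [TopologicalSpace M] [ChartedSpace ℂ M]
    {F : CodimOneFoliation M} (T : F.TransversalBasis) {A : GradingRestrictedVertexAlgebra V}
    (B : A.GeneralizedModule W) (m r : ℕ) (S : T.sections) {p' : M} (hp' : p' ∈ (S : Set M)) :
    closedCochains T B m = fixedPointConnections T B m r S p' := by
  have hsrc := T.coord_covers S hp'
  refine le_antisymm (fun Φ hΦ => ?_) fun Φ hΦ => ?_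
  · have h : IsWValued B Φ := hΦ.1.1
    exact ⟨⟨h, fun _ _ _ _ _ _ => h.composableOn _⟩, fun v₁ v₂ f p hp hne =>
      hΦ.2 v₁ v₂ f _ _ fun e => hne ((T.coord S).injOn hsrc hp e).symm⟩
  · have h : IsWValued B Φ := hΦ.1.1
    refine ⟨⟨h, fun _ _ _ => h.composableOn _⟩, fun v₁ v₂ f z₁ z₂ hz => ?_⟩
    -- The target of the chart is an open neighbourhood of the coordinate of the fixed point, and
    -- each of its other points is the coordinate of some `p ≠ p'`.
    refine h.formVanishes ((T.coord S).open_target.mem_nhds ((T.coord S).map_source hsrc))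
      (fun v₁ v₂ f z hz hne => ?_) v₁ v₂ f hz
    have h1 := hΦ.2 v₁ v₂ f _ ((T.coord S).map_target hz) fun e =>
      hne (by rw [← e, (T.coord S).right_inv hz])
    rwa [(T.coord S).right_inv hz] at h1

end FoliationVertex

end

open FoliationVertex in
theorem mainTheorem1 {M : Type*} [TopologicalSpace M] [T2Space M] [ChartedSpace ℂ M]
    [IsManifold 𝓘(ℂ, ℂ) ω M] (F : CodimOneFoliation M) (T : F.TransversalBasis)
    {V : Type*} [AddCommGroup V] [Module ℂ V] (A : GradingRestrictedVertexAlgebra V)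
    (hA : A.IsQuasiConformal) {W : Type*} [AddCommGroup W] [Module ℂ W]
    (B : A.GeneralizedModule W) (m r : ℕ) (hr : 1 ≤ r) (hrm : r ≤ max 1 m)
    (S : T.sections) (p' : M) (hp' : p' ∈ (S : Set M)) :
    ∃ e : FirstCohomology T B m ≃ₗ[ℂ] fixedPointConnections T B m r S p',
      ∀ Φ : closedCochains T B m, (e (Submodule.Quotient.mk Φ)).1 = Φ.1 := by
  -- There are no non-zero coboundaries, so the quotient map is an isomorphism and the rest is an
  -- equality of subspaces.
  have hbot : (LinearMap.range
      (GradingRestrictedVertexAlgebra.GeneralizedModule.delta0 B)).submoduleOf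
        (closedCochains T B m) = ⊥ := by
    rw [GradingRestrictedVertexAlgebra.GeneralizedModule.delta0_eq_zero, LinearMap.range_zero,
      Submodule.submoduleOf, Submodule.comap_bot, Submodule.ker_subtype]
  exact ⟨(Submodule.quotEquivOfEqBot _ hbot).trans
    (LinearEquiv.ofEq _ _ (closedCochains_eq_fixedPointConnections T B m r S hp')), fun Φ => rfl⟩
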